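/- Let $\beta$ be an indeterminate. For $R\in\{\mathbb Z[\beta],\mathbb Q[\beta]\}$ let $\mathfrak m\mathsf{QSym}_R\subset R[[x_1,x_2,\dots]]$ be the $R$-module of all quasisymmetric power series (possibly of unbounded degree), and write $\mathfrak m\mathsf{QSym}=\mathfrak m\mathsf{QSym}_{\mathbb Z[\beta]}$, viewed inside $\mathfrak m\mathsf{QSym}_{\mathbb Q[\beta]}$. A linearly compact (LC) $R$-module is an $R$-module $B$ dual to a free $R$-module $A$ through a bilinear form $A\times B\to R$ with $B\cong\mathrm{Hom}_R(A,R)$; a pseudobasis of $B$ is a family dual to a basis of $A$; continuous linear maps $B\to B'$ are the adjoints of linear maps $A'\to A$; $B\mathbin{\hat\otimes}B'=\mathrm{Hom}_R(A\otimes A',R)$; an LC-Hopf algebra structure on $B$ is one dual to a Hopf algebra structure on $A$; morphisms are the continuous linear maps commuting with (co)products and (co)units. The module $\mathfrak m\mathsf{QSym}_R$ is an LC-Hopf algebra whose pseudobasis consists of the monomial quasisymmetric functions $M_\alpha$, with the product of power series and the coproduct $\Delta(M_\alpha)=\sum_{\alpha=\alpha'\alpha''}M_{\alpha'}\otimes M_{\alpha''}$.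 A submodule with a given pseudobasis is an LC-Hopf subalgebra if, with that pseudobasis, it carries an LC-Hopf algebra structure for which the inclusion is a morphism. For a composition $\alpha=(\alpha_1,\dots,\alpha_l)$ of $N=|\alpha|$ put $I(\alpha)=\{\alpha_1,\alpha_1+\alpha_2,\dots,\alpha_1+\dots+\alpha_{l-1}\}$; $\alpha$ is a peak composition if $I(\alpha)$ contains neither $1$ nor two consecutive integers. Let $\mathbb M=\{1'<1<2'<2<\cdots\}$. For finite nonempty $S,T\subset\mathbb M$ write $S\preceq T$ if $\max S\le\min T$ and $S\prec T$ if $\max S<\min T$. For an $N$-tuple $S=(S_1,\dots,S_N)$ of finite nonempty subsets of $\mathbb M$ put $|S|=\sum_i|S_i|$ and $x^S=\prod_i\prod_{a\in S_i}x_{|a|}$, where $|j'|=|j|=j$. For a peak composition $\alpha$ of $N$ define $$K^{(\beta)}_\alpha=\sum_S\beta^{|S|-N}x^S,\qquad \bar K^{(\beta)}_\alpha=\sum_S\beta^{|S|-N}x^S,$$ where in the first sum $S$ runs over the tuples with $S_1\preceq\dots\preceq S_N$ such that, for $1\le i<N$, $S_i\cap S_{i+1}\subset\{1',2',\dots\}$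 if $i\in I(\alpha)$ and $S_i\cap S_{i+1}\subset\{1,2,\dots\}$ if $i\notin I(\alpha)$; and in the second sum $S$ runs over the tuples with $S_1\preceq\dots\preceq S_N$ such that $S_1\subset\{1,2,\dots\}$ (if $N\geq 1$) and, for $1\le i<N$, $S_i\prec S_{i+1}$ and $S_{i+1}\subset\{1,2,\dots\}$ if $i\in I(\alpha)$, and $S_i\cap S_{i+1}\subset\{1,2,\dots\}$ if $i\notin I(\alpha)$. Let $\mathfrak m\mathrm{Peak}$ and $\mathfrak m\bar\Pi\mathrm{Sym}$ be the sets of all (possibly infinite) $\mathbb Z[\beta]$-linear combinations of the $K^{(\beta)}_\alpha$ and of the $\bar K^{(\beta)}_\alpha$, respectively, and let $\mathfrak m\mathrm{Peak}_{\mathbb Q[\beta]}$ be the set of all (possibly infinite) $\mathbb Q[\beta]$-linear combinations of the $K^{(\beta)}_\alpha$, where $\alpha$ ranges over all peak compositions. **Theorem.** $\mathfrak m\mathrm{Peak}$ with pseudobasis $\{K^{(\beta)}_\alpha\}$ and $\mathfrak m\bar\Pi\mathrm{Sym}$ with pseudobasis $\{\bar K^{(\beta)}_\alpha\}$ are LC-Hopf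 subalgebras of $\mathfrak m\mathsf{QSym}$, and $$\mathfrak m\bar\Pi\mathrm{Sym}=\mathfrak m\mathsf{QSym}\cap\mathfrak m\mathrm{Peak}_{\mathbb Q[\beta]}\supseteq\mathfrak m\mathrm{Peak}.$$ -/

import Mathlib

open scoped TensorProduct

noncomputable section

/-! ### The Hopf algebra of noncommutative symmetric functions

This is the Hopf algebra to which the quasisymmetric power series are dual: the free associative
algebra on `h 1, h 2, …`, with `Δ (h n) = ∑_{i + j = n} h i ⊗ h j` where `h 0 = 1`. -/

/-- The free associative algebra on one generator for each positive integer. -/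
abbrev NSym (R : Type) [CommRing R] : Type := FreeAlgebra R ℕ+

namespace NSym

variable {R : Type} [CommRing R]

/-- The generator `h n`, with the convention `h 0 = 1`. -/
def h : ℕ → NSym R
  | 0 => 1
  | n + 1 => FreeAlgebra.ι R n.succPNat

theorem h_zero : (h 0 : NSym R) = 1 := rfl

theorem h_pnat (n : ℕ+) : (h n : NSym R) = FreeAlgebra.ι R n := by
  obtain ⟨k, rfl⟩ : ∃ k : ℕ, n = k.succPNat := ⟨n.natPred, by simp⟩
  rfl

/-- The coproduct, `h n ↦ ∑_{i + j = n} h i ⊗ h j`. -/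
def comulHom : NSym R →ₐ[R] NSym R ⊗[R] NSym R :=
  FreeAlgebra.lift R fun n : ℕ+ => ∑ p ∈ Finset.HasAntidiagonal.antidiagonal (n : ℕ), h p.1 ⊗ₜ[R] h p.2

/-- The counit, killing every generator. -/
def counitHom : NSym R →ₐ[R] R := FreeAlgebra.lift R fun _ => 0

theorem comulHom_h (n : ℕ) :
    comulHom (h n : NSym R) = ∑ p ∈ Finset.HasAntidiagonal.antidiagonal n, h p.1 ⊗ₜ[R] h p.2 := by
  rcases Nat.eq_zero_or_pos n with rfl | hn
  · simp [h_zero, Algebra.TensorProduct.one_def]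
  · lift n to ℕ+ using hn
    rw [h_pnat, comulHom, FreeAlgebra.lift_ι_apply]

theorem counitHom_h (n : ℕ) : counitHom (h n : NSym R) = if n = 0 then 1 else 0 := by
  rcases Nat.eq_zero_or_pos n with rfl | hn
  · simp [h_zero]
  · lift n to ℕ+ using hn
    rw [h_pnat, counitHom, FreeAlgebra.lift_ι_apply]
    simp

instance : Bialgebra R (NSym R) :=
  Bialgebra.ofAlgHom comulHom counitHom
    (by
      ext n
      simp only [Function.comp_apply, AlgHom.coe_comp, ← h_pnat, comulHom_h, map_sum]
      simp only [Algebra.TensorProduct.map_tmul, comulHom_h, AlgHom.coe_id, id_eq,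
        TensorProduct.sum_tmul, TensorProduct.tmul_sum, map_sum]
      rw [Finset.sum_sigma', Finset.sum_sigma']
      refine Finset.sum_bij' (fun x _ => ⟨(x.2.1, x.2.2 + x.1.2), (x.2.2, x.1.2)⟩)
        (fun x _ => ⟨(x.1.1 + x.2.1, x.2.2), (x.1.1, x.2.1)⟩) ?_ ?_ ?_ ?_ ?_
      all_goals
        rintro ⟨⟨a, b⟩, ⟨c, d⟩⟩ hx
        simp only [Finset.mem_sigma, Finset.HasAntidiagonal.mem_antidiagonal] at hx ⊢
      · exact ⟨by omega, trivial⟩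
      · exact ⟨by omega, trivial⟩
      · obtain ⟨-, rfl⟩ := hx; rfl
      · obtain ⟨-, rfl⟩ := hx; rfl
      · rfl)
    (by
      ext n
      simp only [Function.comp_apply, AlgHom.coe_comp, ← h_pnat, comulHom_h, map_sum]
      simp only [Algebra.TensorProduct.map_tmul, counitHom_h, AlgHom.coe_id, id_eq]
      rw [Finset.sum_eq_single (0, (n : ℕ))]
      · simp
      · rintro ⟨i, j⟩ hij hne
        have : i ≠ 0 := by rintro rfl; simp_all
        simp [this]
      · simp)
    (by
      ext n
      simp only [Function.comp_apply, AlgHom.coe_comp, ← h_pnat, comulHom_h, map_sum]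
      simp only [Algebra.TensorProduct.map_tmul, counitHom_h, AlgHom.coe_id, id_eq]
      rw [Finset.sum_eq_single ((n : ℕ), 0)]
      · simp
      · rintro ⟨i, j⟩ hij hne
        have : j ≠ 0 := by rintro rfl; simp_all
        simp [this]
      · simp)

/-- The values of the antipode on generators: the coefficients of the inverse of `∑ h n tⁿ`. -/
def s (n : ℕ) : NSym R := PowerSeries.coeff n (PowerSeries.invOfUnit (PowerSeries.mk h) 1)

theorem sum_s_mul_h (n : ℕ) :
    ∑ p ∈ Finset.HasAntidiagonal.antidiagonal n, (s p.1 : NSym R) * h p.2 = if n = 0 then 1 else 0 := by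
  have := congrArg (PowerSeries.coeff n)
    (PowerSeries.invOfUnit_mul (PowerSeries.mk (h (R := R))) 1 (by simp [h_zero]))
  rw [PowerSeries.coeff_mul, PowerSeries.coeff_one] at this
  simpa [s] using this

theorem sum_h_mul_s (n : ℕ) :
    ∑ p ∈ Finset.HasAntidiagonal.antidiagonal n, (h p.1 : NSym R) * s p.2 = if n = 0 then 1 else 0 := by
  have := congrArg (PowerSeries.coeff n)
    (PowerSeries.mul_invOfUnit (PowerSeries.mk (h (R := R))) 1 (by simp [h_zero]))
  rw [PowerSeries.coeff_mul, PowerSeries.coeff_one] at this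
  simpa [s] using this

theorem s_zero : (s 0 : NSym R) = 1 := by
  simpa [h_zero] using sum_s_mul_h (R := R) 0

/-- The antipode, as an algebra morphism to the opposite algebra. -/
def antipodeHom : NSym R →ₐ[R] (NSym R)ᵐᵒᵖ :=
  FreeAlgebra.lift R fun n : ℕ+ => MulOpposite.op (s n)

/-- The antipode, as a linear map. -/
def antipodeLin : NSym R →ₗ[R] NSym R :=
  (MulOpposite.opLinearEquiv R).symm.toLinearMap ∘ₗ antipodeHom.toLinearMap

theorem antipodeLin_mul (a b : NSym R) :
    antipodeLin (a * b) = antipodeLin b * antipodeLin a := by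
  simp [antipodeLin]

theorem antipodeLin_h (n : ℕ) : antipodeLin (h n : NSym R) = s n := by
  rcases Nat.eq_zero_or_pos n with rfl | hn
  · simp [h_zero, s_zero, antipodeLin]
  · lift n to ℕ+ using hn
    rw [h_pnat]
    simp [antipodeLin, antipodeHom]

theorem comul_eq (a : NSym R) : Coalgebra.comul (R := R) a = comulHom a := rfl
theorem counit_eq (a : NSym R) : Coalgebra.counit (R := R) a = counitHom a := rfl

instance : HopfAlgebra R (NSym R) where
  antipode := antipodeLin
  mul_antipode_rTensor_comul := by
    ext a
    induction a using FreeAlgebra.induction with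
    | grade0 r => simp [Algebra.TensorProduct.one_def, Algebra.algebraMap_eq_smul_one, antipodeLin]
    | grade1 n =>
      simp only [← h_pnat, LinearMap.comp_apply, comul_eq, counit_eq, comulHom_h, counitHom_h,
        map_sum, LinearMap.rTensor_tmul, LinearMap.mul'_apply, antipodeLin_h, sum_s_mul_h]
      simp
    | mul a b ha hb =>
      simp only [LinearMap.comp_apply, comul_eq, counit_eq, map_mul,
        Algebra.linearMap_apply] at ha hb ⊢
      have key : ∀ x y : NSym R ⊗[R] NSym R, 
          LinearMap.mul' R _ (LinearMap.rTensor _ antipodeLin (x * y)) =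
          LinearMap.mul' R _ (LinearMap.rTensor _ antipodeLin
            ((1 ⊗ₜ LinearMap.mul' R _ (LinearMap.rTensor _ antipodeLin x)) * y)) := by
        intro x y
        induction x with
        | zero => simp
        | add x x' hx hx' => simp [add_mul, TensorProduct.tmul_add, hx, hx']
        | tmul x x' =>
          induction y with
          | zero => simp
          | add y y' hy hy' => simp only [mul_add, map_add, hy, hy']
          | tmul y y' => simp [antipodeLin_mul, mul_assoc]
      rw [key, ha]
      have : (1 ⊗ₜ[R] (algebraMap R (NSym R)) (counitHom a) : NSym R ⊗[R] NSym R) =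
          counitHom a • 1 := by
        rw [Algebra.algebraMap_eq_smul_one, TensorProduct.tmul_smul, Algebra.TensorProduct.one_def]
      rw [this, smul_mul_assoc, one_mul, map_smul, map_smul, hb, Algebra.smul_def]
    | add a b ha hb => simp only [map_add, ha, hb]
  mul_antipode_lTensor_comul := by
    ext a
    induction a using FreeAlgebra.induction with
    | grade0 r => simp [Algebra.TensorProduct.one_def, Algebra.algebraMap_eq_smul_one, antipodeLin]
    | grade1 n =>
      simp only [← h_pnat, LinearMap.comp_apply, comul_eq, counit_eq, comulHom_h, counitHom_h,
        map_sum, LinearMap.lTensor_tmul, LinearMap.mul'_apply, antipodeLin_h, sum_h_mul_s]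
      simp
    | mul a b ha hb =>
      simp only [LinearMap.comp_apply, comul_eq, counit_eq, map_mul,
        Algebra.linearMap_apply] at ha hb ⊢
      have key : ∀ x y : NSym R ⊗[R] NSym R, 
          LinearMap.mul' R _ (LinearMap.lTensor _ antipodeLin (x * y)) =
          LinearMap.mul' R _ (LinearMap.lTensor _ antipodeLin
            (x * (LinearMap.mul' R _ (LinearMap.lTensor _ antipodeLin y) ⊗ₜ 1))) := by
        intro x y
        induction x with
        | zero => simp
        | add x x' hx hx' => simp only [add_mul, map_add, hx, hx']
        | tmul x x' =>
          induction y with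
          | zero => simp
          | add y y' hy hy' => simp only [mul_add, map_add, TensorProduct.add_tmul, hy, hy']
          | tmul y y' => simp [antipodeLin_mul, mul_assoc]
      rw [key, hb]
      have : ((algebraMap R (NSym R)) (counitHom b) ⊗ₜ[R] 1 : NSym R ⊗[R] NSym R) =
          counitHom b • 1 := by
        rw [Algebra.algebraMap_eq_smul_one, ← TensorProduct.smul_tmul',
          Algebra.TensorProduct.one_def]
      rw [this, mul_smul_comm, mul_one, map_smul, map_smul, ha, Algebra.smul_def, Algebra.commutes]
    | add a b ha hb => simp only [map_add, ha, hb]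

end NSym

/-! ### Quasisymmetric power series

The variables `x_1, x_2, …` are indexed by `ℕ`, the index `j` standing for `x_{j+1}`. Compositions
are lists of positive integers. -/

section QSym

variable {R : Type} [CommRing R]

/-- The exponent vector of the monomial `∏_t x_{i t} ^ (a t)`. -/
def expAt {k : ℕ} (a : Fin k → ℕ+) (i : Fin k → ℕ) : ℕ →₀ ℕ :=
  ∑ t, Finsupp.single (i t) (a t : ℕ)

/-- For all `i_1 < ⋯ < i_k` and all positive `a_1, …, a_k`, the coefficients of
`x_{i_1}^{a_1} ⋯ x_{i_k}^{a_k}` and of `x_1^{a_1} ⋯ x_k^{a_k}` agree. -/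
def IsQuasisymmetric (f : MvPowerSeries ℕ R) : Prop :=
  ∀ (k : ℕ) (a : Fin k → ℕ+) (i : Fin k → ℕ), StrictMono i →
    MvPowerSeries.coeff (expAt a i) f = MvPowerSeries.coeff (expAt a fun t => (t : ℕ)) f

theorem exists_expAt (m : ℕ →₀ ℕ) :
    ∃ (k : ℕ) (a : Fin k → ℕ+) (i : Fin k → ℕ), StrictMono i ∧ m = expAt a i := by
  refine ⟨m.support.card, fun t => ⟨m (m.support.orderEmbOfFin rfl t), ?_⟩,
    m.support.orderEmbOfFin rfl, (m.support.orderEmbOfFin rfl).strictMono, ?_⟩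
  · exact Nat.pos_of_ne_zero (Finsupp.mem_support_iff.1 (m.support.orderEmbOfFin_mem rfl t))
  · conv_lhs => rw [← Finsupp.sum_single m, Finsupp.sum,
      ← Finset.map_orderEmbOfFin_univ m.support rfl, Finset.sum_map]
    rfl

theorem exists_orderEmbedding {k : ℕ} (i : Fin k → ℕ) (hi : StrictMono i) :
    ∃ e : ℕ ↪o ℕ, ∀ t : Fin k, e t = i t := by
  refine ⟨OrderEmbedding.ofStrictMono
    (fun n => if h : n < k then i ⟨n, h⟩ else n + ∑ t, i t) ?_, fun t => dif_pos t.2⟩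
  intro n m hnm
  dsimp only
  split_ifs with h1 h2 h2
  · exact hi hnm
  · have : i ⟨n, h1⟩ ≤ ∑ t, i t :=
      Finset.single_le_sum (f := i) (fun _ _ => Nat.zero_le _) (Finset.mem_univ _)
    omega
  · omega
  · omega

theorem embDomain_expAt {k : ℕ} (a : Fin k → ℕ+) (i : Fin k → ℕ) (e : ℕ ↪ ℕ) :
    (expAt a i).embDomain e = expAt a (e ∘ i) := by
  rw [Finsupp.embDomain_eq_mapDomain, expAt, Finsupp.mapDomain_finsetSum]
  simp [expAt]

theorem isQuasisymmetric_iff (f : MvPowerSeries ℕ R) :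
    IsQuasisymmetric f ↔ ∀ e : ℕ ↪o ℕ, MvPowerSeries.killCompl e.toEmbedding f = f := by
  constructor
  · intro hf e
    ext m
    obtain ⟨k, a, i, hi, rfl⟩ := exists_expAt m
    rw [MvPowerSeries.coeff_killCompl, embDomain_expAt, hf k a i hi]
    exact hf k a _ (e.strictMono.comp hi)
  · intro hf k a i hi
    obtain ⟨e, he⟩ := exists_orderEmbedding i hi
    rw [show i = e.toEmbedding ∘ fun t : Fin k => (t : ℕ) from funext fun t => (he t).symm,
      ← embDomain_expAt, ← MvPowerSeries.coeff_killCompl, hf]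

variable (R) in
/-- The algebra of all quasisymmetric power series (of possibly unbounded degree). -/
def mQSym : Subalgebra R (MvPowerSeries ℕ R) where
  carrier := {f | IsQuasisymmetric f}
  mul_mem' := by
    intro f g hf hg
    simp only [Set.mem_ofPred_eq, isQuasisymmetric_iff] at hf hg ⊢
    intro e
    rw [map_mul, hf e, hg e]
  add_mem' := by
    intro f g hf hg
    simp only [Set.mem_ofPred_eq, isQuasisymmetric_iff] at hf hg ⊢
    intro e
    rw [map_add, hf e, hg e]
  algebraMap_mem' := by
    intro r
    simp only [Set.mem_ofPred_eq, isQuasisymmetric_iff]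
    intro e
    exact AlgHom.commutes _ r

/-- The coefficient of the monomial quasisymmetric function `M_α` in a quasisymmetric series, that is
the coefficient of `x_1^{α_1} ⋯ x_l^{α_l}`. -/
def coeffM (α : List ℕ+) : mQSym R →ₗ[R] R :=
  MvPowerSeries.coeff (expAt α.get fun t => (t : ℕ)) ∘ₗ (mQSym R).val.toLinearMap

/-- The form `NSym × mQSym → R` for which the words `h_α` and the monomial quasisymmetric functions
`M_α` are dual: `⟨h_α, f⟩` is the coefficient of `M_α` in `f`. -/
def nsymForm : NSym R →ₗ[R] mQSym R →ₗ[R] R :=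
  (FreeAlgebra.basisFreeMonoid R ℕ+).constr R fun w => coeffM w.toList

namespace NSym

theorem basis_apply (w : FreeMonoid ℕ+) :
    FreeAlgebra.basisFreeMonoid R ℕ+ w = (w.toList.map fun n : ℕ+ => (h n : NSym R)).prod := by
  have h1 : FreeAlgebra.basisFreeMonoid R ℕ+ w =
      FreeAlgebra.equivMonoidAlgebraFreeMonoid.symm (MonoidAlgebra.of R (FreeMonoid ℕ+) w) := rfl
  rw [h1]
  change MonoidAlgebra.lift R (FreeAlgebra R ℕ+) (FreeMonoid ℕ+)
    (FreeMonoid.lift (FreeAlgebra.ι R)) _ = _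
  rw [MonoidAlgebra.lift_of, FreeMonoid.lift_apply]
  simp only [h_pnat]

theorem nsymForm_prod (w : List ℕ+) (f : mQSym R) :
    nsymForm (w.map fun n : ℕ+ => (h n : NSym R)).prod f = coeffM w f := by
  have := basis_apply (R := R) (FreeMonoid.ofList w)
  rw [FreeMonoid.toList_ofList] at this
  rw [← this, nsymForm, Module.Basis.constr_basis, FreeMonoid.toList_ofList]

theorem coeffM_ofFn {k : ℕ} (a : Fin k → ℕ+) (i : Fin k → ℕ) (hi : StrictMono i)
    (f : mQSym R) : coeffM (List.ofFn a) f = MvPowerSeries.coeff (expAt a i) f.1 := by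
  rw [f.2 k a i hi]
  have : expAt (List.ofFn a).get (fun t => (t : ℕ)) = expAt a fun t => (t : ℕ) :=
    Fintype.sum_equiv (finCongr (List.length_ofFn (f := a))) _ _ fun t => by simp [Fin.cast]
  rw [← this]
  rfl

/-- The word `h_{m 0} h_{m 1} ⋯ h_{m (L-1)}`. -/
def hr (L : ℕ) (m : ℕ →₀ ℕ) : NSym R := ((List.range L).map fun j => h (m j)).prod

theorem range_map_prod {M : Type} [Monoid M] {k : ℕ} (L : ℕ) (i : Fin k → ℕ) (hi : StrictMono i)
    (hL : ∀ t, i t < L) (g : ℕ → M) (hg : ∀ j, j ∉ Set.range i → g j = 1) :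
    ((List.range L).map g).prod = (List.ofFn (g ∘ i)).prod := by
  classical
  have h1 : (List.range L).filter (fun j => decide (j ∈ Set.range i)) = List.ofFn i := by
    apply List.Perm.eq_of_sortedLE
    · exact (List.pairwise_le_range.filter _).sortedLE
    · exact hi.monotone.sortedLE_ofFn
    · rw [List.perm_ext_iff_of_nodup]
      · intro j
        simp only [List.mem_filter, List.mem_range, decide_eq_true_eq, List.mem_ofFn]
        exact ⟨fun h => h.2, fun h => ⟨by obtain ⟨t, rfl⟩ := h; exact hL t, h⟩⟩
      · exact List.nodup_range.filter _
      · exact List.nodup_ofFn.2 hi.injective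
  have h2 : ∀ l : List ℕ, (l.map g).prod =
      ((l.filter (fun j => decide (j ∈ Set.range i))).map g).prod := by
    intro l
    induction l with
    | nil => rfl
    | cons x l ih =>
      by_cases hx : x ∈ Set.range i
      · rw [List.filter_cons_of_pos (by simpa using hx)]
        simp [ih]
      · rw [List.filter_cons_of_neg (by simpa using hx), List.map_cons, List.prod_cons, hg x hx,
          one_mul, ih]
  rw [h2, h1, List.map_ofFn]

theorem expAt_apply_of_notMem {k : ℕ} (a : Fin k → ℕ+) (i : Fin k → ℕ) {j : ℕ}
    (hj : j ∉ Set.range i) : expAt a i j = 0 := by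
  simp only [expAt, Finsupp.coe_finsetSum, Finset.sum_apply]
  refine Finset.sum_eq_zero fun t _ => Finsupp.single_eq_of_ne ?_
  rintro rfl
  exact hj ⟨t, rfl⟩

theorem expAt_apply {k : ℕ} (a : Fin k → ℕ+) (i : Fin k → ℕ) (hi : StrictMono i) (t : Fin k) :
    expAt a i (i t) = a t := by
  simp only [expAt, Finsupp.coe_finsetSum, Finset.sum_apply]
  rw [Finset.sum_eq_single t]
  · simp
  · intro u _ hu
    exact Finsupp.single_eq_of_ne (hi.injective.ne hu.symm)
  · simp

theorem hr_expAt {k : ℕ} (L : ℕ) (a : Fin k → ℕ+) (i : Fin k → ℕ) (hi : StrictMono i)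
    (hL : ∀ t, i t < L) :
    (hr L (expAt a i) : NSym R) = ((List.ofFn a).map fun n : ℕ+ => (h n : NSym R)).prod := by
  rw [hr, range_map_prod L i hi hL _ (fun j hj => by rw [expAt_apply_of_notMem a i hj, h_zero]),
    List.map_ofFn]
  congr 2
  funext t
  simp [expAt_apply a i hi t]

theorem lt_of_support {k : ℕ} {L : ℕ} {a : Fin k → ℕ+} {i : Fin k → ℕ} (hi : StrictMono i)
    (hL : ∀ j, L ≤ j → expAt a i j = 0) (t : Fin k) : i t < L := by
  by_contra hlt
  have := hL (i t) (not_lt.1 hlt)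
  rw [expAt_apply a i hi] at this
  exact (a t).ne_zero this

theorem nsymForm_hr (L : ℕ) (m : ℕ →₀ ℕ) (hL : ∀ j, L ≤ j → m j = 0) (f : mQSym R) :
    nsymForm (hr L m) f = MvPowerSeries.coeff m f.1 := by
  obtain ⟨k, a, i, hi, rfl⟩ := exists_expAt m
  rw [hr_expAt L a i hi (lt_of_support hi hL), nsymForm_prod, coeffM_ofFn a i hi]

theorem comulHom_hr (L : ℕ) (m : ℕ →₀ ℕ) (hL : ∀ j, L ≤ j → m j = 0) :
    comulHom (hr L m : NSym R) =
      ∑ p ∈ Finset.HasAntidiagonal.antidiagonal m, hr L p.1 ⊗ₜ[R] hr L p.2 := by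
  induction L generalizing m with
  | zero =>
    obtain rfl : m = 0 := Finsupp.ext fun j => hL j (Nat.zero_le j)
    simp [hr, Algebra.TensorProduct.one_def]
  | succ L ih =>
    have hsucc : ∀ u : ℕ →₀ ℕ, (hr (L + 1) u : NSym R) = hr L u * h (u L) := by
      intro u
      simp [hr, List.range_succ]
    have hcongr : ∀ u v : ℕ →₀ ℕ, (∀ j, j < L → u j = v j) → (hr L u : NSym R) = hr L v := by
      intro u v huv
      rw [hr, hr]
      congr 1
      refine List.map_congr_left fun j hj => ?_
      rw [huv j (List.mem_range.1 hj)]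
    have herase : ∀ u : ℕ →₀ ℕ, (hr L (u.erase L) : NSym R) = hr L u := fun u =>
      hcongr _ _ fun j hj => Finsupp.erase_ne hj.ne
    rw [hsucc, map_mul, comulHom_h, ← herase m, ih (m.erase L), Finset.sum_mul_sum,
      ← Finset.sum_product']
    · refine Finset.sum_bij'
        (fun x _ => (x.1.1 + Finsupp.single L x.2.1, x.1.2 + Finsupp.single L x.2.2))
        (fun p _ => ((p.1.erase L, p.2.erase L), (p.1 L, p.2 L))) ?_ ?_ ?_ ?_ ?_
      · rintro ⟨⟨a, b⟩, ⟨c, d⟩⟩ hx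
        simp only [Finset.mem_product, Finset.HasAntidiagonal.mem_antidiagonal] at hx ⊢
        rw [← Finsupp.erase_add_single L m, ← hx.1, ← hx.2, Finsupp.single_add]
        abel
      · rintro ⟨a, b⟩ hx
        simp only [Finset.mem_product, Finset.HasAntidiagonal.mem_antidiagonal] at hx ⊢
        subst hx
        exact ⟨(Finsupp.erase_add _ _ _).symm, rfl⟩
      · rintro ⟨⟨a, b⟩, ⟨c, d⟩⟩ hx
        simp only [Finset.mem_product, Finset.HasAntidiagonal.mem_antidiagonal] at hx
        have h0 : a L + b L = 0 := by
          rw [← Finsupp.add_apply, hx.1, Finsupp.erase_same]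
        have ha : a L = 0 := by omega
        have hb : b L = 0 := by omega
        have ha' : a.erase L = a := Finsupp.erase_of_notMem_support (by simpa using ha)
        have hb' : b.erase L = b := Finsupp.erase_of_notMem_support (by simpa using hb)
        simp [Finsupp.erase_add, ha, hb]
      · rintro ⟨a, b⟩ hx
        simp [Finsupp.erase_add_single]
      · rintro ⟨⟨a, b⟩, ⟨c, d⟩⟩ hx
        simp only [Finset.mem_product, Finset.HasAntidiagonal.mem_antidiagonal] at hx
        have h0 : a L + b L = 0 := by
          rw [← Finsupp.add_apply, hx.1, Finsupp.erase_same]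
        have ha : a L = 0 := by omega
        have hb : b L = 0 := by omega
        have hh : ∀ (u : ℕ →₀ ℕ) (c : ℕ),
            (hr L (u + Finsupp.single L c) : NSym R) = hr L u := fun u c =>
          hcongr _ _ fun j hj => by simp [Finsupp.single_eq_of_ne hj.ne]
        simp [hsucc, hh, ha, hb]
    · intro j hj
      rcases hj.eq_or_lt with rfl | hj
      · exact Finsupp.erase_same
      · rw [Finsupp.erase_ne hj.ne', hL j hj]

theorem exists_bound (m : ℕ →₀ ℕ) : ∃ L, ∀ j, L ≤ j → m j = 0 :=
  ⟨m.support.sup id + 1, fun j hj => by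
    by_contra h
    have := Finset.le_sup (f := id) (Finsupp.mem_support_iff.2 h)
    simp only [id] at this
    omega⟩

theorem basis_eq_hr (w : FreeMonoid ℕ+) :
    ∃ L m, (∀ j, L ≤ j → m j = 0) ∧ FreeAlgebra.basisFreeMonoid R ℕ+ w = hr L m := by
  refine ⟨w.toList.length, expAt w.toList.get fun t => (t : ℕ), ?_, ?_⟩
  · intro j hj
    refine expAt_apply_of_notMem _ _ ?_
    rintro ⟨t, rfl⟩
    exact absurd t.2 (not_lt.2 hj)
  · rw [hr_expAt _ _ _ (fun _ _ h => h) (fun t => t.2), basis_apply, List.ofFn_get]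

theorem nsymForm_mul (a : NSym R) (f g : mQSym R) :
    nsymForm a (f * g) =
      TensorProduct.dualDistrib R (NSym R) (NSym R) (nsymForm.flip f ⊗ₜ[R] nsymForm.flip g)
        (Coalgebra.comul a) := by
  have : nsymForm.flip (f * g) =
      TensorProduct.dualDistrib R (NSym R) (NSym R) (nsymForm.flip f ⊗ₜ[R] nsymForm.flip g) ∘ₗ
        Coalgebra.comul := by
    refine (FreeAlgebra.basisFreeMonoid R ℕ+).ext fun w => ?_
    obtain ⟨L, m, hL, hw⟩ := basis_eq_hr (R := R) w
    rw [hw, LinearMap.comp_apply, comul_eq, comulHom_hr L m hL, LinearMap.flip_apply,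
      nsymForm_hr L m hL, map_sum]
    change MvPowerSeries.coeff m (f.1 * g.1) = _
    rw [MvPowerSeries.coeff_mul]
    refine Finset.sum_congr rfl fun p hp => ?_
    rw [Finset.HasAntidiagonal.mem_antidiagonal] at hp
    have hp' : ∀ j, L ≤ j → p.1 j = 0 ∧ p.2 j = 0 := by
      intro j hj
      have := hL j hj
      rw [← hp, Finsupp.add_apply] at this
      omega
    rw [TensorProduct.dualDistrib_apply, LinearMap.flip_apply, LinearMap.flip_apply,
      nsymForm_hr L _ fun j hj => (hp' j hj).1, nsymForm_hr L _ fun j hj => (hp' j hj).2]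
  exact LinearMap.congr_fun this a

theorem nsymForm_one (a : NSym R) : nsymForm a (1 : mQSym R) = Coalgebra.counit (R := R) a := by
  have : nsymForm.flip (1 : mQSym R) = (Coalgebra.counit : NSym R →ₗ[R] R) := by
    refine (FreeAlgebra.basisFreeMonoid R ℕ+).ext fun w => ?_
    rw [LinearMap.flip_apply, basis_apply, nsymForm_prod, counit_eq]
    change MvPowerSeries.coeff _ (1 : MvPowerSeries ℕ R) = _
    classical
    rw [MvPowerSeries.coeff_one]
    rcases w.toList with _ | ⟨n, l⟩
    · simp [expAt]
    · rw [if_neg]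
      · simp [counitHom_h]
      · intro h0
        have := expAt_apply (n :: l).get (fun t => (t : ℕ)) (fun _ _ h => h) ⟨0, by simp⟩
        rw [h0] at this
        simp only [Finsupp.coe_zero, Pi.zero_apply, List.get_eq_getElem, List.getElem_cons_zero] at this
        exact n.ne_zero this.symm
  exact LinearMap.congr_fun this a

theorem nsymForm_bijective : Function.Bijective (nsymForm (R := R)).flip := by
  constructor
  · rw [injective_iff_map_eq_zero]
    intro f hf
    apply Subtype.ext
    ext m
    obtain ⟨L, hL⟩ := exists_bound m
    rw [← nsymForm_hr L m hL f]
    exact LinearMap.congr_fun hf _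
  · intro φ
    choose L hL using exists_bound
    have key : ∀ (k : ℕ) (a : Fin k → ℕ+) (i : Fin k → ℕ), StrictMono i →
        φ (hr (L (expAt a i)) (expAt a i)) =
          φ ((List.ofFn a).map fun n : ℕ+ => (h n : NSym R)).prod := by
      intro k a i hi
      rw [hr_expAt _ a i hi (lt_of_support hi (hL _))]
    let F : mQSym R := ⟨fun m => φ (hr (L m) m), fun k a i hi =>
      (key k a i hi).trans (key k a _ fun _ _ h => h).symm⟩
    refine ⟨F, (FreeAlgebra.basisFreeMonoid R ℕ+).ext fun w => ?_⟩
    rw [LinearMap.flip_apply, basis_apply, nsymForm_prod]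
    have := key _ w.toList.get _ (fun _ _ h => h)
    rw [List.ofFn_get] at this
    exact this

end NSym

end QSym

/-! ### Linearly compact Hopf algebras

A linearly compact `R`-module is an `R`-module `B` with a free `R`-module `A` and a bilinear form
`A × B → R` inducing a bijection `B ≃ Hom_R(A, R)`. Continuous linear maps `B → B'` are the adjoints
of linear maps `A' → A`, and `B ⊗̂ B'` is `Hom_R(A ⊗ A', R)`. -/

/-- A linearly compact Hopf algebra structure on the `R`-algebra `B`: a Hopf algebra `A`, free as an
`R`-module, to which `B` is dual, such that the unit of `B` is adjoint to the counit of `A` and the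
product of `B` is adjoint to the coproduct of `A` (a continuous linear map `B ⊗̂ B → B` is determined
by its values on pure tensors `b ⊗ b'`, and `dualDistrib` is the inclusion `B ⊗ B → B ⊗̂ B`).
The coproduct and counit of `B` are adjoint to the product and unit of `A`. -/
structure LCHopfAlgebra (R B : Type) [CommRing R] [Ring B] [Algebra R B] where
  A : Type
  [ring : Ring A]
  [hopf : HopfAlgebra R A]
  [free : Module.Free R A]
  form : A →ₗ[R] B →ₗ[R] R
  nondegenerate : Function.Bijective form.flip
  form_mul : ∀ (a : A) (b b' : B), form a (b * b') =
    TensorProduct.dualDistrib R A A (form.flip b ⊗ₜ[R] form.flip b') (Coalgebra.comul a)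
  form_one : ∀ a : A, form a 1 = Coalgebra.counit (R := R) a

namespace LCHopfAlgebra

attribute [instance] ring hopf free

variable {R B B' : Type} [CommRing R] [Ring B] [Algebra R B] [Ring B'] [Algebra R B']

/-- The completed tensor product `B ⊗̂ B`. -/
abbrev CompletedTensor (H : LCHopfAlgebra R B) : Type := Module.Dual R (H.A ⊗[R] H.A)

/-- The coproduct `B → B ⊗̂ B`, the adjoint of the product `A ⊗ A → A`. -/
def comul (H : LCHopfAlgebra R B) : B →ₗ[R] H.CompletedTensor :=
  (LinearMap.mul' R H.A).lcomp R R ∘ₗ H.form.flip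

/-- The counit `B → R`, the adjoint of the unit `R → A`. -/
def counit (H : LCHopfAlgebra R B) : B →ₗ[R] R := H.form 1

/-- A morphism of LC-Hopf algebras: an algebra morphism which is continuous, being the adjoint of a
linear map `φ`, and commutes with coproducts (`f ⊗̂ f` is the adjoint of `φ ⊗ φ`) and counits. -/
def IsMorphism (H : LCHopfAlgebra R B) (H' : LCHopfAlgebra R B') (f : B →ₐ[R] B') : Prop :=
  ∃ φ : H'.A →ₗ[R] H.A,
    (∀ (a : H'.A) (b : B), H.form (φ a) b = H'.form a (f b)) ∧
    (∀ b : B, H'.comul (f b) = H.comul b ∘ₗ TensorProduct.map φ φ) ∧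
    (∀ b : B, H'.counit (f b) = H.counit b)

/-- The family `b` is a pseudobasis of `B`: it is dual to some basis of `A`. -/
def IsPseudobasis (H : LCHopfAlgebra R B) {I : Type} (b : I → B) : Prop :=
  ∃ a : Module.Basis I R H.A, ∀ i j, H.form (a i) (b j) = Finsupp.single i (1 : R) j

/-- All arbitrary (possibly infinite) `R`-linear combinations `∑ c_i b_i` of the family `b` that
converge in the linearly compact topology, that is, after pairing with each `a : A`. -/
def pseudospan (H : LCHopfAlgebra R B) {I : Type} (b : I → B) : Set B :=
  {f | ∃ c : I → R, ∀ a : H.A,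
    {i | c i * H.form a (b i) ≠ 0}.Finite ∧ H.form a f = ∑ᶠ i, c i * H.form a (b i)}

/-- `C`, with the linearly compact module structure having pseudobasis `b`, is an LC-Hopf subalgebra
of `H`: it carries the structure of an LC-Hopf algebra with pseudobasis `b` for which the inclusion
into `B` is a morphism of LC-Hopf algebras. -/
def IsLCHopfSubalgebra (H : LCHopfAlgebra R B) (C : Set B) {I : Type} (b : I → B) : Prop :=
  ∃ S : Subalgebra R B, (S : Set B) = C ∧
    ∃ K : LCHopfAlgebra R S, K.IsMorphism H S.val ∧
      ∃ c : I → S, (∀ i, (c i : B) = b i) ∧ K.IsPseudobasis c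

end LCHopfAlgebra

/-- The LC-Hopf algebra of quasisymmetric power series: usual product of power series, and
`Δ(M_α) = ∑_{α = α' α''} M_{α'} ⊗ M_{α''}`, see `mQSymHopf_comul`. -/
def mQSymHopf (R : Type) [CommRing R] : LCHopfAlgebra R (mQSym R) where
  A := NSym R
  form := nsymForm
  nondegenerate := NSym.nsymForm_bijective
  form_mul := NSym.nsymForm_mul
  form_one := NSym.nsymForm_one

/-- The coefficient of `M_u ⊗ M_v` in `Δ f` is the coefficient of `M_{uv}` in `f`, where `uv` is the
concatenation of `u` and `v`. -/
theorem mQSymHopf_comul {R : Type} [CommRing R] (f : mQSym R) (u v : List ℕ+) :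
    (mQSymHopf R).comul f
      ((u.map fun n : ℕ+ => (NSym.h n : NSym R)).prod ⊗ₜ[R]
        (v.map fun n : ℕ+ => (NSym.h n : NSym R)).prod) = coeffM (u ++ v) f := by
  rw [← NSym.nsymForm_prod, List.map_append, List.prod_append]
  rfl

/-! ### Multipeak functions -/

/-- The marked alphabet `1' < 1 < 2' < 2 < ⋯`: the pair `(j, false)` stands for `(j+1)'` and the pair
`(j, true)` for `j+1`, ordered lexicographically. -/
abbrev Marked : Type := ℕ ×ₗ Bool

namespace Marked

/-- The index of the variable `x_{|i|}` attached to a letter. -/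
def index (x : Marked) : ℕ := (ofLex x).1

/-- The letter is primed. -/
def IsPrimed (x : Marked) : Prop := (ofLex x).2 = false

/-- Relabelling of letters along an increasing map, keeping primes. -/
def relabel (e : ℕ ↪o ℕ) : Marked ↪ Marked :=
  ⟨fun x => toLex (e x.index, (ofLex x).2), fun x y hxy => by
    have h : (e x.index, (ofLex x).2) = (e y.index, (ofLex y).2) := hxy
    rw [Prod.mk.injEq, e.injective.eq_iff] at h
    exact Prod.ext h.1 h.2⟩

theorem relabel_le_iff (e : ℕ ↪o ℕ) (x y : Marked) : relabel e x ≤ relabel e y ↔ x ≤ y := by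
  rw [Prod.Lex.le_iff, Prod.Lex.le_iff]
  simp [relabel, index]

theorem relabel_lt_iff (e : ℕ ↪o ℕ) (x y : Marked) : relabel e x < relabel e y ↔ x < y := by
  rw [Prod.Lex.lt_iff, Prod.Lex.lt_iff]
  simp [relabel, index]

theorem isPrimed_relabel (e : ℕ ↪o ℕ) (x : Marked) : (relabel e x).IsPrimed ↔ x.IsPrimed :=
  Iff.rfl

end Marked

/-- `S ≺ T`, that is `max S < min T` for nonempty finite sets. -/
def Prec (S T : Finset Marked) : Prop := ∀ x ∈ S, ∀ y ∈ T, x < y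

/-- `S ⪯ T`, that is `max S ≤ min T` for nonempty finite sets. -/
def PrecEq (S T : Finset Marked) : Prop := ∀ x ∈ S, ∀ y ∈ T, x ≤ y

/-- The size `|α| = α_1 + ⋯ + α_l`. -/
def compSize (α : List ℕ+) : ℕ := (α.map fun n : ℕ+ => (n : ℕ)).sum

/-- `I(α) = {α_1, α_1 + α_2, …, α_1 + ⋯ + α_{l-1}}`. -/
def descentSet (α : List ℕ+) : Set ℕ := {s | ∃ k, 0 < k ∧ k < α.length ∧ s = compSize (α.take k)}

/-- A peak set contains neither `1` nor two consecutive integers. -/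
def IsPeakSet (I : Set ℕ) : Prop := 1 ∉ I ∧ ∀ i ∈ I, i + 1 ∉ I

/-- Peak compositions: compositions `α` such that `I(α)` is a peak set. -/
def PeakComposition : Type := {α : List ℕ+ // IsPeakSet (descentSet α)}

/-- The exponent vector of the monomial `x^S = ∏_i ∏_{a ∈ S_i} x_{|a|}`. -/
def weight {N : ℕ} (S : Fin N → Finset Marked) : ℕ →₀ ℕ :=
  ∑ i, ∑ x ∈ S i, Finsupp.single x.index 1

/-- `|S| = ∑_i |S_i|`. -/
def totalCard {N : ℕ} (S : Fin N → Finset Marked) : ℕ := ∑ i, (S i).card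

/-- The index set of the sum defining `K_α`. The sets `S_1, …, S_N` are `S 0, …, S (N-1)`, so that
`S_i, S_{i+1}` of the usual numbering are `S (i-1), S i`. -/
def IsMultipeakTuple (α : List ℕ+) (S : Fin (compSize α) → Finset Marked) : Prop :=
  (∀ i, (S i).Nonempty) ∧
  ∀ (i : ℕ) (hi : i + 1 < compSize α),
    PrecEq (S ⟨i, by omega⟩) (S ⟨i + 1, hi⟩) ∧
    (i + 1 ∈ descentSet α → ∀ x ∈ S ⟨i, by omega⟩ ∩ S ⟨i + 1, hi⟩, x.IsPrimed) ∧
    (i + 1 ∉ descentSet α → ∀ x ∈ S ⟨i, by omega⟩ ∩ S ⟨i + 1, hi⟩, ¬ x.IsPrimed)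

/-- The index set of the sum defining the barred function attached to `α`. -/
def IsMultipeakBarTuple (α : List ℕ+) (S : Fin (compSize α) → Finset Marked) : Prop :=
  (∀ i, (S i).Nonempty) ∧
  (∀ h0 : 0 < compSize α, ∀ x ∈ S ⟨0, h0⟩, ¬ x.IsPrimed) ∧
  ∀ (i : ℕ) (hi : i + 1 < compSize α),
    PrecEq (S ⟨i, by omega⟩) (S ⟨i + 1, hi⟩) ∧
    (i + 1 ∈ descentSet α →
      Prec (S ⟨i, by omega⟩) (S ⟨i + 1, hi⟩) ∧ ∀ x ∈ S ⟨i + 1, hi⟩, ¬ x.IsPrimed) ∧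
    (i + 1 ∉ descentSet α → ∀ x ∈ S ⟨i, by omega⟩ ∩ S ⟨i + 1, hi⟩, ¬ x.IsPrimed)

/-- The power series `∑_S β^(|S| - N) x^S` over all `N`-tuples `S` with property `P`; the sum that
gives each coefficient is finite by `finite_weight_eq`. -/
def tupleSeries {R : Type} [CommRing R] (β : R) {N : ℕ} (P : (Fin N → Finset Marked) → Prop) :
    MvPowerSeries ℕ R :=
  fun m => ∑ᶠ S ∈ {S : Fin N → Finset Marked | P S ∧ weight S = m}, β ^ (totalCard S - N)

theorem mem_weight_support {N : ℕ} (S : Fin N → Finset Marked) (i : Fin N) {x : Marked}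
    (hx : x ∈ S i) : x.index ∈ (weight S).support := by
  rw [Finsupp.mem_support_iff]
  have h1 : Finsupp.single x.index 1 ≤ ∑ x ∈ S i, Finsupp.single x.index 1 :=
    Finset.single_le_sum (f := fun x : Marked => Finsupp.single x.index 1)
      (fun _ _ => zero_le) hx
  have h2 : ∑ x ∈ S i, Finsupp.single x.index 1 ≤ weight S :=
    Finset.single_le_sum (f := fun i => ∑ x ∈ S i, Finsupp.single x.index 1)
      (fun _ _ => zero_le) (Finset.mem_univ i)
  have h3 := (h1.trans h2) x.index
  rw [Finsupp.single_eq_same] at h3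
  omega

theorem finite_weight_eq {N : ℕ} (m : ℕ →₀ ℕ) :
    {S : Fin N → Finset Marked | weight S = m}.Finite := by
  let X : Finset Marked := (m.support ×ˢ Finset.univ).map toLex.toEmbedding
  refine (Set.Finite.pi fun _ : Fin N => (X.powerset : Set (Finset Marked)).toFinite).subset ?_
  rintro S rfl i -
  simp only [Finset.coe_powerset, Set.mem_preimage, Set.mem_powerset_iff, Finset.coe_subset]
  intro x hx
  exact Finset.mem_map.2 ⟨ofLex x,
    Finset.mem_product.2 ⟨mem_weight_support S i hx, Finset.mem_univ _⟩, rfl⟩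

theorem isQuasisymmetric_tupleSeries {R : Type} [CommRing R] (β : R) {N : ℕ}
    (P : (Fin N → Finset Marked) → Prop)
    (hP : ∀ (e : ℕ ↪o ℕ) S, P (fun i => (S i).map (Marked.relabel e)) ↔ P S) :
    IsQuasisymmetric (tupleSeries β P) := by
  rw [isQuasisymmetric_iff]
  intro e
  ext m
  rw [MvPowerSeries.coeff_killCompl]
  have hw : ∀ S : Fin N → Finset Marked,
      weight (fun i => (S i).map (Marked.relabel e)) = (weight S).embDomain e.toEmbedding := by
    intro S
    rw [Finsupp.embDomain_eq_mapDomain, weight, weight, Finsupp.mapDomain_finsetSum]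
    refine Finset.sum_congr rfl fun i _ => ?_
    rw [Finset.sum_map, Finsupp.mapDomain_finsetSum]
    refine Finset.sum_congr rfl fun x _ => ?_
    rw [Finsupp.mapDomain_single]
    rfl
  symm
  refine finsum_mem_eq_of_bijOn (fun S i => (S i).map (Marked.relabel e)) ⟨?_, ?_, ?_⟩ ?_
  · rintro S ⟨h1, h2⟩
    exact ⟨(hP e S).2 h1, by rw [hw, h2]⟩
  · intro S _ T _ hST
    funext i
    exact Finset.map_injective _ (congrFun hST i)
  · rintro T ⟨h1, h2⟩
    have hT : ∀ i, ∃ U : Finset Marked, U.map (Marked.relabel e) = T i := by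
      intro i
      have : (T i : Set Marked) ⊆ Set.range (Marked.relabel e) := by
        intro x hx
        have hx' := mem_weight_support T i hx
        rw [h2, Finsupp.support_embDomain, Finset.mem_map] at hx'
        obtain ⟨j, -, hj⟩ := hx'
        exact ⟨toLex (j, (ofLex x).2), Prod.ext hj rfl⟩
      obtain ⟨U, hU⟩ := Finset.subset_map_iff.1
        (show T i ⊆ ((T i).preimage (Marked.relabel e) (Marked.relabel e).injective.injOn).map
          (Marked.relabel e) from fun x hx => by
            obtain ⟨y, rfl⟩ := this hx
            exact Finset.mem_map_of_mem _ (Finset.mem_preimage.2 hx))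
      exact ⟨U, hU.2.symm⟩
    choose U hU using hT
    obtain rfl : (fun i => (U i).map (Marked.relabel e)) = T := funext hU
    refine ⟨U, ⟨(hP e U).1 h1, ?_⟩, rfl⟩
    rw [hw] at h2
    exact Finsupp.embDomain_injective _ h2
  · intro S _
    simp [totalCard]

/-- The multipeak quasisymmetric function `K_α^{(β)}`. -/
def multipeak {R : Type} [CommRing R] (β : R) (α : PeakComposition) : mQSym R :=
  ⟨tupleSeries β (IsMultipeakTuple α.1), isQuasisymmetric_tupleSeries β _ fun e S => by
    simp only [IsMultipeakTuple, PrecEq, ← Finset.map_inter, Finset.forall_mem_map,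
      Finset.map_nonempty, Marked.relabel_le_iff, Marked.isPrimed_relabel]⟩

/-- The barred multipeak quasisymmetric function `K̄_α^{(β)}`. -/
def multipeakBar {R : Type} [CommRing R] (β : R) (α : PeakComposition) : mQSym R :=
  ⟨tupleSeries β (IsMultipeakBarTuple α.1), isQuasisymmetric_tupleSeries β _ fun e S => by
    simp only [IsMultipeakBarTuple, PrecEq, Prec, ← Finset.map_inter, Finset.forall_mem_map,
      Finset.map_nonempty, Marked.relabel_le_iff, Marked.relabel_lt_iff, Marked.isPrimed_relabel]⟩

/-- The pseudospan of all `K_α^{(β)}` over `ℤ[β]`, where `β` is the polynomial variable. -/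
def mPeak : Set (mQSym (Polynomial ℤ)) :=
  (mQSymHopf (Polynomial ℤ)).pseudospan (multipeak Polynomial.X)

/-- The pseudospan of all `K̄_α^{(β)}` over `ℤ[β]`. -/
def mPiBarSym : Set (mQSym (Polynomial ℤ)) :=
  (mQSymHopf (Polynomial ℤ)).pseudospan (multipeakBar Polynomial.X)

/-- The pseudospan of all `K_α^{(β)}` over `ℚ[β]`. -/
def mPeakRat : Set (mQSym (Polynomial ℚ)) :=
  (mQSymHopf (Polynomial ℚ)).pseudospan (multipeak Polynomial.X)

/-- The inclusion of the quasisymmetric series over `ℤ[β]` into those over `ℚ[β]`. -/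
def extendScalars (f : mQSym (Polynomial ℤ)) : mQSym (Polynomial ℚ) :=
  ⟨MvPowerSeries.map (Polynomial.mapRingHom (Int.castRingHom ℚ)) f.1, fun k a i hi => by
    rw [MvPowerSeries.coeff_map, MvPowerSeries.coeff_map, f.2 k a i hi]⟩

end

/-! The statement is transported to the predual `NSym`, with generating series H(t) = ∑ h_n tⁿ.
Write ⊖t = -t/(1 + βt) for the inverse of the formal group law x + y + βxy. Two objects govern the
proof: the bialgebra endomorphism Θ (`NSym.theta`) with Θ(H(t)) = H(⊖t)⁻¹ H(t), and the Hopf ideal J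
(`NSym.cancelIdeal`) generated by the non-constant coefficients of H(t) H(⊖t). They fit together
because Θ(H(t) H(⊖t)) = 1, so that Θ kills J.

The functions K_α and K̄_α enter through a transfer matrix. Letters are read in increasing order and
only the number of sets begun so far is remembered. For a descent set I, an unprimed letter acts by
a series U(t) of operators on sequences, and a primed one by P(t), or by B(t) in the barred case.
Sending H(t) to P(t)U(t) or to B(t)U(t) defines representations of `NSym`, and the pairing of x with
K_α or K̄_α is the entry 0 of the image of the unit vector at |α| under x (`nsymForm_multipeak`,
`nsymForm_multipeakBar`). Three operator identities carry the argument: - U(⊖t) P(t) = 1, so the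
representation of K is the representation H ↦ U composed with Θ (`NSym.rep_thetaAlg`), and K_α
annihilates J; - P(t)U(t) depends only on the peaks of I (`primedSeries_mul_unprimedSeries_peaks`);
- if I is a peak set, the series B(t)U(t) is inverted by the substitution of ⊖t
(`peakBarSeries_cancel`), so K̄_α annihilates J.

Triangularity supplies bases. For an order on words given by `wordCode`, the pairing of h_γ with K_α
or K̄_α vanishes unless γ = α or γ is larger; on the diagonal it is a power of 2 for K and 1 for K̄
(`IsTriangularRep.hasTop_word`). Peak words span `NSym` modulo J, since the coefficients of
H(t)H(⊖t) rewrite h_1 h_n through smaller words (`NSym.word_mem_cancelIdeal_sup`). Hence the K̄_α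
are dual to a basis of `NSym`/J over any base ring, and so are the K_α when 2 is invertible. Both
spans are then the annihilator of J. As J is compatible with base change
(`forall_cancelIdeal_baseMap`), this gives the intersection formula, and the inclusion of the span
of K follows because K annihilates J.

Over ℤ[β] the K_α are not dual to a basis of `NSym`/J. Their predual is the saturation of the image
of Θ, the elements with a multiple by a power of 2 in that image. In the coordinates given by H ↦ U,
which form a basis of functionals indexed by all compositions, it consists of the elements whose
coordinates depend only on the peaks of the composition. It is therefore a direct summand, which
makes it a Hopf subalgebra, and K_α is coordinate α composed with Θ.

Both Hopf statements follow from one principle (`LCHopfAlgebra.isLCHopfSubalgebra_pseudospan`): a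
bialgebra morphism from the predual to a free Hopf algebra, whose image determines linear
functionals, dualizes to an LC-Hopf subalgebra. -/

noncomputable section

/-! ### Formal inversion of the multiplicative formal group law -/

namespace PowerSeries

variable {R : Type} [CommRing R] {A B : Type} [Ring A] [Algebra R A] [Ring B] [Algebra R B]

/-- The power series `-t / (1 + b t)`, the inverse of `t` for the formal group law
`x + y + b x y`. -/
def ominus (b : R) : R⟦X⟧ := -(X * mk fun n => (-b) ^ n)

theorem one_add_mul_geom (a : A) : (1 - X * C a) * mk (fun n => a ^ n) = 1 := by
  ext n
  rw [sub_mul, one_mul, map_sub, mul_assoc]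
  cases n with
  | zero => simp
  | succ n => rw [coeff_succ_X_mul, coeff_C_mul, coeff_mk, coeff_mk, pow_succ']; simp [coeff_one]

theorem geom_mul_one_add (a : A) : mk (fun n => a ^ n) * (1 - X * C a) = 1 := by
  ext n
  rw [mul_sub, mul_one, map_sub, X_mul, ← mul_assoc]
  cases n with
  | zero => simp
  | succ n => rw [coeff_succ_mul_X, coeff_mul_C, coeff_mk, coeff_mk, pow_succ]; simp [coeff_one]

theorem one_add_mul_ominus (b : R) : (1 + X * C b) * ominus b = -X := by
  have := one_add_mul_geom (A := R) (-b)
  rw [map_neg, mul_neg, sub_neg_eq_add] at this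
  rw [ominus, mul_neg, mul_left_comm, this, mul_one]

theorem coeff_ominus_pow_of_lt (b : R) {n k : ℕ} (h : n < k) : coeff n (ominus b ^ k) = 0 := by
  rw [ominus, ← mul_neg, mul_pow, coeff_X_pow_mul', if_neg (by omega)]

theorem coeff_ominus_pow_self (b : R) (n : ℕ) : coeff n (ominus b ^ n) = (-1) ^ n := by
  rw [ominus, ← mul_neg, mul_pow, coeff_X_pow_mul', if_pos le_rfl]
  simp

/-- Substitution of `-t / (1 + b t)` for the variable `t` of a power series over an `R`-algebra. -/
def substOminus (b : R) : A⟦X⟧ →+* A⟦X⟧ where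
  toFun f := mk fun n => ∑ k ∈ Finset.range (n + 1), coeff n (ominus b ^ k) • coeff k f
  map_one' := by
    ext n
    rw [coeff_mk, Finset.sum_eq_single 0]
    · by_cases h : n = 0 <;> simp [coeff_one, h]
    · intro k _ hk
      simp [coeff_one, hk]
    · simp
  map_zero' := by ext n; simp
  map_add' f g := by ext n; simp [Finset.sum_add_distrib]
  map_mul' f g := by
    ext n
    -- Powers of ⊖t of exponent above m have no term of degree m, so all truncations can be raised
    -- to a common bound.
    have key : ∀ (m M : ℕ), m ≤ M → ∀ f : A⟦X⟧,
        ∑ k ∈ Finset.range (m + 1), coeff m (ominus b ^ k) • coeff k f =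
          ∑ k ∈ Finset.range (M + 1), coeff m (ominus b ^ k) • coeff k f := by
      intro m M hm f
      refine Finset.sum_subset (Finset.range_mono (by omega)) fun k _ hk => ?_
      rw [coeff_ominus_pow_of_lt b (by simpa using hk), zero_smul]
    have h2 : ∀ k ∈ Finset.range (n + n + 1), coeff n (ominus b ^ k) • coeff k (f * g) =
        ∑ p ∈ Finset.HasAntidiagonal.antidiagonal k,
          coeff n (ominus b ^ (p.1 + p.2)) • (coeff p.1 f * coeff p.2 g) := by
      intro k _
      rw [coeff_mul, Finset.smul_sum]
      refine Finset.sum_congr rfl fun p hp => ?_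
      rw [Finset.HasAntidiagonal.mem_antidiagonal.1 hp]
    rw [coeff_mk, coeff_mul, key n (n + n) (by omega), Finset.sum_congr rfl h2]
    have h3 : ∀ p ∈ Finset.HasAntidiagonal.antidiagonal n,
        coeff p.1 (mk fun n => ∑ k ∈ Finset.range (n + 1), coeff n (ominus b ^ k) • coeff k f) *
        coeff p.2 (mk fun n => ∑ k ∈ Finset.range (n + 1), coeff n (ominus b ^ k) • coeff k g) =
        ∑ i ∈ Finset.range (n + 1), ∑ j ∈ Finset.range (n + 1),
          (coeff p.1 (ominus b ^ i) * coeff p.2 (ominus b ^ j)) • (coeff i f * coeff j g) := by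
      intro p hp
      have := Finset.HasAntidiagonal.mem_antidiagonal.1 hp
      rw [coeff_mk, coeff_mk, key p.1 n (by omega), key p.2 n (by omega), Finset.sum_mul_sum]
      simp only [smul_mul_smul_comm]
    rw [Finset.sum_congr rfl h3, Finset.sum_comm]
    simp_rw [Finset.sum_comm (s := Finset.HasAntidiagonal.antidiagonal n), ← Finset.sum_smul,
      ← coeff_mul, ← pow_add]
    rw [Finset.sum_sigma', ← Finset.sum_product']
    symm
    -- Pairs with i, j ≤ n embed into all pairs with i + j ≤ 2n; a pair that is missed has i + j >
    -- n, and its coefficient vanishes.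
    refine Finset.sum_of_injOn (fun p => ⟨p.1 + p.2, p⟩) ?_ ?_ ?_ ?_
    · rintro ⟨i, j⟩ _ ⟨i', j'⟩ _ h
      have h' := (Sigma.mk.inj_iff.1 h).2
      exact eq_of_heq h'
    · rintro ⟨i, j⟩ h
      simp only [Finset.coe_product, Set.mem_prod, Finset.mem_coe, Finset.mem_range] at h
      simp only [Finset.mem_coe, Finset.mem_sigma, Finset.mem_range,
        Finset.HasAntidiagonal.mem_antidiagonal, and_true]
      omega
    · rintro ⟨k, i, j⟩ h1 h2
      simp only [Finset.mem_sigma, Finset.mem_range,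
        Finset.HasAntidiagonal.mem_antidiagonal] at h1
      obtain ⟨h1, rfl⟩ := h1
      rw [coeff_ominus_pow_of_lt, zero_smul]
      by_contra h3
      exact h2 ⟨(i, j), by
        simp only [Finset.coe_product, Set.mem_prod, Finset.mem_coe, Finset.mem_range]
        dsimp only at h3
        omega, rfl⟩
    · rintro ⟨i, j⟩ _
      rfl

theorem coeff_substOminus (b : R) (f : A⟦X⟧) (n : ℕ) :
    coeff n (substOminus b f) =
      ∑ k ∈ Finset.range (n + 1), coeff n (ominus b ^ k) • coeff k f := by
  change coeff n (mk fun n => ∑ k ∈ Finset.range (n + 1), coeff n (ominus b ^ k) • coeff k f) = _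
  rw [coeff_mk]

theorem map_substOminus (b : R) (φ : A →ₐ[R] B) (f : A⟦X⟧) :
    map (φ : A →+* B) (substOminus b f) = substOminus b (map (φ : A →+* B) f) := by
  ext n
  simp [coeff_substOminus]

theorem substOminus_C (b : R) (a : A) : substOminus b (C a) = C a := by
  ext n
  rw [coeff_substOminus, Finset.sum_eq_single 0]
  · by_cases h : n = 0 <;> simp [coeff_one, coeff_C, h]
  · intro k _ hk
    simp [coeff_C, hk]
  · simp

theorem substOminus_X (b : R) :
    substOminus b (X : A⟦X⟧) = map (algebraMap R A) (ominus b) := by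
  ext n
  rw [coeff_substOminus]
  rcases n with _ | n
  · simp [ominus]
  · rw [Finset.sum_eq_single 1]
    · simp [Algebra.algebraMap_eq_smul_one]
    · intro k _ hk
      simp [coeff_X, hk]
    · simp

/-- The inverse of a group law is an involution; concretely, (1 + bt)(1 + b(⊖t)) = 1. -/
theorem substOminus_ominus (b : R) : substOminus b (ominus b) = X := by
  have h1 := congrArg (substOminus b) (one_add_mul_ominus b)
  rw [map_mul, map_add, map_one, map_mul, map_neg, substOminus_C, substOminus_X] at h1
  simp only [Algebra.algebraMap_self, map_id, id_eq] at h1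
  have h2 := one_add_mul_ominus b
  have h3 : (1 + X * C b) * (1 + ominus b * C b) = 1 := by linear_combination (C b) * h2
  linear_combination (1 + X * C b) * h1 - h2 - substOminus b (ominus b) * h3

theorem substOminus_substOminus (b : R) (f : A⟦X⟧) : substOminus b (substOminus b f) = f := by
  ext n
  have h : ∀ k ∈ Finset.range (n + 1), coeff n (ominus b ^ k) • coeff k (substOminus b f) =
      ∑ j ∈ Finset.range (n + 1),
        (coeff n (ominus b ^ k) • coeff k (ominus b ^ j)) • coeff j f := by
    intro k hk
    rw [coeff_substOminus, Finset.smul_sum]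
    simp_rw [smul_assoc]
    refine Finset.sum_subset (Finset.range_mono ?_) fun j _ hj => ?_
    · simpa using Finset.mem_range.1 hk
    · rw [coeff_ominus_pow_of_lt b (show k < j by simpa using hj), zero_smul, smul_zero]
  rw [coeff_substOminus, Finset.sum_congr rfl h, Finset.sum_comm]
  simp_rw [← Finset.sum_smul, ← coeff_substOminus, map_pow, substOminus_ominus, coeff_X_pow]
  simp

end PowerSeries

end

noncomputable section

/-! ### Group-like series and the Hopf algebra defined by the cancellation law -/

open PowerSeries

variable {R : Type} [CommRing R]

section GroupLikeSeries

variable {A : Type} [Ring A] [Bialgebra R A]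

theorem commute_map_include (f g : A⟦X⟧) :
    map (Algebra.TensorProduct.includeLeft : A →ₐ[R] A ⊗[R] A).toRingHom f *
      map (Algebra.TensorProduct.includeRight : A →ₐ[R] A ⊗[R] A).toRingHom g =
    map (Algebra.TensorProduct.includeRight : A →ₐ[R] A ⊗[R] A).toRingHom g *
      map (Algebra.TensorProduct.includeLeft : A →ₐ[R] A ⊗[R] A).toRingHom f := by
  ext n
  rw [coeff_mul, coeff_mul]
  exact Finset.sum_equiv (Equiv.prodComm ℕ ℕ) (fun p => by simp [add_comm]) fun p _ => by simp

variable (R) in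
/-- A power series `∑ g_n tⁿ` over a bialgebra which is group-like, `t` being a scalar. -/
def IsGroupLikeSeries (g : A⟦X⟧) : Prop :=
  map (Bialgebra.comulAlgHom R A).toRingHom g =
    map (Algebra.TensorProduct.includeLeft : A →ₐ[R] A ⊗[R] A).toRingHom g *
      map (Algebra.TensorProduct.includeRight : A →ₐ[R] A ⊗[R] A).toRingHom g ∧
  map (Bialgebra.counitAlgHom R A).toRingHom g = 1

/-- The two tensor legs commute, so the middle factors can be exchanged. -/
theorem IsGroupLikeSeries.mul {f g : A⟦X⟧} (hf : IsGroupLikeSeries R f)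
    (hg : IsGroupLikeSeries R g) : IsGroupLikeSeries R (f * g) := by
  refine ⟨?_, by rw [map_mul, hf.2, hg.2, one_mul]⟩
  rw [map_mul, hf.1, hg.1, map_mul, map_mul]
  simp only [mul_assoc]
  congr 1
  rw [← mul_assoc, ← commute_map_include, mul_assoc]

/-- Both sides of the group-like equation for g are inverse to the coproduct of f. -/
theorem IsGroupLikeSeries.of_inverse {f g : A⟦X⟧} (hf : IsGroupLikeSeries R f)
    (hfg : f * g = 1) (hgf : g * f = 1) : IsGroupLikeSeries R g := by
  constructor
  · refine left_inv_eq_right_inv (a := map (Bialgebra.comulAlgHom R A).toRingHom f) ?_ ?_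
    · rw [← map_mul, hgf, map_one]
    · rw [hf.1, commute_map_include, mul_assoc,
        ← mul_assoc (map (Algebra.TensorProduct.includeLeft : A →ₐ[R] A ⊗[R] A).toRingHom f),
        ← map_mul, hfg, map_one, one_mul, ← map_mul, hfg, map_one]
  · have := congrArg (map (Bialgebra.counitAlgHom R A).toRingHom) hfg
    rwa [map_mul, hf.2, one_mul, map_one] at this

theorem IsGroupLikeSeries.substOminus (b : R) {f : A⟦X⟧} (hf : IsGroupLikeSeries R f) :
    IsGroupLikeSeries R (substOminus b f) := by
  have h1 := congrArg (PowerSeries.substOminus b) hf.1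
  have h2 := congrArg (PowerSeries.substOminus b) hf.2
  rw [map_mul] at h1
  rw [map_one] at h2
  refine ⟨(map_substOminus b (Bialgebra.comulAlgHom R A) f).trans ?_,
    (map_substOminus b (Bialgebra.counitAlgHom R A) f).trans h2⟩
  refine h1.trans ?_
  congr 1
  · exact (map_substOminus b (Algebra.TensorProduct.includeLeft : A →ₐ[R] A ⊗[R] A) f).symm
  · exact (map_substOminus b (Algebra.TensorProduct.includeRight : A →ₐ[R] A ⊗[R] A) f).symm

end GroupLikeSeries

/-- Bialgebra morphisms between Hopf algebras commute with the antipodes. -/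
theorem antipode_comp_bialgHom {A B : Type} [Ring A] [HopfAlgebra R A] [Ring B] [HopfAlgebra R B]
    (f : A →ₐc[R] B) :
    HopfAlgebra.antipode R ∘ₗ (f : A →ₗ[R] B) = (f : A →ₗ[R] B) ∘ₗ HopfAlgebra.antipode R := by
  -- Both composites are inverses of f in the convolution algebra.
  apply WithConv.toConv_injective
  refine left_inv_eq_right_inv (a := WithConv.toConv (f : A →ₗ[R] B)) ?_ ?_
  · have h1 := LinearMap.convMul_comp_coalgHom_distrib
      (WithConv.toConv (HopfAlgebra.antipode R (A := B))) (WithConv.toConv LinearMap.id)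
      (f : A →ₗc[R] B)
    have h2 := LinearMap.convOne_comp_coalgHom (f : A →ₗc[R] B)
    rw [LinearMap.antipode_mul_id] at h1
    exact WithConv.ofConv_injective (h1.symm.trans h2)
  · have h1 := LinearMap.algHom_comp_convMul_distrib (f : A →ₐ[R] B)
      (WithConv.toConv LinearMap.id) (WithConv.toConv (HopfAlgebra.antipode R (A := A)))
    have h2 := LinearMap.algHom_comp_convOne (f : A →ₐ[R] B)
    rw [LinearMap.id_mul_antipode] at h1
    exact WithConv.ofConv_injective (h1.symm.trans h2)

namespace NSym

/-- The generating series `∑ h_n tⁿ`. -/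
def hSeries : (NSym R)⟦X⟧ := mk h

/-- The generating series of the values of the antipode. -/
def sSeries : (NSym R)⟦X⟧ := mk s

theorem hSeries_mul_sSeries : (hSeries : (NSym R)⟦X⟧) * sSeries = 1 := by
  ext n
  rw [coeff_mul, coeff_one, ← sum_h_mul_s]
  simp [hSeries, sSeries]

theorem sSeries_mul_hSeries : (sSeries : (NSym R)⟦X⟧) * hSeries = 1 := by
  ext n
  rw [coeff_mul, coeff_one, ← sum_s_mul_h]
  simp [hSeries, sSeries]

theorem isGroupLikeSeries_hSeries : IsGroupLikeSeries R (hSeries : (NSym R)⟦X⟧) := by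
  constructor
  · ext n
    rw [coeff_mul, coeff_map, hSeries, coeff_mk]
    refine (comulHom_h n).trans ?_
    simp
  · ext n
    rw [coeff_one, coeff_map, hSeries, coeff_mk]
    exact counitHom_h n

theorem isGroupLikeSeries_sSeries : IsGroupLikeSeries R (sSeries : (NSym R)⟦X⟧) :=
  isGroupLikeSeries_hSeries.of_inverse hSeries_mul_sSeries sSeries_mul_hSeries

/-- The generating series of the images of the `h_n` under the endomorphism `theta`. -/
def qSeries (b : R) : (NSym R)⟦X⟧ := substOminus b sSeries * hSeries

theorem isGroupLikeSeries_qSeries (b : R) : IsGroupLikeSeries R (qSeries b) :=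
  (isGroupLikeSeries_sSeries.substOminus b).mul isGroupLikeSeries_hSeries

theorem coeff_zero_qSeries (b : R) : coeff 0 (qSeries b) = 1 := by
  rw [qSeries, coeff_mul]
  simp [coeff_substOminus, sSeries, hSeries, h_zero, s_zero]

/-- The algebra endomorphism `H(t) ↦ H(⊖t)⁻¹ H(t)`. -/
def thetaAlg (b : R) : NSym R →ₐ[R] NSym R :=
  FreeAlgebra.lift R fun n : ℕ+ => coeff n (qSeries b)

theorem thetaAlg_h (b : R) (n : ℕ) : thetaAlg b (h n) = coeff n (qSeries b) := by
  rcases Nat.eq_zero_or_pos n with rfl | hn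
  · rw [h_zero, map_one, coeff_zero_qSeries]
  · lift n to ℕ+ using hn
    rw [h_pnat, thetaAlg, FreeAlgebra.lift_ι_apply]

theorem map_thetaAlg_hSeries (b : R) :
    map (thetaAlg b : NSym R →+* NSym R) hSeries = qSeries b := by
  ext n
  simpa [hSeries] using thetaAlg_h b n

/-- The bialgebra endomorphism `H(t) ↦ H(⊖t)⁻¹ H(t)`. -/
def theta (b : R) : NSym R →ₐc[R] NSym R :=
  BialgHom.ofAlgHom (thetaAlg b)
    (by
      ext n
      simp only [Function.comp_apply, AlgHom.coe_comp, ← h_pnat, thetaAlg_h]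
      have := congrArg (coeff n) (isGroupLikeSeries_qSeries b).2
      have h2 := counitHom_h (R := R) n
      rw [coeff_one] at this
      exact this.trans h2.symm)
    (by
      ext n
      simp only [Function.comp_apply, AlgHom.coe_comp, ← h_pnat, thetaAlg_h]
      have h1 := congrArg (coeff n) (isGroupLikeSeries_qSeries b).1
      have h2 := comulHom_h (R := R) n
      refine Eq.trans ?_ h1.symm
      refine (congrArg _ h2).trans ?_
      rw [map_sum, coeff_mul]
      refine Finset.sum_congr rfl fun p _ => ?_
      simp [thetaAlg_h])

theorem theta_apply (b : R) (a : NSym R) : theta b a = thetaAlg b a := rfl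

/-- The series `H(t) H(⊖t)`, whose non-constant coefficients generate the cancellation ideal. -/
def cancelSeries (b : R) : (NSym R)⟦X⟧ := hSeries * substOminus b hSeries

theorem isGroupLikeSeries_cancelSeries (b : R) : IsGroupLikeSeries R (cancelSeries b) :=
  isGroupLikeSeries_hSeries.mul (isGroupLikeSeries_hSeries.substOminus b)

/-- Since ⊖ is an involution, the image is H(⊖t)⁻¹ H(t) · H(t)⁻¹ H(⊖t). -/
theorem map_thetaAlg_cancelSeries (b : R) :
    map (thetaAlg b : NSym R →+* NSym R) (cancelSeries b) = 1 := by
  rw [cancelSeries, map_mul, map_substOminus, map_thetaAlg_hSeries, qSeries, map_mul,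
    substOminus_substOminus, mul_assoc, ← mul_assoc hSeries, hSeries_mul_sSeries, one_mul,
    ← map_mul, sSeries_mul_hSeries, map_one]

/-- The two-sided ideal generated by the non-constant coefficients of `H(t) H(⊖t)`. -/
def cancelTwoSided (b : R) : TwoSidedIdeal (NSym R) :=
  TwoSidedIdeal.span (Set.range fun n => coeff n (cancelSeries b) - coeff n 1)

/-- The two-sided ideal generated by the non-constant coefficients of `H(t) H(⊖t)`, as an ideal. -/
def cancelIdeal (b : R) : Ideal (NSym R) := (cancelTwoSided b).asIdeal

instance (b : R) : (cancelIdeal b).IsTwoSided :=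
  inferInstanceAs (cancelTwoSided b).asIdeal.IsTwoSided

/-- The universal property of the ideal, in terms of generating series; it reduces every vanishing
statement on the ideal to one identity of power series. -/
theorem cancelIdeal_le_ker {B : Type} [Ring B] (b : R) (f : NSym R →+* B)
    (hf : map f (cancelSeries b) = 1) {x : NSym R} (hx : x ∈ cancelIdeal b) : f x = 0 := by
  have h1 : cancelTwoSided b ≤ TwoSidedIdeal.ker f := by
    rw [cancelTwoSided, TwoSidedIdeal.span_le]
    rintro _ ⟨n, rfl⟩
    change _ ∈ TwoSidedIdeal.ker f
    rw [TwoSidedIdeal.mem_ker]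
    rw [map_sub, ← coeff_map, ← coeff_map, hf, map_one (map f), sub_self]
  exact (TwoSidedIdeal.mem_ker f).1 (h1 (TwoSidedIdeal.mem_asIdeal.1 hx))

theorem map_mk_cancelSeries (b : R) :
    map (Ideal.Quotient.mk (cancelIdeal b)) (cancelSeries b) = 1 := by
  ext n
  rw [coeff_map, ← sub_eq_zero, ← map_one (map (Ideal.Quotient.mk (cancelIdeal b))), coeff_map,
    ← map_sub, Ideal.Quotient.eq_zero_iff_mem]
  exact TwoSidedIdeal.mem_asIdeal.2 (TwoSidedIdeal.subset_span ⟨n, rfl⟩)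

/-- The antipode reverses products and t is a scalar, so H(t)H(⊖t) becomes H(⊖t)⁻¹ H(t)⁻¹. -/
theorem antipode_coeff_cancelSeries (b : R) (n : ℕ) :
    HopfAlgebra.antipode R (coeff n (cancelSeries b)) =
      coeff n (substOminus b sSeries * sSeries) := by
  rw [cancelSeries, coeff_mul, coeff_mul, map_sum]
  refine Finset.sum_equiv (Equiv.prodComm ℕ ℕ) (fun p => by simp [add_comm]) fun p _ => ?_
  rw [HopfAlgebra.antipode_mul_antidistrib, coeff_substOminus, map_sum, Equiv.prodComm_apply,
    Prod.fst_swap, Prod.snd_swap, coeff_substOminus]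
  simp only [map_smul, hSeries, sSeries, coeff_mk]
  congr 1
  · exact Finset.sum_congr rfl fun k _ => congrArg _ (antipodeLin_h k)
  · exact antipodeLin_h _

/-- This series is the inverse of H(t)H(⊖t), which is 1 in the quotient. -/
theorem map_mk_sSeries_mul (b : R) :
    map (Ideal.Quotient.mk (cancelIdeal b)) (substOminus b sSeries * sSeries) = 1 := by
  refine left_inv_eq_right_inv (a := map (Ideal.Quotient.mk (cancelIdeal b)) (cancelSeries b))
    ?_ (by rw [map_mk_cancelSeries, one_mul])
  rw [← map_mul, cancelSeries, mul_assoc, ← mul_assoc sSeries, sSeries_mul_hSeries, one_mul,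
    ← map_mul, sSeries_mul_hSeries, map_one, map_one]

theorem antipode_mem_cancelIdeal (b : R) {x : NSym R} (hx : x ∈ cancelIdeal b) :
    HopfAlgebra.antipode R x ∈ cancelIdeal b := by
  -- The preimage of the ideal under the antipode is again a two-sided ideal, because the antipode
  -- reverses products; only the generators remain to be checked.
  let K : TwoSidedIdeal (NSym R) :=
    TwoSidedIdeal.mk' {x | HopfAlgebra.antipode R x ∈ cancelIdeal b}
      (by simp) (fun hx hy => by simpa using add_mem (S := Ideal (NSym R)) hx hy)
      (fun hx => by simpa using hx)
      (fun {x y} hy => by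
        simp only [Set.mem_ofPred_eq, HopfAlgebra.antipode_mul_antidistrib] at hy ⊢
        exact Ideal.mul_mem_right _ _ hy)
      (fun {x y} hy => by
        simp only [Set.mem_ofPred_eq, HopfAlgebra.antipode_mul_antidistrib] at hy ⊢
        exact Ideal.mul_mem_left _ _ hy)
  have h1 : cancelTwoSided b ≤ K := by
    rw [cancelTwoSided, TwoSidedIdeal.span_le]
    rintro _ ⟨n, rfl⟩
    refine (TwoSidedIdeal.mem_mk' _ _ _ _ _ _ _).2 ?_
    rw [Set.mem_ofPred_eq, map_sub, antipode_coeff_cancelSeries, ← Ideal.Quotient.eq,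
      ← coeff_map, map_mk_sSeries_mul, coeff_one, coeff_one]
    split_ifs <;> simp
  have h2 : x ∈ K := h1 (TwoSidedIdeal.mem_asIdeal.1 hx)
  rwa [TwoSidedIdeal.mem_mk'] at h2

/-- The generating series is group-like, so modulo the ideal in both legs its coproduct is 1 · 1,
and its counit is 1. -/
instance (b : R) : (cancelIdeal b).IsHopfIdeal R where
  counit_eq_zero x hx :=
    cancelIdeal_le_ker b (Bialgebra.counitAlgHom R (NSym R)).toRingHom
      (isGroupLikeSeries_cancelSeries b).2 hx
  map_mkQ_comul_eq_zero x hx := by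
    refine cancelIdeal_le_ker b ((Algebra.TensorProduct.map (Ideal.Quotient.mkₐ R (cancelIdeal b))
      (Ideal.Quotient.mkₐ R (cancelIdeal b))).comp (Bialgebra.comulAlgHom R (NSym R))).toRingHom
      ?_ hx
    have h1 := congrArg (map (Algebra.TensorProduct.map (Ideal.Quotient.mkₐ R (cancelIdeal b))
      (Ideal.Quotient.mkₐ R (cancelIdeal b))).toRingHom) (isGroupLikeSeries_cancelSeries b).1
    have h2 : ∀ f : (NSym R)⟦X⟧, map (Ideal.Quotient.mk (cancelIdeal b)) f = 1 → ∀ n,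
        Ideal.Quotient.mk (cancelIdeal b) (coeff n f) = coeff n 1 := by
      intro f hf n
      rw [← coeff_map, hf]
    ext n
    refine (congrArg (coeff n) h1).trans ?_
    rw [map_mul, coeff_mul]
    simp only [coeff_map, AlgHom.toRingHom_eq_coe, RingHom.coe_coe,
      Algebra.TensorProduct.includeLeft_apply, Algebra.TensorProduct.includeRight_apply,
      Algebra.TensorProduct.map_tmul, map_one, Ideal.Quotient.mkₐ_eq_mk,
      h2 _ (map_mk_cancelSeries b), Algebra.TensorProduct.tmul_mul_tmul, one_mul, mul_one]
    rw [coeff_one, Finset.sum_eq_single (n, 0)]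
    · by_cases h : n = 0 <;> simp [coeff_one, h, Algebra.TensorProduct.one_def]
    · rintro ⟨i, j⟩ hij hne
      have : j ≠ 0 := by rintro rfl; simp_all
      simp [coeff_one, this]
    · simp
  antipode_mem x hx := antipode_mem_cancelIdeal b hx

end NSym

end

noncomputable section

/-! ### Transfer operators -/

section RingIdentities

variable {K 𝓔 : Type} [CommRing K] [Ring 𝓔] [Algebra K 𝓔]

/-- A complementary pair of half-turn series are mutually inverse after inverting the parameter. -/
theorem half_transfer_mul_eq_one {w c' : K} (hc : (1 + w) * c' = 1) {a d z e d' T' Ty : 𝓔}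
    (hd : (1 - d) * d' = 1) (hT' : T' * (1 - d) = 1 + w • (1 - e) + a + z)
    (hTy : Ty * ((1 + w) • 1 + a) = 1 + w • e - d - z)
    (hae : a * e = 0) (haz : a * z = 0) (hde : d * e = 0) (hdz : d * z = 0) (hzz : z * z = 0)
    (hez : e * z = z) (hee : e * e = e) (hze : z * e = 0) : Ty * T' = 1 := by
  -- Here w = tβ, a and d are t times the steps at ascents and at descents, z is t times the step
  -- from the state 0, and e is the projection to the state 0. The left factor found here is the
  -- denominator that `Ty` absorbs.
  have h1 : (1 + w) • (1 + w • (1 - e) + a + z) =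
      ((1 + w) • 1 + a) * ((1 + w) • 1 - w • e + z) := by
    simp only [add_mul, mul_add, mul_sub, smul_mul_assoc, mul_smul_comm, mul_one, one_mul,
      hae, haz]
    module
  have h2 : (1 + w • e - d - z) * ((1 + w) • 1 - w • e + z) = (1 + w) • (1 - d) := by
    simp only [add_mul, mul_add, sub_mul, mul_sub, smul_mul_assoc, mul_smul_comm, mul_one, one_mul,
      hde, hdz, hzz, hez, hee, hze]
    module
  have h3 : (1 + w) • (Ty * T' * (1 - d)) = (1 + w) • (1 - d) := by
    rw [mul_assoc, hT', ← mul_smul_comm, h1, ← mul_assoc, hTy, h2]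
  have h4 : Ty * T' * (1 - d) = 1 - d := by
    have := congrArg (c' • ·) h3
    simpa only [smul_smul, mul_comm c', hc, one_smul] using this
  have := congrArg (· * d') h4
  simpa only [mul_assoc, hd, mul_one] using this

/-- The cancellation law for the barred transfer series. -/
theorem bar_transfer_mul_eq_one {w c' : K} (hc : (1 + w) * c' = 1)
    {a d z e p a' B T By Ty : 𝓔} (ha : ((1 + w) • 1 + a) * a' = 1) (hB : B = 1 + a + w • p)
    (hT : T * (1 - a) = 1 + w • (1 - e) + d + z) (hBy : (1 + w) • By = (1 + w) • 1 - a - w • p)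
    (hTy : Ty * ((1 + w) • 1 + a) = 1 + w • e - d - z)
    (hae : a * e = 0) (haz : a * z = 0) (hde : d * e = 0) (hdz : d * z = 0) (hzz : z * z = 0)
    (hez : e * z = z) (hee : e * e = e) (hze : z * e = 0) (hed : e * d = 0)
    (hep : e * p = 0) (hpe : p * e = 0) (hpz : p * z = 0) (hzp : z * p = 0) (hap : a * p = a)
    (hdp : d * p = 0) (hpd : p * d = d) (hdd : d * d = 0) (hzd : z * d = 0) (hpp : p * p = p) :
    (B * T) * (By * Ty) = 1 := by
  -- Since a * p = a, one has (1 - a)(1 - p) = 1 - p, so `T` times 1 - p contains no geometric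
  -- series.
  have h1 : T * (1 - p) = (1 + w • (1 - e) + d + z) * (1 - p) := by
    rw [← hT, mul_assoc]
    congr 1
    simp only [mul_sub, sub_mul, one_mul, mul_one, hap]
    abel
  have h2 : (1 + w) • 1 - a - w • p = (1 - a) + w • (1 - p) := by module
  have h3 : (1 + w) • (B * T * (By * Ty) * ((1 + w) • 1 + a)) =
      (1 + w) • ((1 + w) • 1 + a) := by
    have h4 : (1 + w) • (B * T * (By * Ty) * ((1 + w) • 1 + a)) =
        B * (T * ((1 + w) • By)) * (Ty * ((1 + w) • 1 + a)) := by
      simp only [mul_smul_comm, smul_mul_assoc, mul_assoc]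
    rw [h4, hBy, h2, mul_add T, mul_smul_comm, h1, hT, hTy, hB]
    simp only [add_mul, mul_add, sub_mul, mul_sub, smul_mul_assoc, mul_smul_comm, mul_one, one_mul,
      smul_add, smul_sub,
      hae, haz, hde, hdz, hzz, hez, hee, hze, hed, hep, hpe, hpz, hzp, hap, hdp, hpd, hdd,
      hzd, hpp, mul_assoc, zero_mul, mul_zero]
    module
  have h5 : B * T * (By * Ty) * ((1 + w) • 1 + a) = (1 + w) • 1 + a := by
    have := congrArg (c' • ·) h3
    simpa only [smul_smul, mul_comm c', hc, one_smul] using this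
  have := congrArg (· * a') h5
  simpa only [mul_assoc, ha, mul_one] using this

/-- Two transfer series agree if the descents which are not peaks are turned into ascents. -/
theorem transfer_eq_transfer_peak {w : K} {a d₁ d₂ z e g T T' T₁ T₁' : 𝓔}
    (hg : (1 - a - d₂) * g = 1) (hT : T * (1 - a) = 1 + w • (1 - e) + (d₁ + d₂) + z)
    (hT' : T' * (1 - (d₁ + d₂)) = 1 + w • (1 - e) + a + z)
    (hT₁ : T₁ * (1 - a - d₂) = 1 + w • (1 - e) + d₁ + z)
    (hT₁' : T₁' * (1 - d₁) = 1 + w • (1 - e) + (a + d₂) + z)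
    (hae : a * e = 0) (haz : a * z = 0) (hde : d₁ * e = 0) (hdz : d₁ * z = 0) (hzz : z * z = 0)
    (hez : e * z = z) (hee : e * e = e) (hze : z * e = 0) (hed : e * d₁ = 0)
    (hde₂ : d₂ * e = 0) (hdz₂ : d₂ * z = 0) (hed₂ : e * d₂ = 0) (had : a * d₂ = 0)
    (h11 : d₁ * d₁ = 0) (h21 : d₂ * d₁ = 0) (hzd : z * d₁ = 0) : T' * T = T₁' * T₁ := by
  have h1 : 1 - a - d₂ = (1 - a) * (1 - d₂) := by
    simp only [mul_sub, sub_mul, one_mul, mul_one, had]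
    abel
  -- The factor 1 - (d₁ + d₂) is extracted on the left, where `T'` absorbs it by `hT'`.
  have h2 : (1 + w • (1 - e) + (d₁ + d₂) + z) * (1 - d₂) = (1 - (d₁ + d₂)) *
      (e + z - z * d₂ + (1 + w) • (1 - e) + d₂ + (2 + w) • d₁) := by
    simp only [add_mul, mul_add, sub_mul, mul_sub, smul_mul_assoc, mul_smul_comm, mul_one, one_mul,
      smul_add, smul_sub, hde, hdz, hde₂, hdz₂, hed₂, h11, h21, ← mul_assoc, zero_mul]
    module
  have h3 : T₁' = (1 + w • (1 - e) + (a + d₂) + z) * (1 + d₁) := by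
    have h : (1 - d₁) * (1 + d₁) = 1 := by
      simp only [mul_add, sub_mul, one_mul, mul_one, h11]
      abel
    rw [← hT₁', mul_assoc, h, mul_one]
  have r : ∀ {x y v : 𝓔}, x * y = v → ∀ u, x * (y * u) = v * u := fun h u => by
    rw [← mul_assoc, h]
  have h4 : T' * T * (1 - a - d₂) = T₁' * T₁ * (1 - a - d₂) := by
    rw [mul_assoc T₁', hT₁, h3, h1, mul_assoc T', ← mul_assoc T, hT, h2, ← mul_assoc T', hT']
    simp only [add_mul, mul_add, sub_mul, mul_sub, smul_mul_assoc, mul_smul_comm, mul_one, one_mul,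
      smul_add, smul_sub, hae, haz, hde, hdz, hzz, hez, hee, hze, hed, hde₂, hdz₂, hed₂, had,
      h11, h21, hzd, mul_assoc, r haz, r hzz, r hez, zero_mul, mul_zero]
    module
  have := congrArg (· * g) h4
  simpa only [mul_assoc, hg, mul_one] using this

end RingIdentities

end

/-! ### Operators on sequences and the transfer series of a letter -/

noncomputable section

open PowerSeries

section Operators

variable {R : Type} [CommRing R]

variable (R) in
/-- The shift `v ↦ v (· + 1)` on sequences. -/
def shiftOp : Module.End R (ℕ → R) := LinearMap.funLeft R R Nat.succ

variable (R) in
/-- The projection of sequences that restricts the support to `s`. -/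
def maskOp (s : Set ℕ) : Module.End R (ℕ → R) where
  toFun v := s.indicator v
  map_add' v w := Set.indicator_add s v w
  map_smul' r v := Set.indicator_const_smul s r v

theorem shiftOp_apply (v : ℕ → R) (i : ℕ) : shiftOp R v i = v (i + 1) := rfl

theorem maskOp_apply (s : Set ℕ) (v : ℕ → R) : maskOp R s v = s.indicator v := rfl

theorem maskOp_apply_of_mem {s : Set ℕ} (v : ℕ → R) {i : ℕ} (h : i ∈ s) : maskOp R s v i = v i :=
  Set.indicator_of_mem h v

theorem maskOp_apply_of_notMem {s : Set ℕ} (v : ℕ → R) {i : ℕ} (h : i ∉ s) :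
    maskOp R s v i = 0 := Set.indicator_of_notMem h v

theorem maskOp_univ : maskOp R Set.univ = 1 := by
  ext v i
  simp [maskOp_apply]

theorem maskOp_empty : maskOp R ∅ = 0 := by
  refine LinearMap.ext fun v => ?_
  simp only [maskOp_apply, Set.indicator_empty]
  rfl

theorem maskOp_mul_maskOp (s t : Set ℕ) : maskOp R s * maskOp R t = maskOp R (s ∩ t) := by
  refine LinearMap.ext fun v => ?_
  simp [maskOp_apply, Set.indicator_indicator]

theorem maskOp_add_maskOp {s t : Set ℕ} (h : Disjoint s t) :
    maskOp R s + maskOp R t = maskOp R (s ∪ t) := by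
  refine LinearMap.ext fun v => ?_
  simp [maskOp_apply, Set.indicator_union_of_disjoint h]
  rfl

theorem shiftOp_mul_maskOp (t : Set ℕ) :
    shiftOp R * maskOp R t = maskOp R {i | i + 1 ∈ t} * shiftOp R := by
  refine LinearMap.ext fun v => funext fun i => ?_
  by_cases h : i + 1 ∈ t
  · simp [shiftOp_apply, maskOp_apply_of_mem, h]
  · simp [shiftOp_apply, maskOp_apply_of_notMem, h]

variable (R) in
/-- The steps `i → i + 1` with `i ∈ s`. -/
def stepOp (s : Set ℕ) : Module.End R (ℕ → R) := maskOp R s * shiftOp R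

theorem stepOp_mul_maskOp (s t : Set ℕ) :
    stepOp R s * maskOp R t = stepOp R (s ∩ {i | i + 1 ∈ t}) := by
  rw [stepOp, mul_assoc, shiftOp_mul_maskOp, ← mul_assoc, maskOp_mul_maskOp, stepOp]

theorem maskOp_mul_stepOp (s t : Set ℕ) : maskOp R t * stepOp R s = stepOp R (t ∩ s) := by
  rw [stepOp, ← mul_assoc, maskOp_mul_maskOp, stepOp]

theorem stepOp_empty : stepOp R ∅ = 0 := by
  rw [stepOp, maskOp_empty, zero_mul]

theorem stepOp_mul_stepOp_eq_zero {s t : Set ℕ} (h : ∀ i ∈ s, i + 1 ∉ t) :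
    stepOp R s * stepOp R t = 0 := by
  rw [show stepOp R t = maskOp R t * shiftOp R from rfl, ← mul_assoc, stepOp_mul_maskOp,
    show s ∩ {i | i + 1 ∈ t} = ∅ from Set.eq_empty_of_forall_notMem fun i hi => h i hi.1 hi.2,
    stepOp_empty, zero_mul]

theorem stepOp_add_stepOp {s t : Set ℕ} (h : Disjoint s t) :
    stepOp R s + stepOp R t = stepOp R (s ∪ t) := by
  rw [stepOp, stepOp, ← add_mul, maskOp_add_maskOp h, stepOp]

/-- The transfer series of a letter that may be put into the sets numbered by `m`, and may be shared
by two consecutive sets `i`, `i + 1` if `i ∈ s`. The state is the number of sets begun so far. -/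
def transferSeries (b : R) (m s : Set ℕ) : (Module.End R (ℕ → R))⟦X⟧ :=
  1 + X * C ((shiftOp R + b • maskOp R {0}ᶜ) * maskOp R m) *
    mk fun n => (stepOp R s * maskOp R m) ^ n

theorem coeff_zero_transferSeries (b : R) (m s : Set ℕ) :
    coeff 0 (transferSeries b m s) = 1 := by
  rw [transferSeries, map_add, mul_assoc, coeff_zero_X_mul]
  simp

/-- The first use of a letter either begins a new set, by the shift, or joins the last set at the
cost of a factor b, which requires that a set has been begun. Each of the n further uses begins a
new set that shares the letter with the previous one. -/
theorem coeff_succ_transferSeries (b : R) (m s : Set ℕ) (n : ℕ) :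
    coeff (n + 1) (transferSeries b m s) =
      (shiftOp R + b • maskOp R {0}ᶜ) * maskOp R m * (stepOp R s * maskOp R m) ^ n := by
  rw [transferSeries, map_add, mul_assoc, coeff_succ_X_mul, coeff_C_mul, coeff_mk]
  simp [coeff_one]

/-- The ascents. -/
def ascents (I : Set ℕ) : Set ℕ := {i | 1 ≤ i ∧ i ∉ I}

/-- The series `X` times a constant. -/
def XC (A : Module.End R (ℕ → R)) : (Module.End R (ℕ → R))⟦X⟧ := X * C A

theorem XC_add (A B : Module.End R (ℕ → R)) : XC (A + B) = XC A + XC B := by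
  simp [XC, mul_add]

theorem XC_mul_C (A B : Module.End R (ℕ → R)) : XC A * C B = XC (A * B) := by
  simp [XC, mul_assoc]

theorem C_mul_XC (A B : Module.End R (ℕ → R)) : C B * XC A = XC (B * A) := by
  rw [XC, ← mul_assoc, ← X_mul, mul_assoc, ← map_mul, XC]

theorem XC_zero : XC (0 : Module.End R (ℕ → R)) = 0 := by simp [XC]

theorem XC_mul_XC (A B : Module.End R (ℕ → R)) (h : A * B = 0) : XC A * XC B = 0 := by
  rw [show XC B = X * C B from rfl, X_mul, ← mul_assoc, XC_mul_C, h, XC_zero, zero_mul]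

theorem one_sub_XC_mul (A : Module.End R (ℕ → R)) : (1 - XC A) * mk (fun n => A ^ n) = 1 :=
  one_add_mul_geom A

theorem mul_one_sub_XC (A : Module.End R (ℕ → R)) : mk (fun n => A ^ n) * (1 - XC A) = 1 :=
  geom_mul_one_add A

variable (R) in
/-- Power series over the operators as an algebra over power series over the scalars. -/
@[reducible] def seriesAlgebra : Algebra R⟦X⟧ (Module.End R (ℕ → R))⟦X⟧ :=
  (map (algebraMap R (Module.End R (ℕ → R)))).toAlgebra' fun c f => by
    ext1 n
    rw [coeff_mul, coeff_mul]
    refine Finset.sum_equiv (Equiv.prodComm ℕ ℕ) (fun p => by simp [add_comm]) fun p _ => ?_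
    simpa using Algebra.commutes _ _

attribute [local instance] seriesAlgebra

theorem series_smul_def (k : R⟦X⟧) (f : (Module.End R (ℕ → R))⟦X⟧) :
    k • f = map (algebraMap R (Module.End R (ℕ → R))) k * f := rfl

theorem XC_smul (b : R) (A : Module.End R (ℕ → R)) : XC (b • A) = (X * C b : R⟦X⟧) • C A := by
  rw [series_smul_def, map_mul, map_X, map_C, XC, Algebra.smul_def, map_mul, mul_assoc]

/-- The factor on the right clears the geometric series of shared uses, leaving an expression linear
in `X`. -/
theorem transferSeries_mul (b : R) (s : Set ℕ) :
    transferSeries b Set.univ s * (1 - XC (stepOp R s)) =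
      1 - XC (stepOp R s) + XC (shiftOp R) + (X * C b : R⟦X⟧) • (1 - C (maskOp R {0})) := by
  rw [transferSeries, maskOp_univ, mul_one, mul_one, add_mul, one_mul, mul_assoc _ _ (1 - _),
    mul_one_sub_XC, mul_one]
  change _ + XC _ = _
  rw [XC_add, XC_smul, add_assoc]
  congr 3
  rw [eq_sub_iff_add_eq, ← map_add, maskOp_add_maskOp disjoint_compl_left, Set.compl_union_self,
    maskOp_univ, map_one]

theorem substOminus_smul (b : R) (k : R⟦X⟧) (f : (Module.End R (ℕ → R))⟦X⟧) :
    substOminus b (k • f) = substOminus b k • substOminus b f := by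
  rw [series_smul_def, map_mul, series_smul_def]
  congr 1
  exact (map_substOminus b (Algebra.ofId R (Module.End R (ℕ → R))) k).symm

theorem XC_eq_smul (A : Module.End R (ℕ → R)) : XC A = (X : R⟦X⟧) • C A := by
  rw [series_smul_def, map_X, XC]

theorem substOminus_XC (b : R) (A : Module.End R (ℕ → R)) :
    (1 + X * C b : R⟦X⟧) • substOminus b (XC A) = - XC A := by
  rw [XC_eq_smul, substOminus_smul, substOminus_C, substOminus_X, smul_smul]
  simp only [Algebra.algebraMap_self, map_id, id_eq]
  rw [one_add_mul_ominus, neg_smul]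

/-- Multiplication by 1 + bt clears the denominators of ⊖t, since (1 + bt)(⊖t) = -t. -/
theorem substOminus_transferSeries_mul (b : R) (s : Set ℕ) :
    substOminus b (transferSeries b Set.univ s) * ((1 + X * C b : R⟦X⟧) • 1 + XC (stepOp R s)) =
      1 + (X * C b : R⟦X⟧) • C (maskOp R {0}) + XC (stepOp R s) - XC (shiftOp R) := by
  have h1 := congrArg (fun f => (1 + X * C b : R⟦X⟧) • substOminus b f) (transferSeries_mul b s)
  have h2 := substOminus_XC b (stepOp R s)
  have h3 := substOminus_XC b (shiftOp R)
  have h4 : (1 + X * C b : R⟦X⟧) * substOminus b (X * C b : R⟦X⟧) = - (X * C b) := by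
    rw [map_mul, substOminus_C, substOminus_X, ← mul_assoc]
    simp only [Algebra.algebraMap_self, map_id, id_eq]
    rw [one_add_mul_ominus, neg_mul]
  simp only [map_mul, map_sub, map_add, map_one, substOminus_smul, substOminus_C] at h1 h4
  rw [← mul_smul_comm, smul_sub, h2, smul_add, smul_add, smul_sub, h2, h3, smul_smul, h4] at h1
  rw [sub_neg_eq_add] at h1
  rw [h1, add_smul, one_smul, smul_sub, neg_smul, neg_smul]
  abel

end Operators

end

/-! ### Identities between transfer series -/

noncomputable section

open PowerSeries

section TransferIdentities

variable {R : Type} [CommRing R]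

attribute [local instance] seriesAlgebra

/-- The transfer series of an unprimed letter for the descent set `I`. -/
def unprimedSeries (b : R) (I : Set ℕ) : (Module.End R (ℕ → R))⟦X⟧ :=
  transferSeries b Set.univ (ascents I)

/-- The transfer series of a primed letter for the descent set `I`. -/
def primedSeries (b : R) (I : Set ℕ) : (Module.End R (ℕ → R))⟦X⟧ :=
  transferSeries b Set.univ I

/-- The transfer series of a primed letter for the descent set `I` in the barred case. -/
def primedBarSeries (b : R) (I : Set ℕ) : (Module.End R (ℕ → R))⟦X⟧ :=
  transferSeries b {i | 2 ≤ i ∧ i - 1 ∉ I} ∅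

theorem shiftOp_eq_stepOp : shiftOp R = stepOp R Set.univ := by
  rw [stepOp, maskOp_univ, one_mul]

/-- The step from the state 0 is neither an ascent nor a descent: it begins the first set. -/
theorem shiftOp_eq (I : Set ℕ) (h0 : 0 ∉ I) :
    shiftOp R = stepOp R (ascents I) + stepOp R I + stepOp R {0} := by
  have h1 : Disjoint (ascents I) I := Set.disjoint_left.2 fun i hi => hi.2
  have h2 : Disjoint (ascents I ∪ I) {0} := by
    rw [Set.disjoint_singleton_right]
    rintro (h | h)
    · exact absurd h.1 (by omega)
    · exact h0 h
  rw [stepOp_add_stepOp h1, stepOp_add_stepOp h2, shiftOp_eq_stepOp]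
  congr 1
  ext i
  by_cases h : i = 0 <;> by_cases h' : i ∈ I <;> simp [ascents, h, h'] <;> omega

theorem one_add_smul_inverse (b : R) :
    (1 + X * C b : R⟦X⟧) * mk (fun n => (-b) ^ n) = 1 := by
  simpa using one_add_mul_geom (A := R) (-b)

theorem unprimedSeries_mul (b : R) {I : Set ℕ} (h0 : 0 ∉ I) :
    unprimedSeries b I * (1 - XC (stepOp R (ascents I))) =
      1 + (X * C b : R⟦X⟧) • (1 - C (maskOp R {0})) + XC (stepOp R I) + XC (stepOp R {0}) := by
  rw [unprimedSeries, transferSeries_mul, shiftOp_eq I h0, XC_add, XC_add]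
  abel

theorem primedSeries_mul (b : R) {I : Set ℕ} (h0 : 0 ∉ I) :
    primedSeries b I * (1 - XC (stepOp R I)) =
      1 + (X * C b : R⟦X⟧) • (1 - C (maskOp R {0})) + XC (stepOp R (ascents I)) +
        XC (stepOp R {0}) := by
  rw [primedSeries, transferSeries_mul, shiftOp_eq I h0, XC_add, XC_add]
  abel

theorem substOminus_unprimedSeries_mul (b : R) {I : Set ℕ} (h0 : 0 ∉ I) :
    substOminus b (unprimedSeries b I) *
        ((1 + X * C b : R⟦X⟧) • 1 + XC (stepOp R (ascents I))) =
      1 + (X * C b : R⟦X⟧) • C (maskOp R {0}) - XC (stepOp R I) - XC (stepOp R {0}) := by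
  rw [unprimedSeries, substOminus_transferSeries_mul, shiftOp_eq I h0, XC_add, XC_add]
  abel

theorem XC_stepOp_mul_C_eq_zero {s t : Set ℕ} (h : ∀ i ∈ s, i + 1 ∉ t) :
    XC (stepOp R s) * C (maskOp R t) = 0 := by
  rw [XC_mul_C, stepOp_mul_maskOp,
    show s ∩ {i | i + 1 ∈ t} = ∅ from Set.eq_empty_of_forall_notMem fun i hi => h i hi.1 hi.2,
    stepOp_empty, XC_zero]

theorem XC_stepOp_mul_C {s t : Set ℕ} (h : ∀ i ∈ s, i + 1 ∈ t) :
    XC (stepOp R s) * C (maskOp R t) = XC (stepOp R s) := by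
  rw [XC_mul_C, stepOp_mul_maskOp, Set.inter_eq_left.2 (show s ⊆ {i | i + 1 ∈ t} from h)]

theorem C_mul_XC_stepOp_eq_zero {s t : Set ℕ} (h : ∀ i ∈ s, i ∉ t) :
    C (maskOp R t) * XC (stepOp R s) = 0 := by
  rw [C_mul_XC, maskOp_mul_stepOp,
    show t ∩ s = ∅ from Set.eq_empty_of_forall_notMem fun i hi => h i hi.2 hi.1,
    stepOp_empty, XC_zero]

theorem C_mul_XC_stepOp {s t : Set ℕ} (h : ∀ i ∈ s, i ∈ t) :
    C (maskOp R t) * XC (stepOp R s) = XC (stepOp R s) := by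
  rw [C_mul_XC, maskOp_mul_stepOp, Set.inter_eq_right.2 fun i hi => h i hi]

theorem C_maskOp_mul_eq_zero {s t : Set ℕ} (h : ∀ i ∈ s, i ∉ t) :
    C (maskOp R s) * C (maskOp R t) = 0 := by
  rw [← map_mul, maskOp_mul_maskOp,
    show s ∩ t = ∅ from Set.eq_empty_of_forall_notMem fun i hi => h i hi.1 hi.2, maskOp_empty,
    map_zero]

theorem C_maskOp_mul_self (s : Set ℕ) : C (maskOp R s) * C (maskOp R s) = C (maskOp R s) := by
  rw [← map_mul, maskOp_mul_maskOp, Set.inter_self]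

theorem XC_stepOp_mul_XC {s t : Set ℕ} (h : ∀ i ∈ s, i + 1 ∉ t) :
    XC (stepOp R s) * XC (stepOp R t) = 0 :=
  XC_mul_XC _ _ (stepOp_mul_stepOp_eq_zero h)

/-- Primed letters follow the rules of unprimed ones with ascents and descents exchanged; under ⊖
this exchange is inversion. All relations fed to the ring identity say that a step leads from i to i
+ 1 ≥ 1, so that nothing returns to the state 0. -/
theorem substOminus_unprimedSeries_mul_primedSeries (b : R) {I : Set ℕ} (h0 : 0 ∉ I) :
    substOminus b (unprimedSeries b I) * primedSeries b I = 1 :=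
  half_transfer_mul_eq_one (one_add_smul_inverse b) (one_sub_XC_mul (stepOp R I))
    (primedSeries_mul b h0) (substOminus_unprimedSeries_mul b h0)
    (XC_stepOp_mul_C_eq_zero fun i _ => by simp) (XC_stepOp_mul_XC fun i _ => by simp)
    (XC_stepOp_mul_C_eq_zero fun i _ => by simp) (XC_stepOp_mul_XC fun i _ => by simp)
    (XC_stepOp_mul_XC fun i _ => by simp) (C_mul_XC_stepOp fun i h => h)
    (C_maskOp_mul_self _) (XC_stepOp_mul_C_eq_zero fun i _ => by simp)

theorem primedBarSeries_eq (b : R) (I : Set ℕ) :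
    primedBarSeries b I = 1 + XC (stepOp R (ascents I)) +
      (X * C b : R⟦X⟧) • C (maskOp R {i | 2 ≤ i ∧ i - 1 ∉ I}) := by
  rw [primedBarSeries, transferSeries, stepOp_empty, zero_mul]
  have h1 : (mk fun n => (0 : Module.End R (ℕ → R)) ^ n) = 1 := by
    ext1 n
    rcases n with _ | n <;> simp [coeff_one]
  rw [h1, mul_one, add_mul, shiftOp_eq_stepOp, stepOp_mul_maskOp, smul_mul_assoc,
    maskOp_mul_maskOp]
  change 1 + XC _ = _
  have h2 : Set.univ ∩ {i | i + 1 ∈ {i | 2 ≤ i ∧ i - 1 ∉ I}} = ascents I := by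
    ext i
    simp [ascents]
  have h3 : ({0}ᶜ : Set ℕ) ∩ {i | 2 ≤ i ∧ i - 1 ∉ I} = {i | 2 ≤ i ∧ i - 1 ∉ I} :=
    Set.inter_eq_right.2 fun i hi => by
      have := hi.1
      simp only [Set.mem_compl_iff, Set.mem_singleton_iff]
      omega
  rw [XC_add, XC_smul, add_assoc, h2, h3]

theorem substOminus_primedBarSeries (b : R) (I : Set ℕ) :
    (1 + X * C b : R⟦X⟧) • substOminus b (primedBarSeries b I) =
      (1 + X * C b : R⟦X⟧) • 1 - XC (stepOp R (ascents I)) -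
      (X * C b : R⟦X⟧) • C (maskOp R {i | 2 ≤ i ∧ i - 1 ∉ I}) := by
  rw [primedBarSeries_eq, ← XC_smul, map_add, map_add, map_one, smul_add, smul_add, substOminus_XC,
    substOminus_XC]
  abel

theorem exists_inverse_smul_one_add (b : R) (A : Module.End R (ℕ → R)) :
    ∃ u, ((1 + X * C b : R⟦X⟧) • 1 + XC A) * u = 1 := by
  set v := invOfUnit ((1 + X * C b : R⟦X⟧) • 1 + XC A) 1 with hv
  refine ⟨v, mul_invOfUnit _ _ ?_⟩
  rw [series_smul_def, mul_one, map_add, XC]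
  simp

/-- The peak condition enters in three relations: a descent lies among the states where a primed
letter may have been used, two consecutive steps are not both descents, and the step from 0 is not
followed by a descent. -/
theorem peakBarSeries_cancel (b : R) {I : Set ℕ} (h0 : 0 ∉ I) (hI : IsPeakSet I) :
    (primedBarSeries b I * unprimedSeries b I) *
      substOminus b (primedBarSeries b I * unprimedSeries b I) = 1 := by
  obtain ⟨u, hu⟩ := exists_inverse_smul_one_add b (stepOp R (ascents I))
  rw [map_mul]
  refine bar_transfer_mul_eq_one (one_add_smul_inverse b) hu
    (primedBarSeries_eq b I) (unprimedSeries_mul b h0) (substOminus_primedBarSeries b I)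
    (substOminus_unprimedSeries_mul b h0)
    (XC_stepOp_mul_C_eq_zero fun i _ => by simp) (XC_stepOp_mul_XC fun i _ => by simp)
    (XC_stepOp_mul_C_eq_zero fun i _ => by simp) (XC_stepOp_mul_XC fun i _ => by simp)
    (XC_stepOp_mul_XC fun i _ => by simp) (C_mul_XC_stepOp fun i h => h)
    (C_maskOp_mul_self _) (XC_stepOp_mul_C_eq_zero fun i _ => by simp)
    (C_mul_XC_stepOp_eq_zero ?_) (C_maskOp_mul_eq_zero ?_) (C_maskOp_mul_eq_zero ?_)
    (C_mul_XC_stepOp_eq_zero ?_) (XC_stepOp_mul_C_eq_zero ?_) (XC_stepOp_mul_C ?_)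
    (XC_stepOp_mul_C_eq_zero ?_) (C_mul_XC_stepOp ?_) (XC_stepOp_mul_XC ?_) (XC_stepOp_mul_XC ?_)
    (C_maskOp_mul_self _)
  · rintro i hi rfl; exact h0 hi
  · rintro i rfl; simp
  · rintro i ⟨hi, -⟩ rfl; omega
  · rintro i rfl; simp
  · rintro i rfl; simp
  · rintro i ⟨h1, h2⟩; exact ⟨by omega, by simpa using h2⟩
  · rintro i hi ⟨_, h2⟩; exact h2 (by simpa using hi)
  · intro i hi
    have : i ≠ 0 := by rintro rfl; exact h0 hi
    have : i ≠ 1 := by rintro rfl; exact hI.1 hi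
    refine ⟨by omega, fun h => hI.2 _ h ?_⟩
    rwa [show i - 1 + 1 = i by omega]
  · exact hI.2
  · rintro i rfl; exact hI.1

/-- The peaks of a set of descents. -/
def peaks (I : Set ℕ) : Set ℕ := {i | 2 ≤ i ∧ i ∈ I ∧ i - 1 ∉ I}

/-- The descents that are not peaks move from the primed to the unprimed factor without changing the
product. -/
theorem primedSeries_mul_unprimedSeries_peaks (b : R) {I : Set ℕ} (h0 : 0 ∉ I) :
    primedSeries b I * unprimedSeries b I =
      primedSeries b (peaks I) * unprimedSeries b (peaks I) := by
  have h1 : Disjoint (peaks I) (I \ peaks I) := Set.disjoint_sdiff_right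
  have h2 : peaks I ∪ I \ peaks I = I := Set.union_sdiff_cancel fun i hi => hi.2.1
  have h3 : Disjoint (ascents I) (I \ peaks I) := Set.disjoint_left.2 fun i hi h => hi.2 h.1
  have h4 : ascents I ∪ I \ peaks I = ascents (peaks I) := by
    ext i
    have : i ∈ I → 1 ≤ i := fun h => by
      rcases Nat.eq_zero_or_pos i with rfl | h'
      · exact absurd h h0
      · exact h'
    simp only [ascents, peaks, Set.mem_union, Set.mem_ofPred_eq, Set.mem_sdiff]
    tauto
  have h5 : 0 ∉ peaks I := fun h => h0 h.2.1
  have e1 : XC (stepOp R I) = XC (stepOp R (peaks I)) + XC (stepOp R (I \ peaks I)) := by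
    rw [← XC_add, stepOp_add_stepOp h1, h2]
  have e2 : XC (stepOp R (ascents (peaks I))) =
      XC (stepOp R (ascents I)) + XC (stepOp R (I \ peaks I)) := by
    rw [← XC_add, stepOp_add_stepOp h3, h4]
  have hT := unprimedSeries_mul b h0
  have hT' := primedSeries_mul b h0
  have hT₁ := unprimedSeries_mul b h5
  have hT₁' := primedSeries_mul b h5
  have hg := one_sub_XC_mul (stepOp R (ascents (peaks I)))
  rw [e1] at hT hT'
  rw [e2] at hT₁ hT₁' hg
  rw [← sub_sub] at hT₁ hg
  refine transfer_eq_transfer_peak hg hT hT' hT₁ hT₁'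
    (XC_stepOp_mul_C_eq_zero fun i _ => by simp) (XC_stepOp_mul_XC fun i _ => by simp)
    (XC_stepOp_mul_C_eq_zero fun i _ => by simp) (XC_stepOp_mul_XC fun i _ => by simp)
    (XC_stepOp_mul_XC fun i _ => by simp) (C_mul_XC_stepOp fun i h => h)
    (C_maskOp_mul_self _) (XC_stepOp_mul_C_eq_zero fun i _ => by simp)
    (C_mul_XC_stepOp_eq_zero ?_) (XC_stepOp_mul_C_eq_zero fun i _ => by simp)
    (XC_stepOp_mul_XC fun i _ => by simp) (C_mul_XC_stepOp_eq_zero ?_) (XC_stepOp_mul_XC ?_)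
    (XC_stepOp_mul_XC ?_) (XC_stepOp_mul_XC ?_) (XC_stepOp_mul_XC ?_)
  · rintro i hi rfl; exact h5 hi
  · rintro i hi rfl; exact h0 hi.1
  · rintro i ⟨hi, hi'⟩ ⟨h, h'⟩
    exact h' ⟨by omega, h, by simpa using hi'⟩
  · rintro i ⟨_, hi, _⟩ ⟨_, _, h⟩
    exact h (by simpa using hi)
  · rintro i ⟨hi, _⟩ ⟨_, _, h⟩
    exact h (by simpa using hi)
  · rintro i rfl ⟨h, _⟩
    omega

end TransferIdentities

end

/-! ### Representations of the noncommutative symmetric functions on sequences -/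

noncomputable section

open PowerSeries

namespace NSym

variable {R : Type} [CommRing R]

/-- The algebra morphism that sends each `h_n` to the `n`th coefficient of a series. -/
def liftSeries {A : Type} [Ring A] [Algebra R A] (f : A⟦X⟧) : NSym R →ₐ[R] A :=
  FreeAlgebra.lift R fun n : ℕ+ => coeff (n : ℕ) f

theorem liftSeries_h {A : Type} [Ring A] [Algebra R A] {f : A⟦X⟧} (hf : coeff 0 f = 1) (n : ℕ) :
    liftSeries (R := R) f (h n) = coeff n f := by
  rcases Nat.eq_zero_or_pos n with rfl | hn
  · rw [h_zero, map_one, hf]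
  · lift n to ℕ+ using hn
    rw [h_pnat, liftSeries, FreeAlgebra.lift_ι_apply]

theorem map_liftSeries_hSeries {A : Type} [Ring A] [Algebra R A] {f : A⟦X⟧} (hf : coeff 0 f = 1) :
    map (liftSeries (R := R) f : NSym R →+* A) hSeries = f := by
  ext n
  simpa [hSeries] using liftSeries_h hf n

theorem algHom_ext_hSeries {A : Type} [Ring A] [Algebra R A] {f g : NSym R →ₐ[R] A}
    (h : map (f : NSym R →+* A) hSeries = map (g : NSym R →+* A) hSeries) : f = g := by
  ext n
  have := congrArg (coeff (n : ℕ)) h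
  simpa [hSeries, h_pnat] using this

theorem coeff_zero_unprimedSeries (b : R) (I : Set ℕ) : coeff 0 (unprimedSeries b I) = 1 :=
  coeff_zero_transferSeries _ _ _

theorem coeff_zero_peakSeries (b : R) (I : Set ℕ) :
    coeff 0 (primedSeries b I * unprimedSeries b I) = 1 := by
  simp only [coeff_mul, Finset.HasAntidiagonal.antidiagonal_zero, Finset.sum_singleton, primedSeries,
    unprimedSeries, coeff_zero_transferSeries, mul_one]

theorem coeff_zero_peakBarSeries (b : R) (I : Set ℕ) :
    coeff 0 (primedBarSeries b I * unprimedSeries b I) = 1 := by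
  simp only [coeff_mul, Finset.HasAntidiagonal.antidiagonal_zero, Finset.sum_singleton, primedBarSeries,
    unprimedSeries, coeff_zero_transferSeries, mul_one]

/-- The action of the noncommutative symmetric functions on sequences by unprimed letters. -/
def rep (b : R) (I : Set ℕ) : NSym R →ₐ[R] Module.End R (ℕ → R) :=
  liftSeries (unprimedSeries b I)

/-- The action of the noncommutative symmetric functions on sequences by pairs of letters. -/
def peakRep (b : R) (I : Set ℕ) : NSym R →ₐ[R] Module.End R (ℕ → R) :=
  liftSeries (primedSeries b I * unprimedSeries b I)

/-- The action of the noncommutative symmetric functions on sequences by pairs of letters, in the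
barred case. -/
def peakBarRep (b : R) (I : Set ℕ) : NSym R →ₐ[R] Module.End R (ℕ → R) :=
  liftSeries (primedBarSeries b I * unprimedSeries b I)

/-- The representation sends H(t) to U(t), hence H(⊖t)⁻¹ H(t) to U(⊖t)⁻¹ U(t), and U(⊖t)⁻¹ is the
primed series. -/
theorem rep_thetaAlg (b : R) {I : Set ℕ} (h0 : 0 ∉ I) (a : NSym R) :
    rep b I (thetaAlg b a) = peakRep b I a := by
  have hU : map (rep b I : NSym R →+* _) hSeries = unprimedSeries b I :=
    map_liftSeries_hSeries (coeff_zero_unprimedSeries b I)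
  have h1 : substOminus b (unprimedSeries b I) *
      substOminus b (map (rep b I : NSym R →+* Module.End R (ℕ → R)) sSeries) = 1 := by
    rw [← hU, ← map_mul, ← map_mul, hSeries_mul_sSeries, map_one, map_one]
  have h2 : substOminus b (map (rep b I : NSym R →+* Module.End R (ℕ → R)) sSeries) *
      substOminus b (unprimedSeries b I) = 1 := by
    rw [← hU, ← map_mul, ← map_mul, sSeries_mul_hSeries, map_one, map_one]
  have h3 := left_inv_eq_right_inv h2 (substOminus_unprimedSeries_mul_primedSeries b h0)
  have h4 : (rep b I).comp (thetaAlg b) = peakRep b I := by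
    apply algHom_ext_hSeries
    rw [peakRep, map_liftSeries_hSeries (coeff_zero_peakSeries b I)]
    have h5 : map ((rep b I).comp (thetaAlg b) : NSym R →+* Module.End R (ℕ → R)) hSeries =
        map (rep b I : NSym R →+* Module.End R (ℕ → R))
          (map (thetaAlg b : NSym R →+* NSym R) hSeries) := by
      ext n
      simp
    rw [h5, map_thetaAlg_hSeries, qSeries, map_mul, map_substOminus, h3, hU]
  exact DFunLike.congr_fun h4 a

theorem peakRep_peaks (b : R) {I : Set ℕ} (h0 : 0 ∉ I) :
    peakRep b (peaks I) = peakRep b I := by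
  rw [peakRep, peakRep, primedSeries_mul_unprimedSeries_peaks b h0]

theorem thetaAlg_eq_zero (b : R) {x : NSym R} (hx : x ∈ cancelIdeal b) : thetaAlg b x = 0 :=
  cancelIdeal_le_ker b (thetaAlg b : NSym R →+* NSym R) (map_thetaAlg_cancelSeries b) hx

theorem peakRep_eq_zero (b : R) {I : Set ℕ} (h0 : 0 ∉ I) {x : NSym R} (hx : x ∈ cancelIdeal b) :
    peakRep b I x = 0 := by
  rw [← rep_thetaAlg b h0, thetaAlg_eq_zero b hx, map_zero]

/-- Unlike `peakRep`, this representation is not obtained by composition with `thetaAlg`; it kills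
the ideal because the product series is inverse to its own substitution. -/
theorem peakBarRep_eq_zero (b : R) {I : Set ℕ} (h0 : 0 ∉ I) (hI : IsPeakSet I) {x : NSym R}
    (hx : x ∈ cancelIdeal b) : peakBarRep b I x = 0 := by
  refine cancelIdeal_le_ker b (peakBarRep b I : NSym R →+* Module.End R (ℕ → R)) ?_ hx
  rw [cancelSeries, map_mul, map_substOminus, peakBarRep,
    map_liftSeries_hSeries (coeff_zero_peakBarSeries b I), peakBarSeries_cancel b h0 hI]

end NSym

end

/-! ### Generating functions of tuples of sets of letters -/

noncomputable section

section Tuples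

variable {R : Type} [CommRing R]

/-- Weakly increasing tuples of nonempty sets of letters for which `allow i` holds for the letters
of the `i`th set and `share i` holds for the letters shared by the sets `i - 1` and `i`. -/
def IsGoodTuple (allow share : ℕ → Marked → Prop) {k : ℕ} (S : Fin k → Finset Marked) : Prop :=
  (∀ i, (S i).Nonempty) ∧ (∀ i j, i < j → PrecEq (S i) (S j)) ∧ (∀ i, ∀ x ∈ S i, allow i x) ∧
    ∀ (i : ℕ) (hi : i + 1 < k), ∀ x ∈ S ⟨i, by omega⟩ ∩ S ⟨i + 1, hi⟩, share (i + 1) x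

theorem isGoodTuple_snoc_iff {allow share : ℕ → Marked → Prop} {k : ℕ}
    (S : Fin k → Finset Marked) (T : Finset Marked) :
    IsGoodTuple allow share (Fin.snoc S T : Fin (k + 1) → Finset Marked) ↔
      IsGoodTuple allow share S ∧ T.Nonempty ∧ (∀ i, PrecEq (S i) T) ∧ (∀ x ∈ T, allow k x) ∧
        ∀ i : Fin k, (i : ℕ) + 1 = k → ∀ x ∈ S i ∩ T, share k x := by
  have e1 : ∀ (i : ℕ) (hi : i < k), (Fin.snoc S T : Fin (k + 1) → Finset Marked) ⟨i, by omega⟩ =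
      S ⟨i, hi⟩ := fun i hi => Fin.snoc_castSucc (α := fun _ => Finset Marked) T S ⟨i, hi⟩
  have e2 : (Fin.snoc S T : Fin (k + 1) → Finset Marked) ⟨k, by omega⟩ = T :=
    Fin.snoc_last (α := fun _ => Finset Marked) T S
  constructor
  · rintro ⟨h1, h2, h3, h4⟩
    refine ⟨⟨fun i => by simpa using h1 i.castSucc, fun i j hij => ?_,
      fun i => by simpa using h3 i.castSucc, fun i hi => ?_⟩, by simpa using h1 (Fin.last k),
      fun i => ?_, by simpa using h3 (Fin.last k), fun i hi => ?_⟩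
    · simpa using h2 i.castSucc j.castSucc (by simpa using hij)
    · have := h4 i (by omega)
      rwa [e1 i (by omega), e1 (i + 1) hi] at this
    · simpa using h2 i.castSucc (Fin.last k) (Fin.castSucc_lt_last i)
    · have := h4 i (by omega)
      rwa [e1 i i.2, show (⟨i + 1, by omega⟩ : Fin (k + 1)) = ⟨k, by omega⟩ from Fin.ext hi, e2,
        hi] at this
  · rintro ⟨⟨h1, h2, h3, h4⟩, h5, h6, h7, h8⟩
    refine ⟨fun i => ?_, fun i j hij => ?_, fun i => ?_, fun i hi => ?_⟩
    · induction i using Fin.lastCases with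
      | last => simpa using h5
      | cast i => simpa using h1 i
    · induction i using Fin.lastCases with
      | last => exact absurd hij (Fin.le_last j).not_gt
      | cast i =>
        induction j using Fin.lastCases with
        | last => simpa using h6 i
        | cast j => simpa using h2 i j (by simpa using hij)
    · induction i using Fin.lastCases with
      | last => simpa using h7
      | cast i => simpa using h3 i
    · rcases Nat.lt_or_ge (i + 1) k with h | h
      · rw [e1 i (by omega), e1 (i + 1) h]
        exact h4 i h
      · obtain rfl : k = i + 1 := by omega
        rw [e1 i (by omega), e2]
        exact h8 ⟨i, by omega⟩ rfl

/-- The contribution of a set of letters to the generating function of tuples. -/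
def setTerm (b : R) (T : Finset Marked) : MvPolynomial ℕ R :=
  MvPolynomial.C (b ^ (T.card - 1)) * ∏ x ∈ T, MvPolynomial.X x.index

open Classical in
/-- The good tuples with letters in `X`. -/
def goodTuples (allow share : ℕ → Marked → Prop) (X : Finset Marked) (k : ℕ) :
    Finset (Fin k → Finset Marked) :=
  {S ∈ Fintype.piFinset fun _ => X.powerset | IsGoodTuple allow share S}

theorem mem_goodTuples {allow share : ℕ → Marked → Prop} {X : Finset Marked} {k : ℕ}
    {S : Fin k → Finset Marked} :
    S ∈ goodTuples allow share X k ↔ (∀ i, S i ⊆ X) ∧ IsGoodTuple allow share S := by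
  simp [goodTuples, Fintype.mem_piFinset]

/-- The generating function of the good tuples with letters in `X`. -/
def tupleSum (b : R) (allow share : ℕ → Marked → Prop) (X : Finset Marked) (k : ℕ) :
    MvPolynomial ℕ R :=
  ∑ S ∈ goodTuples allow share X k, ∏ i, setTerm b (S i)

open Classical in
/-- The generating function of the good tuples with letters in `insert a X` that use `a`. -/
def tupleSumUsing (b : R) (allow share : ℕ → Marked → Prop) (X : Finset Marked) (a : Marked)
    (k : ℕ) : MvPolynomial ℕ R :=
  ∑ S ∈ goodTuples allow share (insert a X) k with ∃ i, a ∈ S i, ∏ i, setTerm b (S i)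

variable (b : R) {allow share : ℕ → Marked → Prop} {X : Finset Marked} {a : Marked}

theorem goodTuples_filter_not (ha : a ∉ X) (k : ℕ) [DecidablePred fun S : Fin k → Finset Marked => ¬ ∃ i, a ∈ S i] :
    {S ∈ goodTuples allow share (insert a X) k | ¬ ∃ i, a ∈ S i} = goodTuples allow share X k := by
  ext S
  simp only [Finset.mem_filter, mem_goodTuples, not_exists]
  constructor
  · rintro ⟨⟨h1, h2⟩, h3⟩
    exact ⟨fun i => (Finset.subset_insert_iff_of_notMem (h3 i)).1 (h1 i), h2⟩
  · rintro ⟨h1, h2⟩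
    exact ⟨⟨fun i => (h1 i).trans (Finset.subset_insert _ _), h2⟩, fun i hi => ha (h1 i hi)⟩

theorem tupleSum_insert (ha : a ∉ X) (k : ℕ) :
    tupleSum b allow share (insert a X) k =
      tupleSum b allow share X k + tupleSumUsing b allow share X a k := by
  classical
  rw [tupleSum, ← Finset.sum_filter_not_add_sum_filter _ (fun S => ∃ i, a ∈ S i),
    goodTuples_filter_not ha]
  rfl

theorem tupleSumUsing_zero : tupleSumUsing b allow share X a 0 = 0 := by
  classical
  rw [tupleSumUsing, Finset.filter_false_of_mem, Finset.sum_empty]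
  rintro S - ⟨i, -⟩
  exact i.elim0

theorem tupleSum_zero : tupleSum b allow share X 0 = 1 := by
  have : goodTuples allow share X 0 = {Fin.elim0} := by
    ext S
    rw [mem_goodTuples, Finset.mem_singleton]
    refine ⟨fun _ => Subsingleton.elim _ _, fun _ => ⟨fun i => i.elim0, fun i => i.elim0,
      fun i => i.elim0, fun i => i.elim0, fun i hi => by omega⟩⟩
  rw [tupleSum, this, Finset.sum_singleton, Finset.univ_eq_empty, Finset.prod_empty]

theorem tupleSum_empty_succ (k : ℕ) : tupleSum b allow share ∅ (k + 1) = 0 := by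
  refine Finset.sum_eq_zero fun S hS => ?_
  obtain ⟨h1, h2⟩ := mem_goodTuples.1 hS
  exact absurd (h2.1 0) (by simp [Finset.subset_empty.1 (h1 0)])

theorem prod_setTerm_snoc {k : ℕ} (S : Fin k → Finset Marked) (T : Finset Marked) :
    ∏ i, setTerm b ((Fin.snoc S T : Fin (k + 1) → Finset Marked) i) =
      (∏ i, setTerm b (S i)) * setTerm b T := by
  rw [Fin.prod_univ_castSucc]
  simp

theorem setTerm_singleton : setTerm b {a} = MvPolynomial.X a.index := by
  simp [setTerm]

theorem setTerm_insert {T : Finset Marked} (hT : T.Nonempty) (ha : a ∉ T) :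
    setTerm b (insert a T) = MvPolynomial.X a.index * MvPolynomial.C b * setTerm b T := by
  obtain ⟨n, hn⟩ := Nat.exists_eq_succ_of_ne_zero hT.card_pos.ne'
  rw [setTerm, setTerm, Finset.prod_insert ha, Finset.card_insert_of_notMem ha, hn]
  simp only [Nat.succ_eq_add_one, Nat.add_sub_cancel, pow_succ, map_mul]
  ring

/-- If a largest letter is used, it is used in all later sets. -/
theorem IsGoodTuple.mem_of_le {k : ℕ} {S : Fin k → Finset Marked} (hS : IsGoodTuple allow share S)
    (hle : ∀ i, ∀ x ∈ S i, x ≤ a) {i j : Fin k} (hij : i ≤ j) (hi : a ∈ S i) : a ∈ S j := by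
  rcases hij.eq_or_lt with rfl | hij
  · exact hi
  · obtain ⟨x, hx⟩ := hS.1 j
    rwa [le_antisymm (hS.2.1 i j hij a hi x hx) (hle j x hx)]

open Classical in
-- These are the tuples to which a further set {a} can be appended. If sharing is forbidden, the
-- tuple avoids `a` altogether, for a largest letter that occurs at all occurs in the last set. The
-- condition on i is vacuous for k = 0.
theorem sum_goodTuples_share (hX : ∀ x ∈ X, x < a) (k : ℕ) :
    ∑ S ∈ goodTuples allow share (insert a X) k with
        ∀ i : Fin k, (i : ℕ) + 1 = k → a ∈ S i → share k a, ∏ i, setTerm b (S i) =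
      tupleSum b allow share X k +
        if share k a then tupleSumUsing b allow share X a k else 0 := by
  have haX : a ∉ X := fun h => lt_irrefl _ (hX a h)
  split_ifs with h
  · rw [← tupleSum_insert b haX, Finset.filter_true_of_mem fun S _ i _ _ => h, tupleSum]
  · rw [add_zero, tupleSum, ← goodTuples_filter_not haX]
    refine Finset.sum_congr (Finset.filter_congr fun S hS => ?_) fun _ _ => rfl
    obtain ⟨h1, h2⟩ := mem_goodTuples.1 hS
    constructor
    · rintro h3 ⟨i, hi⟩
      have hk : k - 1 < k := by have := i.2; omega
      refine h (h3 ⟨k - 1, hk⟩ (Nat.sub_add_cancel (by omega)) (h2.mem_of_le ?_ ?_ hi))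
      · intro i x hx
        rcases Finset.mem_insert.1 (h1 i hx) with rfl | hx
        · exact le_rfl
        · exact (hX x hx).le
      · exact Fin.mk_le_mk.2 (by have := i.2; omega)
    · exact fun h3 i _ hi => absurd ⟨i, hi⟩ h3

open Classical in
-- A largest letter that is used lies in the last set. Either that set is {a} and can be removed, or
-- `a` can be removed from it, which costs a factor β.
theorem tupleSumUsing_succ (hX : ∀ x ∈ X, x < a) (k : ℕ) :
    tupleSumUsing b allow share X a (k + 1) =
      if allow k a then MvPolynomial.X a.index * (tupleSum b allow share X k +
        MvPolynomial.C b * tupleSum b allow share X (k + 1) +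
        if share k a then tupleSumUsing b allow share X a k else 0) else 0 := by
  have haX : a ∉ X := fun h => lt_irrefl _ (hX a h)
  have hle : ∀ x ∈ insert a X, x ≤ a := by
    intro x hx
    rcases Finset.mem_insert.1 hx with rfl | hx
    · exact le_rfl
    · exact (hX x hx).le
  have hlast : ∀ S ∈ goodTuples allow share (insert a X) (k + 1),
      (∃ i, a ∈ S i) → a ∈ S (Fin.last k) := by
    rintro S hS ⟨i, hi⟩
    obtain ⟨h1, h2⟩ := mem_goodTuples.1 hS
    exact h2.mem_of_le (fun i x hx => hle x (h1 i hx)) (Fin.le_last i) hi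
  have hsnoc : ∀ S : Fin (k + 1) → Finset Marked, ∃ S' T, S = Fin.snoc S' T := fun S =>
    ⟨Fin.init S, S (Fin.last k), (Fin.snoc_init_self S).symm⟩
  by_cases hk : allow k a
  swap
  · rw [if_neg hk]
    refine Finset.sum_eq_zero fun S hS => ?_
    rw [Finset.mem_filter] at hS
    exact absurd ((mem_goodTuples.1 hS.1).2.2.2.1 _ a (hlast S hS.1 hS.2)) hk
  rw [if_pos hk, add_right_comm, ← sum_goodTuples_share b hX, mul_add, Finset.mul_sum,
    tupleSumUsing, ← Finset.sum_filter_add_sum_filter_not _ (fun S => S (Fin.last k) = {a})]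
  congr 1
  -- Last set equal to {a}: what is left may still contain `a` in its own last set, if sharing is
  -- allowed.
  · symm
    refine Finset.sum_bij' (fun S _ => Fin.snoc S {a}) (fun S _ => Fin.init S) ?_ ?_ ?_ ?_ ?_
    · intro S hS
      simp only [Finset.mem_filter, mem_goodTuples] at hS ⊢
      obtain ⟨⟨h1, h2⟩, h3⟩ := hS
      refine ⟨⟨⟨fun i => ?_, (isGoodTuple_snoc_iff _ _).2 ⟨h2, by simp, fun i x hx y hy => ?_,
        fun x hx => ?_, fun i hi x hx => ?_⟩⟩, Fin.last k, by simp⟩, by simp⟩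
      · induction i using Fin.lastCases with
        | last => simp
        | cast i => simpa using h1 i
      · rw [Finset.mem_singleton.1 hy]
        exact hle x (h1 i hx)
      · rwa [Finset.mem_singleton.1 hx]
      · rw [Finset.mem_inter, Finset.mem_singleton] at hx
        obtain ⟨hx, rfl⟩ := hx
        exact h3 i hi hx
    · intro S hS
      obtain ⟨S', T, rfl⟩ := hsnoc S
      rw [Finset.mem_filter, Finset.mem_filter, mem_goodTuples, isGoodTuple_snoc_iff] at hS
      obtain ⟨⟨⟨h1, h2, -, -, -, h3⟩, -⟩, h4⟩ := hS
      rw [Fin.snoc_last] at h4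
      subst h4
      rw [Fin.init_snoc, Finset.mem_filter, mem_goodTuples]
      refine ⟨⟨fun i => by simpa using h1 i.castSucc, h2⟩, fun i hi ha => h3 i hi a ?_⟩
      simpa using ha
    · intro S hS
      rw [Fin.init_snoc]
    · intro S hS
      rw [Finset.mem_filter] at hS
      rw [← hS.2, Fin.snoc_init_self]
    · intro S hS
      rw [prod_setTerm_snoc, setTerm_singleton, mul_comm]
  -- Last set with other letters: a smaller letter there keeps `a` out of all earlier sets, so
  -- erasing `a` gives a tuple with letters in `X` of the same length.
  · symm
    rw [tupleSum, Finset.mul_sum, Finset.mul_sum]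
    refine Finset.sum_bij' (fun S _ => Fin.snoc (Fin.init S) (insert a (S (Fin.last k))))
      (fun S _ => Fin.snoc (Fin.init S) ((S (Fin.last k)).erase a)) ?_ ?_ ?_ ?_ ?_
    · intro S hS
      obtain ⟨S', T, rfl⟩ := hsnoc S
      rw [mem_goodTuples, isGoodTuple_snoc_iff] at hS
      obtain ⟨h1, h2, h3, h4, h5, h6⟩ := hS
      have h1' : ∀ i, S' i ⊆ X := fun i => by simpa using h1 i.castSucc
      have h1'' : T ⊆ X := by simpa using h1 (Fin.last k)
      rw [Fin.init_snoc, Fin.snoc_last, Finset.mem_filter, Finset.mem_filter, mem_goodTuples,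
        isGoodTuple_snoc_iff, Fin.snoc_last]
      refine ⟨⟨⟨fun i => ?_, h2, by simp, fun i x hx y hy => ?_, fun x hx => ?_,
        fun i hi x hx => h6 i hi x ?_⟩, Fin.last k, by simp⟩, fun h => ?_⟩
      · induction i using Fin.lastCases with
        | last => simpa using Finset.insert_subset_insert a h1''
        | cast i => simpa using (h1' i).trans (Finset.subset_insert _ _)
      · rcases Finset.mem_insert.1 hy with rfl | hy
        · exact (hX x (h1' i hx)).le
        · exact h4 i x hx y hy
      · rcases Finset.mem_insert.1 hx with rfl | hx
        · exact hk
        · exact h5 x hx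
      · rw [Finset.mem_inter, Finset.mem_insert] at hx
        rcases hx with ⟨hx, rfl | hx'⟩
        · exact absurd (h1' i hx) haX
        · exact Finset.mem_inter.2 ⟨hx, hx'⟩
      · obtain ⟨x, hx⟩ := h3
        have h7 : x ∈ insert a T := Finset.mem_insert_of_mem hx
        rw [h, Finset.mem_singleton] at h7
        exact haX (h7 ▸ h1'' hx)
    · intro S hS
      obtain ⟨S', T, rfl⟩ := hsnoc S
      rw [Finset.mem_filter, Finset.mem_filter] at hS
      obtain ⟨⟨h0, h0'⟩, h7⟩ := hS
      have haT := hlast _ h0 h0'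
      rw [mem_goodTuples, isGoodTuple_snoc_iff] at h0
      obtain ⟨h1, h2, h3, h4, h5, h6⟩ := h0
      have h1' : ∀ i, S' i ⊆ insert a X := fun i => by simpa using h1 i.castSucc
      have h1'' : T ⊆ insert a X := by simpa using h1 (Fin.last k)
      rw [Fin.snoc_last] at h7 haT
      have h8 : (T.erase a).Nonempty := by
        rw [Finset.nonempty_iff_ne_empty, Ne, Finset.erase_eq_empty_iff]
        rintro (rfl | h)
        · exact Finset.notMem_empty _ haT
        · exact h7 h
      obtain ⟨y, hy⟩ := h8
      have hya : y < a := lt_of_le_of_ne (hle y (h1'' (Finset.mem_of_mem_erase hy)))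
        (Finset.ne_of_mem_erase hy)
      rw [Fin.init_snoc, Fin.snoc_last, mem_goodTuples, isGoodTuple_snoc_iff]
      refine ⟨fun i => ?_, h2, ⟨y, hy⟩, fun i x hx y hy => h4 i x hx y (Finset.mem_of_mem_erase hy),
        fun x hx => h5 x (Finset.mem_of_mem_erase hx), fun i hi x hx => h6 i hi x ?_⟩
      · induction i using Fin.lastCases with
        | last => simpa using Finset.subset_insert_iff.1 h1''
        | cast i =>
          rw [Fin.snoc_castSucc]
          refine (Finset.subset_insert_iff_of_notMem fun h => ?_).1 (h1' i)
          exact absurd (h4 i a h y (Finset.mem_of_mem_erase hy)) hya.not_ge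
      · rw [Finset.mem_inter] at hx ⊢
        exact ⟨hx.1, Finset.mem_of_mem_erase hx.2⟩
    · intro S hS
      obtain ⟨S', T, rfl⟩ := hsnoc S
      have haT : a ∉ T := fun h => haX (by simpa using (mem_goodTuples.1 hS).1 (Fin.last k) (by simpa using h))
      simp [Finset.erase_insert haT]
    · intro S hS
      rw [Finset.mem_filter, Finset.mem_filter] at hS
      obtain ⟨S', T, rfl⟩ := hsnoc S
      have haT := hlast _ hS.1.1 hS.1.2
      rw [Fin.snoc_last] at haT
      simp [Finset.insert_erase haT]
    · intro S hS
      obtain ⟨S', T, rfl⟩ := hsnoc S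
      obtain ⟨h1, h2⟩ := mem_goodTuples.1 hS
      rw [isGoodTuple_snoc_iff] at h2
      have haT : a ∉ T := fun h => haX (by simpa using h1 (Fin.last k) (by simpa using h))
      rw [Fin.init_snoc, Fin.snoc_last, prod_setTerm_snoc, prod_setTerm_snoc,
        setTerm_insert b h2.2.1 haT]
      ring

end Tuples

end

/-! ### Coefficients of the generating functions as matrix entries of transfer operators -/

noncomputable section

open PowerSeries

section Extraction

variable {R : Type} [CommRing R]

/-- The pairing of sequences up to `N`. -/
def pairUpTo (N : ℕ) (u v : ℕ → R) : R := ∑ k ∈ Finset.range (N + 1), u k * v k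

/-- The sequence vanishes above `N`. -/
def VanishesAbove (N : ℕ) (v : ℕ → R) : Prop := ∀ k, N < k → v k = 0

theorem VanishesAbove.shiftOp {N : ℕ} {v : ℕ → R} (hv : VanishesAbove N v) :
    VanishesAbove N (shiftOp R v) := fun k hk => hv (k + 1) (by omega)

theorem VanishesAbove.maskOp {N : ℕ} {v : ℕ → R} (hv : VanishesAbove N v) (s : Set ℕ) :
    VanishesAbove N (maskOp R s v) := fun k hk => by
  rw [maskOp_apply]
  exact Set.indicator_apply_eq_zero.2 fun _ => hv k hk

theorem VanishesAbove.stepOp {N : ℕ} {v : ℕ → R} (hv : VanishesAbove N v) (s : Set ℕ) :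
    VanishesAbove N (stepOp R s v) := hv.shiftOp.maskOp s

theorem VanishesAbove.step_mask_pow {N : ℕ} {v : ℕ → R} (hv : VanishesAbove N v) (m s : Set ℕ)
    (n : ℕ) : VanishesAbove N (((_root_.stepOp R s * _root_.maskOp R m) ^ n) v) := by
  induction n with
  | zero => exact hv
  | succ n ih =>
    rw [pow_succ']
    exact (ih.maskOp m).stepOp s

theorem VanishesAbove.coeff_transferSeries {N : ℕ} {v : ℕ → R} (hv : VanishesAbove N v) (b : R)
    (m s : Set ℕ) (n : ℕ) : VanishesAbove N (coeff n (transferSeries b m s) v) := by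
  rcases n with _ | n
  · rwa [coeff_zero_transferSeries]
  · rw [coeff_succ_transferSeries]
    intro k hk
    have h1 := (hv.step_mask_pow m s n).maskOp m
    change _root_.shiftOp R _ k + (b • _root_.maskOp R {0}ᶜ _) k = 0
    have h2 := (h1.maskOp {0}ᶜ) k hk
    have h3 := h1.shiftOp k hk
    rw [Pi.smul_apply]
    refine (congrArg₂ (· + b • ·) h3 h2).trans (by simp)

variable (b : R) {allow share : ℕ → Marked → Prop} {X : Finset Marked} {a : Marked}

/-- Every tuple that uses `a` contributes at least one factor of the variable of `a`. -/
theorem coeff_zero_tupleSumUsing (hX : ∀ x ∈ X, x < a) (μ : ℕ →₀ ℕ) (hμ : μ a.index = 0) (k : ℕ) :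
    MvPolynomial.coeff (μ + Finsupp.single a.index 0) (tupleSumUsing b allow share X a k) = 0 := by
  classical
  rcases k with _ | k
  · rw [tupleSumUsing_zero, MvPolynomial.coeff_zero]
  · rw [tupleSumUsing_succ b hX]
    split_ifs
    all_goals simp [MvPolynomial.coeff_X_mul', hμ]

/-- Adding one letter to the alphabet applies the transfer series of the letter. -/
theorem pairUpTo_coeff_tupleSumUsing (hX : ∀ x ∈ X, x < a) {m s : Set ℕ}
    (hm : ∀ k, k + 1 ∈ m ↔ allow k a) (hs : ∀ k, 1 ≤ k → (k ∈ s ↔ share k a)) (N : ℕ)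
    (μ : ℕ →₀ ℕ) (hμ : μ a.index = 0) (r : ℕ) (v : ℕ → R) (hv : VanishesAbove N v) :
    pairUpTo N (fun k => MvPolynomial.coeff (μ + Finsupp.single a.index (r + 1))
        (tupleSumUsing b allow share X a k)) v =
      ∑ p ∈ Finset.HasAntidiagonal.antidiagonal r, pairUpTo N (fun k => MvPolynomial.coeff
        (μ + Finsupp.single a.index p.1) (tupleSum b allow share X k))
          (coeff (p.2 + 1) (transferSeries b m s) v) := by
  classical
  have hsucc : ∀ r k, MvPolynomial.coeff (μ + Finsupp.single a.index (r + 1))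
      (tupleSumUsing b allow share X a (k + 1)) = if allow k a then
        MvPolynomial.coeff (μ + Finsupp.single a.index r) (tupleSum b allow share X k) +
        b * MvPolynomial.coeff (μ + Finsupp.single a.index r) (tupleSum b allow share X (k + 1)) +
        (if share k a then MvPolynomial.coeff (μ + Finsupp.single a.index r)
          (tupleSumUsing b allow share X a k) else 0) else 0 := by
    intro r k
    rw [tupleSumUsing_succ b hX]
    by_cases h : allow k a
    · rw [if_pos h, if_pos h, Finsupp.single_add, ← add_assoc, add_comm _ (Finsupp.single _ 1),
        MvPolynomial.coeff_X_mul, MvPolynomial.coeff_add, MvPolynomial.coeff_add,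
        MvPolynomial.coeff_C_mul]
      congr 1
      split_ifs <;> simp
    · rw [if_neg h, if_neg h, MvPolynomial.coeff_zero]
  -- One occurrence of `a` is peeled off by transposing the recursion for tuples onto v. Iteration
  -- of the last term produces the powers in the coefficients of the transfer series.
  have hstep : ∀ r (v : ℕ → R), VanishesAbove N v →
      pairUpTo N (fun k => MvPolynomial.coeff (μ + Finsupp.single a.index (r + 1))
        (tupleSumUsing b allow share X a k)) v =
      pairUpTo N (fun k => MvPolynomial.coeff (μ + Finsupp.single a.index r)
        (tupleSum b allow share X k)) (coeff 1 (transferSeries b m s) v) +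
      pairUpTo N (fun k => MvPolynomial.coeff (μ + Finsupp.single a.index r)
        (tupleSumUsing b allow share X a k)) ((stepOp R s * maskOp R m) v) := by
    intro r v hv
    have hv' := hv.maskOp m
    have hM : ∀ k, maskOp R m v (k + 1) = if allow k a then v (k + 1) else 0 := by
      intro k
      split_ifs with h
      · exact maskOp_apply_of_mem v ((hm k).2 h)
      · exact maskOp_apply_of_notMem v fun h' => h ((hm k).1 h')
    have hT : ∀ k, coeff 1 (transferSeries b m s) v k =
        maskOp R m v (k + 1) + b * maskOp R {0}ᶜ (maskOp R m v) k := by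
      intro k
      rw [coeff_succ_transferSeries b m s 0, pow_zero, mul_one]
      rfl
    have hS : ∀ k, MvPolynomial.coeff (μ + Finsupp.single a.index r)
        (tupleSumUsing b allow share X a k) * (stepOp R s * maskOp R m) v k =
        (if share k a then MvPolynomial.coeff (μ + Finsupp.single a.index r)
          (tupleSumUsing b allow share X a k) else 0) * maskOp R m v (k + 1) := by
      intro k
      rcases Nat.eq_zero_or_pos k with rfl | hk
      · simp [tupleSumUsing_zero]
      · change _ * maskOp R s (shiftOp R (maskOp R m v)) k = _
        by_cases h : share k a
        · rw [if_pos h, maskOp_apply_of_mem _ ((hs k hk).2 h)]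
          rfl
        · rw [if_neg h, maskOp_apply_of_notMem _ fun h' => h ((hs k hk).1 h'), mul_zero, zero_mul]
    -- The term k = 0 is killed by the mask and the term N + 1 by the vanishing of v, so the index
    -- can be shifted.
    have hP : ∀ u : ℕ → R, ∑ k ∈ Finset.range (N + 1), u k * maskOp R {0}ᶜ (maskOp R m v) k =
        ∑ k ∈ Finset.range (N + 1), u (k + 1) * maskOp R m v (k + 1) := by
      intro u
      rw [Finset.sum_range_succ', Finset.sum_range_succ _ N, hv' (N + 1) (by omega),
        maskOp_apply_of_notMem (s := ({0} : Set ℕ)ᶜ) _ (by simp), mul_zero, mul_zero]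
      congr 1
      refine Finset.sum_congr rfl fun k _ => ?_
      rw [maskOp_apply_of_mem (s := ({0} : Set ℕ)ᶜ) _ (by simp)]
    simp only [pairUpTo, hS, hT]
    rw [Finset.sum_range_succ', tupleSumUsing_zero, MvPolynomial.coeff_zero, zero_mul, add_zero]
    have hlast : ∀ f : ℕ → R, ∑ k ∈ Finset.range (N + 1), f k * maskOp R m v (k + 1) =
        ∑ k ∈ Finset.range N, f k * maskOp R m v (k + 1) := by
      intro f
      rw [Finset.sum_range_succ, hv' (N + 1) (by omega), mul_zero, add_zero]
    simp only [mul_add, Finset.sum_add_distrib, mul_left_comm _ b]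
    rw [← Finset.mul_sum _ _ b, hP, hlast, hlast, hlast, Finset.mul_sum,
      ← Finset.sum_add_distrib, ← Finset.sum_add_distrib]
    refine Finset.sum_congr rfl fun k _ => ?_
    rw [hsucc, hM]
    split_ifs <;> ring
  induction r generalizing v with
  | zero =>
    rw [hstep 0 v hv, Finset.HasAntidiagonal.antidiagonal_zero, Finset.sum_singleton]
    simp only [pairUpTo, coeff_zero_tupleSumUsing b hX μ hμ, zero_mul, Finset.sum_const_zero,
      add_zero]
  | succ r ih =>
    rw [hstep _ v hv, ih ((stepOp R s * maskOp R m) v) ((hv.maskOp m).stepOp s), Finset.Nat.sum_antidiagonal_succ']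
    congr 1
    refine Finset.sum_congr rfl fun p _ => ?_
    rw [coeff_succ_transferSeries, coeff_succ_transferSeries, pow_succ, ← mul_assoc]
    rfl

theorem pairUpTo_coeff_tupleSum_insert (hX : ∀ x ∈ X, x < a) {m s : Set ℕ}
    (hm : ∀ k, k + 1 ∈ m ↔ allow k a) (hs : ∀ k, 1 ≤ k → (k ∈ s ↔ share k a)) (N : ℕ)
    (μ : ℕ →₀ ℕ) (hμ : μ a.index = 0) (r : ℕ) (v : ℕ → R) (hv : VanishesAbove N v) :
    pairUpTo N (fun k => MvPolynomial.coeff (μ + Finsupp.single a.index r)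
        (tupleSum b allow share (insert a X) k)) v =
      ∑ p ∈ Finset.HasAntidiagonal.antidiagonal r, pairUpTo N (fun k => MvPolynomial.coeff
        (μ + Finsupp.single a.index p.1) (tupleSum b allow share X k))
          (coeff p.2 (transferSeries b m s) v) := by
  have haX : a ∉ X := fun h => lt_irrefl _ (hX a h)
  have h1 : pairUpTo N (fun k => MvPolynomial.coeff (μ + Finsupp.single a.index r)
        (tupleSum b allow share (insert a X) k)) v =
      pairUpTo N (fun k => MvPolynomial.coeff (μ + Finsupp.single a.index r)
        (tupleSum b allow share X k)) v +
      pairUpTo N (fun k => MvPolynomial.coeff (μ + Finsupp.single a.index r)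
        (tupleSumUsing b allow share X a k)) v := by
    simp only [pairUpTo, tupleSum_insert b haX, MvPolynomial.coeff_add, add_mul,
      Finset.sum_add_distrib]
  rw [h1]
  rcases r with _ | r
  · rw [Finset.HasAntidiagonal.antidiagonal_zero, Finset.sum_singleton, coeff_zero_transferSeries]
    simp only [pairUpTo, coeff_zero_tupleSumUsing b hX μ hμ, zero_mul, Finset.sum_const_zero,
      add_zero, Module.End.one_apply]
  · rw [pairUpTo_coeff_tupleSumUsing b hX hm hs N μ hμ r v hv,
      Finset.Nat.sum_antidiagonal_succ', coeff_zero_transferSeries, Module.End.one_apply]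

theorem prod_setTerm {k : ℕ} {S : Fin k → Finset Marked} (hS : ∀ i, (S i).Nonempty) :
    ∏ i, setTerm b (S i) = MvPolynomial.monomial (weight S) (b ^ (totalCard S - k)) := by
  have h1 : ∀ T : Finset Marked, setTerm b T =
      MvPolynomial.monomial (∑ x ∈ T, Finsupp.single x.index 1) (b ^ (T.card - 1)) := by
    intro T
    rw [setTerm]
    simp only [MvPolynomial.X]
    rw [MvPolynomial.monomial_sum_index, Finset.prod_congr rfl fun _ _ => rfl]
  have h2 : totalCard S - k = ∑ i, ((S i).card - 1) := by
    have : ∑ i, ((S i).card - 1) + k = totalCard S := by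
      rw [totalCard]
      refine (congrArg (∑ i, ((S i).card - 1) + ·) (show k = ∑ _i : Fin k, 1 by simp)).trans ?_
      rw [← Finset.sum_add_distrib]
      exact Finset.sum_congr rfl fun i _ => Nat.sub_add_cancel (hS i).card_pos
    omega
  simp only [h1]
  rw [← MvPolynomial.monomial_sum_prod, Finset.prod_pow_eq_pow_sum, ← h2]
  rfl

/-- The letters of index less than `n`. -/
def lettersBelow (n : ℕ) : Finset Marked := (Finset.range n ×ˢ Finset.univ).map toLex.toEmbedding

theorem mem_lettersBelow {n : ℕ} {x : Marked} : x ∈ lettersBelow n ↔ x.index < n := by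
  simp only [lettersBelow, Finset.mem_map, Finset.mem_product, Finset.mem_range, Finset.mem_univ,
    and_true]
  constructor
  · rintro ⟨y, hy, rfl⟩
    exact hy
  · exact fun h => ⟨ofLex x, h, rfl⟩

theorem lettersBelow_succ (n : ℕ) : lettersBelow (n + 1) =
    insert (toLex (n, true)) (insert (toLex (n, false)) (lettersBelow n)) := by
  ext x
  have h1 : ∀ c : Bool, x = toLex (n, c) ↔ x.index = n ∧ (ofLex x).2 = c := by
    intro c
    exact Prod.ext_iff (x := ofLex x) (y := (n, c))
  simp only [Finset.mem_insert, mem_lettersBelow, h1]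
  rcases (ofLex x).2 <;> simp <;> omega

theorem coeff_tupleSum (μ : ℕ →₀ ℕ) (k : ℕ) :
    MvPolynomial.coeff μ (tupleSum b allow share X k) =
      ∑ S ∈ goodTuples allow share X k with weight S = μ, b ^ (totalCard S - k) := by
  classical
  rw [tupleSum, MvPolynomial.coeff_sum, Finset.sum_filter]
  refine Finset.sum_congr rfl fun S hS => ?_
  rw [prod_setTerm b (mem_goodTuples.1 hS).2.1, MvPolynomial.coeff_monomial]

theorem weight_apply_eq_zero {k : ℕ} {S : Fin k → Finset Marked} {n : ℕ}
    (hS : ∀ i, ∀ x ∈ S i, x.index ≠ n) : weight S n = 0 := by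
  by_contra h
  have h1 : ∀ i, ∀ x ∈ S i, (Finsupp.single x.index 1 : ℕ →₀ ℕ) n = 0 := fun i x hx =>
    Finsupp.single_eq_of_ne (hS i x hx).symm
  refine h ?_
  rw [weight, Finsupp.finsetSum_apply]
  refine Finset.sum_eq_zero fun i _ => ?_
  rw [Finsupp.finsetSum_apply]
  exact Finset.sum_eq_zero (h1 i)

theorem coeff_tupleSum_lettersBelow (n k : ℕ) (μ : ℕ →₀ ℕ) (r : ℕ) :
    MvPolynomial.coeff (μ + Finsupp.single n (r + 1))
      (tupleSum b allow share (lettersBelow n) k) = 0 := by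
  rw [coeff_tupleSum]
  refine Finset.sum_eq_zero fun S hS => ?_
  rw [Finset.mem_filter, mem_goodTuples] at hS
  have h1 := weight_apply_eq_zero (n := n) (S := S) fun i x hx =>
    (mem_lettersBelow.1 (hS.1.1 i hx)).ne
  rw [hS.2] at h1
  simp at h1

theorem hr_succ (L : ℕ) (μ : ℕ →₀ ℕ) :
    (NSym.hr (L + 1) μ : NSym R) = NSym.hr L μ * NSym.h (μ L) := by
  simp [NSym.hr, List.range_succ]

/-- Induction on the number of variables, adding a primed and then an unprimed letter each time.
Operators accumulate on v from the last variable to the first, which is the order of the word `hr`.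
Over the empty alphabet only the empty tuple remains, and it contributes the entry 0. -/
theorem pairUpTo_coeff_tupleSum {m₁ m₂ s₁ s₂ : Set ℕ}
    (hm₁ : ∀ n k, k + 1 ∈ m₁ ↔ allow k (toLex (n, false)))
    (hs₁ : ∀ n k, 1 ≤ k → (k ∈ s₁ ↔ share k (toLex (n, false))))
    (hm₂ : ∀ n k, k + 1 ∈ m₂ ↔ allow k (toLex (n, true)))
    (hs₂ : ∀ n k, 1 ≤ k → (k ∈ s₂ ↔ share k (toLex (n, true))))
    (N L : ℕ) (μ : ℕ →₀ ℕ) (hμ : ∀ j, L ≤ j → μ j = 0) (v : ℕ → R) (hv : VanishesAbove N v) :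
    pairUpTo N (fun k => MvPolynomial.coeff μ (tupleSum b allow share (lettersBelow L) k)) v =
      NSym.liftSeries (transferSeries b m₁ s₁ * transferSeries b m₂ s₂) (NSym.hr L μ : NSym R) v 0 := by
  have h0 : coeff 0 (transferSeries b m₁ s₁ * transferSeries b m₂ s₂) = 1 := by
    simp only [coeff_mul, Finset.HasAntidiagonal.antidiagonal_zero, Finset.sum_singleton,
      coeff_zero_transferSeries, mul_one]
  induction L generalizing μ v with
  | zero =>
    obtain rfl : μ = 0 := Finsupp.ext fun j => hμ j (Nat.zero_le j)
    have h1 : lettersBelow 0 = ∅ := by simp [lettersBelow]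
    rw [pairUpTo, h1, Finset.sum_range_succ', tupleSum_zero]
    simp [tupleSum_empty_succ, NSym.hr]
  | succ L ih =>
    have hμ' : ∀ j, L ≤ j → (μ.erase L) j = 0 := by
      intro j hj
      rcases hj.eq_or_lt with rfl | hj
      · exact Finsupp.erase_same
      · rw [Finsupp.erase_ne hj.ne', hμ j hj]
    have hr1 : (NSym.hr L (μ.erase L) : NSym R) = NSym.hr L μ := by
      rw [NSym.hr, NSym.hr]
      congr 1
      refine List.map_congr_left fun j hj => ?_
      rw [Finsupp.erase_ne (List.mem_range.1 hj).ne]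
    have hX1 : ∀ x ∈ lettersBelow L, x < toLex (L, false) := fun x hx =>
      Prod.Lex.lt_iff.2 (Or.inl (mem_lettersBelow.1 hx))
    have hX2 : ∀ x ∈ insert (toLex (L, false)) (lettersBelow L), x < toLex (L, true) := by
      intro x hx
      rcases Finset.mem_insert.1 hx with rfl | hx
      · exact Prod.Lex.lt_iff.2 (Or.inr ⟨rfl, by simp⟩)
      · exact Prod.Lex.lt_iff.2 (Or.inl (mem_lettersBelow.1 hx))
    have h2 : ∀ r v, VanishesAbove N v → pairUpTo N (fun k => MvPolynomial.coeff
        (μ.erase L + Finsupp.single L r)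
          (tupleSum b allow share (insert (toLex (L, false)) (lettersBelow L)) k)) v =
        NSym.liftSeries (transferSeries b m₁ s₁ * transferSeries b m₂ s₂) (NSym.hr L μ : NSym R)
          (coeff r (transferSeries b m₁ s₁) v) 0 := by
      intro r v hv
      have := pairUpTo_coeff_tupleSum_insert b hX1 (hm₁ L) (hs₁ L) N (μ.erase L)
        (hμ' L le_rfl) r v hv
      refine this.trans ?_
      rw [Finset.sum_eq_single (0, r)]
      -- The earlier letters do not involve the variable of index L, so all its powers here come
      -- from the primed letter.
      · have h3 := ih (μ.erase L) hμ' _ (hv.coeff_transferSeries b m₁ s₁ r)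
        rw [hr1] at h3
        rw [← h3, Finsupp.single_zero, add_zero]
      · rintro ⟨p, q⟩ hpq hne
        rcases p with _ | p
        · rw [Finset.HasAntidiagonal.mem_antidiagonal] at hpq
          exact absurd (by rw [← hpq, zero_add]) hne
        · rw [pairUpTo]
          refine Finset.sum_eq_zero fun k _ => ?_
          rw [show Marked.index (toLex (L, false)) = L from rfl, coeff_tupleSum_lettersBelow,
            zero_mul]
      · simp
    have h3 := pairUpTo_coeff_tupleSum_insert b hX2 (hm₂ L) (hs₂ L) N (μ.erase L)
      (hμ' L le_rfl) (μ L) v hv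
    rw [show Marked.index (toLex (L, true)) = L from rfl, ← lettersBelow_succ,
      Finsupp.erase_add_single] at h3
    rw [h3, hr_succ, map_mul, NSym.liftSeries_h h0, coeff_mul, Finset.mul_sum]
    rw [LinearMap.sum_apply, Finset.sum_apply]
    refine Finset.sum_congr rfl fun p _ => ?_
    rw [h2 _ _ (hv.coeff_transferSeries b m₂ s₂ _)]
    rfl

end Extraction

end

/-! ### Pairings with the multipeak functions -/

noncomputable section

section Link

variable {R : Type} [CommRing R]

theorem precEq_of_lt {k : ℕ} {S : Fin k → Finset Marked} (hne : ∀ i, (S i).Nonempty)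
    (h : ∀ (i : ℕ) (hi : i + 1 < k), PrecEq (S ⟨i, by omega⟩) (S ⟨i + 1, hi⟩)) :
    ∀ i j, i < j → PrecEq (S i) (S j) := by
  have key : ∀ (n i : ℕ) (hi : i + n + 1 < k),
      PrecEq (S ⟨i, by omega⟩) (S ⟨i + n + 1, hi⟩) := by
    intro n
    induction n with
    | zero => exact h
    | succ n ih =>
      intro i hi x hx y hy
      obtain ⟨z, hz⟩ := hne ⟨i + n + 1, by omega⟩
      exact (ih i (by omega) x hx z hz).trans (h (i + n + 1) hi z hz y hy)
  rintro ⟨i, hi⟩ ⟨j, hj⟩ hij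
  obtain ⟨n, rfl⟩ : ∃ n, j = i + n + 1 := ⟨j - i - 1, by have := Fin.mk_lt_mk.1 hij; omega⟩
  exact key n i hj

theorem zero_notMem_descentSet (α : List ℕ+) : 0 ∉ descentSet α := by
  rintro ⟨k, hk, hk', h⟩
  obtain ⟨n, l, rfl⟩ : ∃ n l, α = n :: l := by
    cases α with
    | nil => simp at hk'
    | cons n l => exact ⟨n, l, rfl⟩
  obtain ⟨k, rfl⟩ := Nat.exists_eq_succ_of_ne_zero hk.ne'
  rw [compSize, List.take_succ_cons, List.map_cons, List.sum_cons] at h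
  have := n.pos
  omega

/-- The condition on shared letters in the definition of the multipeak functions. -/
def peakShare (I : Set ℕ) (k : ℕ) (x : Marked) : Prop := k ∈ I ↔ x.IsPrimed

/-- The condition on letters in the definition of the barred multipeak functions. -/
def barAllow (I : Set ℕ) (k : ℕ) (x : Marked) : Prop := x.IsPrimed → 1 ≤ k ∧ k ∉ I

/-- The condition on shared letters in the definition of the barred multipeak functions. -/
def barShare (I : Set ℕ) (k : ℕ) (x : Marked) : Prop := ¬ x.IsPrimed ∧ k ∉ I

theorem isMultipeakTuple_iff (α : List ℕ+) (S : Fin (compSize α) → Finset Marked) :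
    IsMultipeakTuple α S ↔ IsGoodTuple (fun _ _ => True) (peakShare (descentSet α)) S := by
  constructor
  · rintro ⟨h1, h2⟩
    refine ⟨h1, precEq_of_lt h1 fun i hi => (h2 i hi).1, fun _ _ _ => trivial, fun i hi x hx => ?_⟩
    obtain ⟨-, h3, h4⟩ := h2 i hi
    exact ⟨fun h => h3 h x hx, fun h => by_contra fun h' => h4 h' x hx h⟩
  · rintro ⟨h1, h2, -, h3⟩
    refine ⟨h1, fun i hi => ⟨h2 _ _ (Fin.mk_lt_mk.2 i.lt_succ_self),
      fun h x hx => (h3 i hi x hx).1 h, fun h x hx hp => h ((h3 i hi x hx).2 hp)⟩⟩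

/-- Strict precedence at a descent is weak precedence together with the absence of shared letters.
The sets are numbered from 0, so index k refers to the set just after the possible descent k. -/
theorem isMultipeakBarTuple_iff (α : List ℕ+) (S : Fin (compSize α) → Finset Marked) :
    IsMultipeakBarTuple α S ↔
      IsGoodTuple (barAllow (descentSet α)) (barShare (descentSet α)) S := by
  constructor
  · rintro ⟨h1, h0, h2⟩
    refine ⟨h1, precEq_of_lt h1 fun i hi => (h2 i hi).1, ?_, fun i hi x hx => ?_⟩
    · rintro ⟨i, hi⟩ x hx hp
      rcases i with _ | i
      · exact absurd hp (h0 hi x hx)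
      · exact ⟨by simp, fun h => ((h2 i hi).2.1 h).2 x hx hp⟩
    · obtain ⟨-, h3, h4⟩ := h2 i hi
      -- At a descent a shared letter would be smaller than itself.
      have h5 : i + 1 ∉ descentSet α := fun h =>
        lt_irrefl x ((h3 h).1 x (Finset.mem_inter.1 hx).1 x (Finset.mem_inter.1 hx).2)
      exact ⟨h4 h5 x hx, h5⟩
  · rintro ⟨h1, h2, h3, h4⟩
    refine ⟨h1, fun h0 x hx hp => absurd (h3 _ x hx hp).1 (by simp), fun i hi =>
      ⟨h2 _ _ (Fin.mk_lt_mk.2 i.lt_succ_self), fun h => ⟨fun x hx y hy => ?_, fun x hx hp => ?_⟩,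
        fun _ x hx => (h4 i hi x hx).1⟩⟩
    · refine lt_of_le_of_ne (h2 _ _ (Fin.mk_lt_mk.2 i.lt_succ_self) x hx y hy) ?_
      rintro rfl
      exact (h4 i hi x (Finset.mem_inter.2 ⟨hx, hy⟩)).2 h
    · exact (h3 _ x hx hp).2 h

/-- Letters of index at least L cannot occur in a tuple of the given weight, so the series may be
replaced by a polynomial in finitely many variables. -/
theorem coeff_tupleSeries (b : R) {allow share : ℕ → Marked → Prop} {N : ℕ}
    {P : (Fin N → Finset Marked) → Prop} (hP : ∀ S, P S ↔ IsGoodTuple allow share S)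
    (L : ℕ) (μ : ℕ →₀ ℕ) (hμ : ∀ j, L ≤ j → μ j = 0) :
    MvPowerSeries.coeff μ (tupleSeries b P) =
      MvPolynomial.coeff μ (tupleSum b allow share (lettersBelow L) N) := by
  classical
  rw [coeff_tupleSum]
  change ∑ᶠ S ∈ {S | P S ∧ weight S = μ}, _ = _
  rw [← finsum_mem_coe_finset]
  refine finsum_mem_congr (Set.ext fun S => ?_) fun _ _ => rfl
  rw [Set.mem_ofPred_eq, Finset.mem_coe, Finset.mem_filter, mem_goodTuples, hP]
  refine ⟨fun h => ⟨⟨fun i x hx => ?_, h.1⟩, h.2⟩, fun h => ⟨h.1.2, h.2⟩⟩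
  rw [mem_lettersBelow]
  by_contra hL
  have h1 := mem_weight_support S i hx
  rw [h.2, Finsupp.mem_support_iff] at h1
  exact h1 (hμ _ (not_lt.1 hL))

theorem vanishesAbove_single (N : ℕ) : VanishesAbove N (Pi.single N 1 : ℕ → R) :=
  fun _ hk => Pi.single_eq_of_ne hk.ne' 1

/-- The unit vector at N selects the tuples of length N. It is enough to compare both sides on
words, where the left side reads off a coefficient of the series. -/
theorem nsymForm_eq_of_coeff (b : R) {allow share : ℕ → Marked → Prop} {N : ℕ} {m₁ m₂ s₁ s₂ : Set ℕ}
    (hm₁ : ∀ n k, k + 1 ∈ m₁ ↔ allow k (toLex (n, false)))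
    (hs₁ : ∀ n k, 1 ≤ k → (k ∈ s₁ ↔ share k (toLex (n, false))))
    (hm₂ : ∀ n k, k + 1 ∈ m₂ ↔ allow k (toLex (n, true)))
    (hs₂ : ∀ n k, 1 ≤ k → (k ∈ s₂ ↔ share k (toLex (n, true))))
    {P : (Fin N → Finset Marked) → Prop} (hP : ∀ S, P S ↔ IsGoodTuple allow share S)
    (f : mQSym R) (hf : f.1 = tupleSeries b P) (a : NSym R) :
    nsymForm a f = NSym.liftSeries (transferSeries b m₁ s₁ * transferSeries b m₂ s₂) a
      (Pi.single N 1) 0 := by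
  have : nsymForm.flip f = LinearMap.proj 0 ∘ₗ LinearMap.applyₗ (Pi.single N 1) ∘ₗ
      (NSym.liftSeries (R := R)
        (transferSeries b m₁ s₁ * transferSeries b m₂ s₂)).toLinearMap := by
    refine (FreeAlgebra.basisFreeMonoid R ℕ+).ext fun w => ?_
    obtain ⟨L, μ, hμ, hw⟩ := NSym.basis_eq_hr (R := R) w
    rw [hw, LinearMap.flip_apply, NSym.nsymForm_hr L μ hμ, hf, coeff_tupleSeries b hP L μ hμ]
    refine Eq.trans ?_ (pairUpTo_coeff_tupleSum b hm₁ hs₁ hm₂ hs₂ N L μ hμ _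
      (vanishesAbove_single N))
    rw [pairUpTo, Finset.sum_eq_single N]
    · simp
    · intro k _ hk
      rw [Pi.single_eq_of_ne hk, mul_zero]
    · simp
  exact LinearMap.congr_fun this a

theorem nsymForm_multipeak (b : R) (α : PeakComposition) (a : NSym R) :
    nsymForm a (multipeak b α) =
      NSym.peakRep b (descentSet α.1) a (Pi.single (compSize α.1) 1) 0 := by
  refine nsymForm_eq_of_coeff b (allow := fun _ _ => True) (share := peakShare (descentSet α.1))
    (fun _ _ => by simp) (fun n k hk => ?_) (fun _ _ => by simp) (fun n k hk => ?_)
    (isMultipeakTuple_iff α.1) _ rfl a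
  · simp [peakShare, Marked.IsPrimed]
  · simp [peakShare, Marked.IsPrimed, ascents, hk]

theorem nsymForm_multipeakBar (b : R) (α : PeakComposition) (a : NSym R) :
    nsymForm a (multipeakBar b α) =
      NSym.peakBarRep b (descentSet α.1) a (Pi.single (compSize α.1) 1) 0 := by
  refine nsymForm_eq_of_coeff b (allow := barAllow (descentSet α.1))
    (share := barShare (descentSet α.1)) (fun n k => ?_) (fun n k hk => ?_)
    (fun n k => ?_) (fun n k hk => ?_) (isMultipeakBarTuple_iff α.1) _ rfl a
  · simp [barAllow, Marked.IsPrimed]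
  · simp [barShare, Marked.IsPrimed]
  · simp [barAllow, Marked.IsPrimed]
  · simp [barShare, Marked.IsPrimed, ascents, hk]

end Link

end

/-! ### Words and leading coefficients of the representations -/

noncomputable section

open PowerSeries

section Words

variable {R : Type} [CommRing R]

theorem compSize_nil : compSize [] = 0 := rfl

theorem compSize_cons (n : ℕ+) (g : List ℕ+) : compSize (n :: g) = n + compSize g := by
  simp [compSize]

theorem compSize_append (g g' : List ℕ+) : compSize (g ++ g') = compSize g + compSize g' := by
  simp [compSize]

theorem compSize_eq_zero {g : List ℕ+} : compSize g = 0 ↔ g = [] := by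
  cases g with
  | nil => simp [compSize_nil]
  | cons n g => simp [compSize_cons]

theorem mem_descentSet {α : List ℕ+} {s : ℕ} :
    s ∈ descentSet α ↔ ∃ p q, p ≠ [] ∧ q ≠ [] ∧ α = p ++ q ∧ s = compSize p := by
  constructor
  · rintro ⟨k, hk, hk', rfl⟩
    refine ⟨α.take k, α.drop k, ?_, ?_, (List.take_append_drop k α).symm, rfl⟩
    · exact List.ne_nil_of_length_pos (by rw [List.length_take]; omega)
    · exact List.ne_nil_of_length_pos (by rw [List.length_drop]; omega)
  · rintro ⟨p, q, hp, hq, rfl, rfl⟩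
    refine ⟨p.length, List.length_pos_iff.2 hp, ?_, by simp⟩
    have := List.length_pos_iff.2 hq
    simp
    omega

theorem notMem_descentSet_append_cons {p b : List ℕ+} {m : ℕ+} {k : ℕ} (h1 : compSize p < k)
    (h2 : k < compSize p + m) : k ∉ descentSet (p ++ m :: b) := by
  rw [mem_descentSet]
  rintro ⟨p', q, hp, hq, h, rfl⟩
  rcases List.append_eq_append_iff.1 h with ⟨t, ht, ht'⟩ | ⟨t, rfl, -⟩
  · rw [ht, compSize_append] at h1 h2
    cases t with
    | nil => simp [compSize_nil] at h1
    | cons x t =>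
      rw [List.cons_append, List.cons.injEq] at ht'
      rw [compSize_cons, ← ht'.1] at h2
      omega
  · rw [compSize_append] at h1
    omega

/-- A statistic on words that refines the size, and for which splitting a letter or moving size to
the right increases a word. -/
def wordCode : List ℕ+ → ℕ
  | [] => 0
  | n :: g => 2 ^ compSize (n :: g) + wordCode g

/-- The code is the sum of 2^s over the sizes s of the nonempty suffixes; these are distinct, so it
is a binary number whose leading digit records the size of the word. -/
theorem wordCode_lt (g : List ℕ+) : wordCode g < 2 ^ (compSize g + 1) := by
  induction g with
  | nil => simp [wordCode]
  | cons n g ih =>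
    have h1 : 2 ^ (compSize g + 1) ≤ 2 ^ compSize (n :: g) :=
      Nat.pow_le_pow_right (by norm_num) (by have := n.pos; rw [compSize_cons]; omega)
    rw [wordCode, pow_succ]
    omega

theorem le_wordCode {g : List ℕ+} (hg : g ≠ []) : 2 ^ compSize g ≤ wordCode g := by
  cases g with
  | nil => exact absurd rfl hg
  | cons n g => exact Nat.le_add_right _ _

theorem wordCode_lt_of_compSize_lt {g g' : List ℕ+} (h : compSize g < compSize g') :
    wordCode g < wordCode g' := by
  have h1 := wordCode_lt g
  have h2 : 2 ^ (compSize g + 1) ≤ 2 ^ compSize g' := Nat.pow_le_pow_right (by norm_num) h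
  have h3 := le_wordCode (g := g') (by rintro rfl; simp [compSize_nil] at h)
  omega

theorem wordCode_cons_lt {m n : ℕ+} {g b : List ℕ+} (h : compSize (n :: g) = compSize (m :: b))
    (h' : wordCode b < wordCode g) : wordCode (m :: b) < wordCode (n :: g) := by
  rw [wordCode, wordCode, h]
  omega

variable (R) in
/-- The product of generators attached to a word. -/
def NSym.word (g : List ℕ+) : NSym R := (g.map fun n : ℕ+ => (NSym.h n : NSym R)).prod

theorem NSym.word_nil : NSym.word R [] = 1 := rfl

theorem NSym.word_cons (n : ℕ+) (g : List ℕ+) :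
    NSym.word R (n :: g) = NSym.h n * NSym.word R g := by
  simp [NSym.word]

theorem NSym.word_append (g g' : List ℕ+) :
    NSym.word R (g ++ g') = NSym.word R g * NSym.word R g' := by
  simp [NSym.word]

/-- On sequences vanishing below `i + n`, the entry `i` of the image under the operator is `c` times
the entry `i + n`. -/
def HasTop (O : Module.End R (ℕ → R)) (n i : ℕ) (c : R) : Prop :=
  ∀ w : ℕ → R, (∀ k < i + n, w k = 0) → O w i = c * w (i + n)

theorem HasTop.congr {O : Module.End R (ℕ → R)} {n i : ℕ} {c c' : R} (h : HasTop O n i c)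
    (hc : c = c') : HasTop O n i c' := hc ▸ h

theorem hasTop_one (i : ℕ) : HasTop (1 : Module.End R (ℕ → R)) 0 i 1 := fun w _ => by simp

/-- The hypothesis on all states k guarantees that the image of `O'` vanishes below i + m, so that
the top coefficient of `O` applies. -/
theorem HasTop.mul {O O' : Module.End R (ℕ → R)} {m n i : ℕ} {c c' : R} (h : HasTop O m i c)
    (h' : ∀ k, ∃ c, HasTop O' n k c) (hc' : HasTop O' n (i + m) c') :
    HasTop (O * O') (m + n) i (c * c') := by
  intro w hw
  rw [Module.End.mul_apply, h, hc' w fun k hk => hw k (by omega), mul_assoc, add_assoc]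
  intro k hk
  obtain ⟨d, hd⟩ := h' k
  rw [hd w fun j hj => hw j (by omega), hw _ (by omega), mul_zero]

theorem HasTop.add {O O' : Module.End R (ℕ → R)} {n i : ℕ} {c c' : R} (h : HasTop O n i c)
    (h' : HasTop O' n i c') : HasTop (O + O') n i (c + c') := by
  intro w hw
  rw [LinearMap.add_apply, Pi.add_apply, h w hw, h' w hw, add_mul]

theorem HasTop.sum {ι : Type} {s : Finset ι} {O : ι → Module.End R (ℕ → R)} {n i : ℕ} {c : ι → R}
    (h : ∀ j ∈ s, HasTop (O j) n i (c j)) : HasTop (∑ j ∈ s, O j) n i (∑ j ∈ s, c j) := by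
  intro w hw
  rw [LinearMap.sum_apply, Finset.sum_apply, Finset.sum_mul]
  exact Finset.sum_congr rfl fun j hj => h j hj w hw

theorem hasTop_shiftOp (i : ℕ) : HasTop (shiftOp R) 1 i 1 := fun w _ => by
  rw [shiftOp_apply, one_mul]

open Classical in
theorem hasTop_maskOp (s : Set ℕ) (i : ℕ) : HasTop (maskOp R s) 0 i (if i ∈ s then 1 else 0) := by
  intro w _
  split_ifs with h
  · rw [maskOp_apply_of_mem _ h, one_mul, add_zero]
  · rw [maskOp_apply_of_notMem _ h, zero_mul]

/-- The term with b does not raise the state and is invisible at the top: leading coefficients do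
not depend on β. -/
theorem hasTop_shiftOp_add (b : R) (i : ℕ) :
    HasTop (shiftOp R + b • maskOp R {0}ᶜ) 1 i 1 := by
  classical
  intro w hw
  have h := hasTop_maskOp (R := R) {0}ᶜ i w fun k hk => hw k (by omega)
  rw [LinearMap.add_apply, Pi.add_apply, hasTop_shiftOp i w hw, LinearMap.smul_apply, Pi.smul_apply,
    h, add_zero, hw i (by omega)]
  simp

open Classical in
theorem hasTop_stepOp (s : Set ℕ) (i : ℕ) :
    HasTop (stepOp R s) 1 i (if i ∈ s then 1 else 0) := by
  have := (hasTop_maskOp (R := R) s i).mul (fun k => ⟨1, hasTop_shiftOp k⟩) (hasTop_shiftOp (i + 0))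
  rwa [mul_one, zero_add] at this

open Classical in
theorem hasTop_stepOp_pow (s : Set ℕ) (n i : ℕ) :
    HasTop (stepOp R s ^ n) n i (if ∀ k, i ≤ k → k < i + n → k ∈ s then 1 else 0) := by
  induction n generalizing i with
  | zero =>
    rw [if_pos fun k _ _ => by omega]
    exact hasTop_one i
  | succ n ih =>
    have h := (hasTop_stepOp (R := R) s i).mul (fun k => ⟨_, ih k⟩) (ih (i + 1))
    rw [← pow_succ', add_comm 1 n, ite_zero_mul_ite_zero, one_mul] at h
    refine h.congr (if_congr ⟨fun ⟨h1, h2⟩ k hk hk' => ?_, fun h' => ⟨h' i le_rfl (by omega),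
      fun k hk hk' => h' k (by omega) (by omega)⟩⟩ rfl rfl)
    rcases hk.eq_or_lt with rfl | hk
    · exact h1
    · exact h2 k hk (by omega)

open Classical in
theorem hasTop_coeff_succ_transferSeries (b : R) (s : Set ℕ) (n i : ℕ) :
    HasTop (coeff (n + 1) (transferSeries b Set.univ s)) (n + 1) i
      (if ∀ k, i < k → k < i + (n + 1) → k ∈ s then 1 else 0) := by
  rw [coeff_succ_transferSeries, maskOp_univ, mul_one, mul_one]
  have h := (hasTop_shiftOp_add b i).mul (fun k => ⟨_, hasTop_stepOp_pow s n k⟩)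
    (hasTop_stepOp_pow s n (i + 1))
  rw [one_mul, add_comm 1 n] at h
  convert h using 2
  simp only [Nat.succ_le_iff, add_right_comm i 1 n, add_assoc]

theorem hasTop_coeff_transferSeries_univ (b : R) (s : Set ℕ) (n i : ℕ) :
    ∃ c, HasTop (coeff n (transferSeries b Set.univ s)) n i c := by
  rcases n with _ | n
  · rw [coeff_zero_transferSeries]
    exact ⟨1, hasTop_one i⟩
  · exact ⟨_, hasTop_coeff_succ_transferSeries b s n i⟩

theorem hasTop_coeff_mul {f g : (Module.End R (ℕ → R))⟦X⟧} {n i : ℕ} {c d : ℕ → R}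
    (hf : ∀ p ≤ n, HasTop (coeff p f) p i (c p)) (hg' : ∀ q k, ∃ c, HasTop (coeff q g) q k c)
    (hg : ∀ p ≤ n, HasTop (coeff (n - p) g) (n - p) (i + p) (d p)) :
    HasTop (coeff n (f * g)) n i (∑ p ∈ Finset.range (n + 1), c p * d p) := by
  rw [coeff_mul, Finset.Nat.sum_antidiagonal_eq_sum_range_succ_mk]
  refine HasTop.sum fun p hp => ?_
  rw [Finset.mem_range, Nat.lt_succ_iff] at hp
  have := (hf p hp).mul (fun k => hg' _ k) (hg p hp)
  rwa [Nat.add_sub_cancel' hp] at this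

theorem exists_hasTop_coeff_mul {f g : (Module.End R (ℕ → R))⟦X⟧}
    (hf : ∀ p k, ∃ c, HasTop (coeff p f) p k c) (hg : ∀ q k, ∃ c, HasTop (coeff q g) q k c)
    (n i : ℕ) : ∃ c, HasTop (coeff n (f * g)) n i c := by
  choose c hc using hf
  choose d hd using hg
  exact ⟨_, hasTop_coeff_mul (fun p _ => hc p i) (fun q k => ⟨_, hd q k⟩)
    (fun p _ => hd (n - p) (i + p))⟩

open Classical in
/-- The representation is triangular: from a boundary `i` of `I`, the top coefficient of the
image of `h n` is `d` if there are no elements of `I` strictly between `i` and `i + n`, and zero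
otherwise. -/
def IsTriangularRep (φ : NSym R →ₐ[R] Module.End R (ℕ → R)) (d : R) (I : Set ℕ) : Prop :=
  (∀ n i, ∃ c, HasTop (φ (NSym.h n)) n i c) ∧
    ∀ n i, (i = 0 ∨ i ∈ I) → HasTop (φ (NSym.h (n + 1))) (n + 1) i
      (if ∀ k, i < k → k < i + (n + 1) → k ∉ I then d else 0)

open Classical in
theorem hasTop_coeff_unprimedSeries (b : R) (I : Set ℕ) (n i : ℕ) :
    HasTop (coeff (n + 1) (unprimedSeries b I)) (n + 1) i
      (if ∀ k, i < k → k < i + (n + 1) → k ∉ I then 1 else 0) := by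
  have := hasTop_coeff_succ_transferSeries b (ascents I) n i
  refine this.congr (if_congr (forall_congr' fun k => imp_congr_right fun h1 =>
    imp_congr_right fun h2 => ?_) rfl rfl)
  exact ⟨fun h => h.2, fun h => ⟨by omega, h⟩⟩

theorem isTriangularRep_rep (b : R) (I : Set ℕ) : IsTriangularRep (NSym.rep b I) 1 I := by
  have h (n : ℕ) : NSym.rep b I (NSym.h n) = coeff n (unprimedSeries b I) :=
    NSym.liftSeries_h (NSym.coeff_zero_unprimedSeries b I) n
  refine ⟨fun n i => ?_, fun n i _ => ?_⟩
  · rw [h]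
    exact hasTop_coeff_transferSeries_univ b _ n i
  · rw [h]
    exact hasTop_coeff_unprimedSeries b I n i

/-- The factor 2 counts the two ways of beginning at a boundary i. Either all uses are unprimed, or
one primed use precedes them; a second primed use would require i + 1 ∈ I, which the peak condition
excludes. -/
theorem isTriangularRep_peakRep (b : R) {I : Set ℕ} (hI : IsPeakSet I) :
    IsTriangularRep (NSym.peakRep b I) 2 I := by
  classical
  have h (n : ℕ) : NSym.peakRep b I (NSym.h n) = coeff n (primedSeries b I * unprimedSeries b I) :=
    NSym.liftSeries_h (NSym.coeff_zero_peakSeries b I) n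
  refine ⟨fun n i => ?_, fun n i hi => ?_⟩
  · rw [h]
    exact exists_hasTop_coeff_mul (fun p k => hasTop_coeff_transferSeries_univ b _ p k)
      (fun p k => hasTop_coeff_transferSeries_univ b _ p k) n i
  · have hi' : i + 1 ∉ I := by
      rcases hi with rfl | hi
      · exact hI.1
      · exact hI.2 i hi
    have h0 : HasTop (coeff 0 (primedSeries b I)) 0 i 1 := by
      rw [primedSeries, coeff_zero_transferSeries]
      exact hasTop_one i
    have h1 : HasTop (coeff 1 (primedSeries b I)) 1 i 1 := by
      have := hasTop_coeff_succ_transferSeries b I 0 i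
      rwa [if_pos fun k _ _ => by omega] at this
    have h2 : ∀ p, HasTop (coeff (p + 2) (primedSeries b I)) (p + 2) i 0 := by
      intro p
      have := hasTop_coeff_succ_transferSeries b I (p + 1) i
      rwa [if_neg fun h => hi' (h (i + 1) (by omega) (by omega))] at this
    rw [h]
    have hg' : ∀ q k, ∃ c, HasTop (coeff q (unprimedSeries b I)) q k c :=
      fun q k => hasTop_coeff_transferSeries_univ b _ q k
    choose d hd using hg'
    -- After the primed use the state is i + 1. Its own membership in I is excluded by `hi'`, so the
    -- condition can be stated from i.
    have h3 : HasTop (coeff n (unprimedSeries b I)) n (i + 1)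
        (if ∀ k, i < k → k < i + (n + 1) → k ∉ I then 1 else 0) := by
      rcases n with _ | n
      · rw [if_pos fun k _ _ => by omega, unprimedSeries, coeff_zero_transferSeries]
        exact hasTop_one _
      · refine (hasTop_coeff_unprimedSeries b I n (i + 1)).congr (if_congr
          ⟨fun h k hk hk' => ?_, fun h k hk hk' => h k (by omega) (by omega)⟩ rfl rfl)
        rcases eq_or_ne k (i + 1) with rfl | hne
        · exact hi'
        · exact h k (by omega) (by omega)
    have h4 : coeff (n + 1) (primedSeries b I * unprimedSeries b I) =
        coeff (n + 1) (unprimedSeries b I) +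
          coeff 1 (primedSeries b I) * coeff n (unprimedSeries b I) +
          ∑ p ∈ Finset.range n,
            coeff (p + 2) (primedSeries b I) * coeff (n - (p + 1)) (unprimedSeries b I) := by
      rw [coeff_mul, Finset.Nat.sum_antidiagonal_eq_sum_range_succ_mk, Finset.sum_range_succ',
        Finset.sum_range_succ']
      have : coeff 0 (primedSeries b I) = 1 := coeff_zero_transferSeries _ _ _
      simp only [this, one_mul, Nat.sub_zero, zero_add, Nat.add_sub_cancel]
      simp only [Nat.reduceSubDiff]
      abel
    have h5 : HasTop (∑ p ∈ Finset.range n,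
        coeff (p + 2) (primedSeries b I) * coeff (n - (p + 1)) (unprimedSeries b I)) (n + 1) i
          (∑ p ∈ Finset.range n, 0) := by
      refine HasTop.sum fun p hp => ?_
      rw [Finset.mem_range] at hp
      have := (h2 p).mul (fun k => ⟨_, hd (n - (p + 1)) k⟩) (hd (n - (p + 1)) _)
      rwa [zero_mul, show p + 2 + (n - (p + 1)) = n + 1 by omega] at this
    have h6 := h1.mul (fun k => ⟨_, hd n k⟩) h3
    rw [add_comm 1 n] at h6
    have h7 := ((hasTop_coeff_unprimedSeries b I n i).add h6).add h5
    rw [h4]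
    convert h7 using 1
    split_ifs <;> simp; norm_num

/-- A set begun at a boundary may contain no primed letter, and primed letters are never shared, so
only the unprimed contribution survives. -/
theorem isTriangularRep_peakBarRep (b : R) (I : Set ℕ) :
    IsTriangularRep (NSym.peakBarRep b I) 1 I := by
  classical
  have h (n : ℕ) : NSym.peakBarRep b I (NSym.h n) =
      coeff n (primedBarSeries b I * unprimedSeries b I) :=
    NSym.liftSeries_h (NSym.coeff_zero_peakBarSeries b I) n
  have hg' : ∀ q k, ∃ c, HasTop (coeff q (unprimedSeries b I)) q k c :=
    fun q k => hasTop_coeff_transferSeries_univ b _ q k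
  have h0 : coeff 0 (primedBarSeries b I) = 1 := coeff_zero_transferSeries _ _ _
  have h1 (i : ℕ) : HasTop (coeff 1 (primedBarSeries b I)) 1 i
      (if i + 1 ∈ {i | 2 ≤ i ∧ i - 1 ∉ I} then 1 else 0) := by
    rw [primedBarSeries, coeff_succ_transferSeries b _ _ 0, pow_zero, mul_one]
    have := (hasTop_shiftOp_add b i).mul (fun k => ⟨_, hasTop_maskOp _ k⟩)
      (hasTop_maskOp {i | 2 ≤ i ∧ i - 1 ∉ I} (i + 1))
    rw [one_mul, add_zero] at this
    convert this
  have h2 (p : ℕ) : coeff (p + 2) (primedBarSeries b I) = 0 := by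
    rw [primedBarSeries, coeff_succ_transferSeries, stepOp_empty, zero_mul, pow_succ, mul_zero,
      mul_zero]
  have h3 (n : ℕ) : coeff (n + 1) (primedBarSeries b I * unprimedSeries b I) =
      coeff (n + 1) (unprimedSeries b I) +
        coeff 1 (primedBarSeries b I) * coeff n (unprimedSeries b I) := by
    rw [coeff_mul, Finset.Nat.sum_antidiagonal_eq_sum_range_succ_mk, Finset.sum_range_succ',
      Finset.sum_range_succ', Finset.sum_eq_zero fun p _ => by rw [h2, zero_mul]]
    simp only [h0, one_mul, Nat.sub_zero, zero_add, Nat.add_sub_cancel]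
    abel
  refine ⟨fun n i => ?_, fun n i hi => ?_⟩
  · rw [h]
    refine exists_hasTop_coeff_mul (fun p k => ?_) hg' n i
    rcases p with _ | _ | p
    · rw [h0]
      exact ⟨1, hasTop_one k⟩
    · exact ⟨_, h1 k⟩
    · rw [h2]
      exact ⟨0, fun w _ => by simp⟩
  · rw [h, h3]
    obtain ⟨c, hc⟩ := hg' n (i + 1)
    have h4 := (h1 i).mul (hg' n) hc
    rw [if_neg, zero_mul, add_comm 1 n] at h4
    · have := (hasTop_coeff_unprimedSeries b I n i).add h4
      rwa [add_zero] at this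
    · rintro ⟨h5, h6⟩
      rcases hi with rfl | hi
      · omega
      · exact h6 (by simpa using hi)

theorem IsTriangularRep.exists_hasTop_word {φ : NSym R →ₐ[R] Module.End R (ℕ → R)} {d : R}
    {I : Set ℕ} (hφ : IsTriangularRep φ d I) (g : List ℕ+) (i : ℕ) :
    ∃ c, HasTop (φ (NSym.word R g)) (compSize g) i c := by
  induction g generalizing i with
  | nil =>
    rw [NSym.word_nil, map_one]
    exact ⟨1, hasTop_one i⟩
  | cons n g ih =>
    obtain ⟨c, hc⟩ := hφ.1 n i
    obtain ⟨c', hc'⟩ := ih (i + n)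
    rw [NSym.word_cons, map_mul, compSize_cons]
    exact ⟨_, hc.mul ih hc'⟩

/-- A letter of g cannot pass over an element of the descent set, so its first letter is at most
that of b. If they are equal, the tails are compared; if it is smaller, the tail of g is larger in
size and hence in code. -/
theorem IsTriangularRep.hasTop_word {d : R} {α : List ℕ+}
    {φ : NSym R →ₐ[R] Module.End R (ℕ → R)} (hφ : IsTriangularRep φ d (descentSet α))
    (g : List ℕ+) (p b : List ℕ+) (hα : α = p ++ b) (hg : compSize g = compSize b) :
    ∃ c, HasTop (φ (NSym.word R g)) (compSize g) (compSize p) c ∧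
      (c ≠ 0 → g = b ∨ wordCode b < wordCode g) ∧ (g = b → c = d ^ b.length) := by
  classical
  induction g generalizing p b with
  | nil =>
    obtain rfl : b = [] := compSize_eq_zero.1 hg.symm
    rw [NSym.word_nil, map_one]
    exact ⟨1, hasTop_one _, fun _ => Or.inl rfl, fun _ => by simp⟩
  | cons n g ih =>
    rcases b with _ | ⟨m, b⟩
    · exact absurd (compSize_eq_zero.1 hg) (by simp)
    have hp : compSize p = 0 ∨ compSize p ∈ descentSet α := by
      rcases eq_or_ne p [] with rfl | hp
      · exact Or.inl rfl
      · exact Or.inr (mem_descentSet.2 ⟨p, m :: b, hp, by simp, hα, rfl⟩)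
    have h1 : HasTop (φ (NSym.h n)) n (compSize p)
        (if ∀ k, compSize p < k → k < compSize p + n → k ∉ descentSet α then d else 0) := by
      have := hφ.2 (n - 1 : ℕ) _ hp
      rwa [Nat.sub_add_cancel n.pos] at this
    rw [NSym.word_cons, map_mul]
    have hg0 := hg
    rw [compSize_cons, compSize_cons] at hg
    -- If n > m, the state compSize p + m is a descent strictly inside the step; equality of sizes
    -- makes the tail of b nonempty.
    have hle : (∀ k, compSize p < k → k < compSize p + n → k ∉ descentSet α) → (n : ℕ) ≤ m := by
      intro h
      by_contra hlt
      refine h (compSize p + m) (by have := m.pos; omega) (by omega) (mem_descentSet.2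
        ⟨p ++ [m], b, by simp, ?_, by simp [hα], by simp [compSize_append, compSize_cons,
          compSize_nil]⟩)
      rintro rfl
      rw [compSize_nil] at hg
      omega
    rcases eq_or_ne n m with rfl | hne
    · obtain ⟨c, hc, hc1, hc2⟩ := ih (p ++ [n]) b (by simp [hα]) (by omega)
      rw [compSize_append, compSize_cons, compSize_nil, add_zero] at hc
      have h2 := h1.mul (hφ.exists_hasTop_word g) hc
      rw [if_pos fun k hk hk' => hα ▸ notMem_descentSet_append_cons hk hk'] at h2
      refine ⟨_, by rwa [compSize_cons], fun h => ?_, fun h => ?_⟩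
      · rcases hc1 (right_ne_zero_of_mul h) with rfl | h
        · exact Or.inl rfl
        · exact Or.inr (wordCode_cons_lt hg0 h)
      · rw [hc2 (List.cons.inj h).2, List.length_cons, pow_succ']
    · obtain ⟨c, hc⟩ := hφ.exists_hasTop_word g (compSize p + n)
      refine ⟨_, by rw [compSize_cons]; exact h1.mul (hφ.exists_hasTop_word g) hc, fun h => ?_,
        fun h => absurd (List.cons.inj h).1 hne⟩
      have h3 := hle (by by_contra h4; exact h (by rw [if_neg h4, zero_mul]))
      have h4 : (n : ℕ) ≠ m := fun h => hne (PNat.coe_injective h)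
      exact Or.inr (wordCode_cons_lt hg0 (wordCode_lt_of_compSize_lt (by omega)))

/-- A word smaller in size than α does not reach the unit vector at |α|; a larger one has a larger
code anyway. -/
theorem IsTriangularRep.apply_word {d : R} {α : List ℕ+}
    {φ : NSym R →ₐ[R] Module.End R (ℕ → R)} (hφ : IsTriangularRep φ d (descentSet α))
    (g : List ℕ+) (h : φ (NSym.word R g) (Pi.single (compSize α) 1) 0 ≠ 0) :
    g = α ∨ wordCode α < wordCode g := by
  rcases lt_trichotomy (compSize g) (compSize α) with h1 | h1 | h1
  · obtain ⟨c, hc⟩ := hφ.exists_hasTop_word g 0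
    refine absurd ?_ h
    rw [hc _ fun k hk => Pi.single_eq_of_ne (by omega) 1, Pi.single_eq_of_ne (by omega), mul_zero]
  · obtain ⟨c, hc, hc1, -⟩ := hφ.hasTop_word g [] α rfl h1
    rw [compSize_nil] at hc
    rw [hc _ fun k hk => Pi.single_eq_of_ne (by omega) 1] at h
    exact hc1 (left_ne_zero_of_mul h)
  · exact Or.inr (wordCode_lt_of_compSize_lt h1)

theorem IsTriangularRep.apply_word_self {d : R} {α : List ℕ+}
    {φ : NSym R →ₐ[R] Module.End R (ℕ → R)} (hφ : IsTriangularRep φ d (descentSet α)) :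
    φ (NSym.word R α) (Pi.single (compSize α) 1) 0 = d ^ α.length := by
  obtain ⟨c, hc, -, hc1⟩ := hφ.hasTop_word α [] α rfl rfl
  rw [compSize_nil] at hc
  rw [hc _ fun k hk => Pi.single_eq_of_ne (by omega) 1, hc1 rfl, zero_add, Pi.single_eq_same,
    mul_one]

end Words

end

/-! ### Triangular families of functionals -/

noncomputable section

section Triangular

variable {R M ι : Type} [CommRing R] [AddCommGroup M] [Module R M]

/-- The map with the given coordinates, when they are finitely supported on every element. -/
def coordMap (ℓ : ι → M →ₗ[R] R) (hfin : ∀ x, (Function.support fun α => ℓ α x).Finite) :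
    M →ₗ[R] ι →₀ R where
  toFun x := Finsupp.ofSupportFinite (fun α => ℓ α x) (hfin x)
  map_add' x y := by
    ext α
    exact map_add (ℓ α) x y
  map_smul' r x := by
    ext α
    exact map_smul (ℓ α) r x

theorem coordMap_apply (ℓ : ι → M →ₗ[R] R)
    (hfin : ∀ x, (Function.support fun α => ℓ α x).Finite) (x : M) (α : ι) :
    coordMap ℓ hfin x α = ℓ α x := rfl

theorem finite_support_of_span_eq_top {κ : Type} (ℓ : ι → M →ₗ[R] R) (w : κ → M)
    (hw : Submodule.span R (Set.range w) = ⊤)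
    (h : ∀ k, (Function.support fun α => ℓ α (w k)).Finite) (x : M) :
    (Function.support fun α => ℓ α x).Finite := by
  have hx : x ∈ Submodule.span R (Set.range w) := hw ▸ Submodule.mem_top
  induction hx using Submodule.span_induction with
  | mem x hx =>
    obtain ⟨k, rfl⟩ := hx
    exact h k
  | zero => simp
  | add x y _ _ hx hy =>
    refine (hx.union hy).subset fun α hα => ?_
    by_contra hα'
    simp only [Set.mem_union, Function.mem_support, not_or, not_not] at hα hα'
    exact hα (by rw [map_add, hα'.1, hα'.2, add_zero])
  | smul r x _ hx =>
    refine hx.subset fun α hα hα' => hα ?_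
    dsimp only at hα' ⊢
    rw [map_smul, hα', smul_zero]

/-- The matrix of the functionals on the family is triangular for the rank, with powers of `u` on
the diagonal. -/
def IsTriangularMatrix (ℓ : ι → M →ₗ[R] R) (w : ι → M) (rk : ι → ℕ) (u : R) : Prop :=
  (∀ α γ, ℓ α (w γ) ≠ 0 → γ = α ∨ rk α < rk γ) ∧ ∀ γ, ∃ n : ℕ, ℓ γ (w γ) = u ^ n

/-- The coordinates of w γ are u^n at γ plus terms of smaller rank, so induction on the rank solves
the system up to a power of u. -/
theorem IsTriangularMatrix.exists_apply_eq {ℓ : ι → M →ₗ[R] R} {w : ι → M} {rk : ι → ℕ} {u : R}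
    (h : IsTriangularMatrix ℓ w rk u) (hfin : ∀ x, (Function.support fun α => ℓ α x).Finite)
    (m : ι →₀ R) : ∃ (k : ℕ) (x : M), coordMap ℓ hfin x = u ^ k • m := by
  let V : Submodule R (ι →₀ R) :=
    { carrier := {m | ∃ (k : ℕ) (x : M), coordMap ℓ hfin x = u ^ k • m}
      zero_mem' := ⟨0, 0, by simp⟩
      add_mem' := by
        rintro m m' ⟨k, x, hx⟩ ⟨k', x', hx'⟩
        refine ⟨k + k', u ^ k' • x + u ^ k • x', ?_⟩
        rw [map_add, map_smul, map_smul, hx, hx', smul_add, smul_smul, smul_smul, ← pow_add,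
          ← pow_add, add_comm k' k]
      smul_mem' := by
        rintro r m ⟨k, x, hx⟩
        exact ⟨k, r • x, by rw [map_smul, hx, smul_comm]⟩ }
  have hpow : ∀ (n : ℕ) (m : ι →₀ R), u ^ n • m ∈ V → m ∈ V := by
    rintro n m ⟨k, x, hx⟩
    exact ⟨k + n, x, by rw [hx, smul_smul, ← pow_add]⟩
  have hsum : ∀ m : ι →₀ R, (∀ α, m α ≠ 0 → Finsupp.single α 1 ∈ V) → m ∈ V := by
    intro m hm
    rw [← Finsupp.sum_single m]
    refine Submodule.sum_mem _ fun α hα => ?_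
    rw [← Finsupp.smul_single_one]
    exact Submodule.smul_mem _ _ (hm α (Finsupp.mem_support_iff.1 hα))
  have hmain : ∀ (r : ℕ) (γ : ι), rk γ = r → Finsupp.single γ (1 : R) ∈ V := by
    intro r
    induction r using Nat.strong_induction_on with
    | _ r ih =>
      rintro γ rfl
      obtain ⟨n, hn⟩ := h.2 γ
      refine hpow n _ ?_
      have h1 : coordMap ℓ hfin (w γ) ∈ V := ⟨0, w γ, by simp⟩
      have h2 : coordMap ℓ hfin (w γ) - u ^ n • Finsupp.single γ 1 ∈ V := by
        refine hsum _ fun α hα => ?_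
        rcases eq_or_ne γ α with rfl | hne
        · refine absurd ?_ hα
          simp [coordMap_apply, hn]
        · rw [Finsupp.sub_apply, Finsupp.smul_apply, Finsupp.single_eq_of_ne hne.symm, smul_zero,
            sub_zero, coordMap_apply] at hα
          exact ih _ ((h.1 α γ hα).resolve_left hne) α rfl
      have := V.sub_mem h1 h2
      rwa [sub_sub_cancel] at this
  exact hsum m fun α _ => hmain _ α rfl

/-- In a combination of the w γ, the coordinate at an index of maximal rank in the support sees only
its own coefficient, multiplied by a power of the non-zero-divisor u. -/
theorem IsTriangularMatrix.coordMap_injective {ℓ : ι → M →ₗ[R] R} {w : ι → M} {rk : ι → ℕ} {u : R}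
    (h : IsTriangularMatrix ℓ w rk u) (hfin : ∀ x, (Function.support fun α => ℓ α x).Finite)
    (hu : ∀ r : R, u * r = 0 → r = 0) (hw : Submodule.span R (Set.range w) = ⊤) :
    Function.Injective (coordMap ℓ hfin) := by
  rw [injective_iff_map_eq_zero]
  intro x hx
  have hx' : x ∈ Submodule.span R (Set.range w) := hw ▸ Submodule.mem_top
  obtain ⟨c, rfl⟩ := (Finsupp.mem_span_range_iff_exists_finsupp).1 hx'
  suffices c = 0 by rw [this, Finsupp.sum_zero_index]
  by_contra hc
  obtain ⟨α, hα, hmax⟩ := Finset.exists_max_image c.support rk (Finsupp.support_nonempty_iff.2 hc)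
  have h1 : ℓ α (c.sum fun i a => a • w i) = 0 := by
    rw [← coordMap_apply ℓ hfin, hx, Finsupp.zero_apply]
  obtain ⟨n, hn⟩ := h.2 α
  rw [Finsupp.sum, map_sum, Finset.sum_eq_single α, map_smul, hn, smul_eq_mul, mul_comm] at h1
  · have h2 : ∀ (n : ℕ) (r : R), u ^ n * r = 0 → r = 0 := by
      intro n
      induction n with
      | zero => exact fun r hr => by simpa using hr
      | succ n ih => exact fun r hr => ih r (hu _ (by rw [← mul_assoc, ← pow_succ', hr]))
    exact Finsupp.mem_support_iff.1 hα (h2 n _ h1)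
  · intro γ hγ hne
    by_contra h3
    rw [map_smul] at h3
    exact ((h.1 α γ (right_ne_zero_of_mul h3)).resolve_left hne).not_ge (hmax γ hγ)
  · exact fun h => absurd hα h

theorem IsTriangularMatrix.coordMap_surjective {ℓ : ι → M →ₗ[R] R} {w : ι → M} {rk : ι → ℕ} {u : R}
    (h : IsTriangularMatrix ℓ w rk u) (hfin : ∀ x, (Function.support fun α => ℓ α x).Finite)
    (hu : IsUnit u) : Function.Surjective (coordMap ℓ hfin) := by
  intro m
  obtain ⟨k, x, hx⟩ := h.exists_apply_eq hfin m
  obtain ⟨v, hv⟩ := (hu.pow k).exists_left_inv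
  exact ⟨v • x, by rw [map_smul, hx, smul_smul, hv, one_smul]⟩

end Triangular

/-! ### Peak words span modulo the cancellation ideal -/

section Spanning

variable {R : Type} [CommRing R]

theorem wordCode_append (x q : List ℕ+) :
    wordCode (x ++ q) = 2 ^ compSize q * wordCode x + wordCode q := by
  induction x with
  | nil => simp [wordCode]
  | cons n x ih =>
    rw [List.cons_append, wordCode, wordCode, ih, ← List.cons_append, compSize_append, pow_add]
    ring

theorem wordCode_append_lt {x y : List ℕ+} (p q : List ℕ+) (h : wordCode x < wordCode y) :
    wordCode (p ++ (x ++ q)) < wordCode (p ++ (y ++ q)) := by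
  have h1 : compSize x ≤ compSize y := by
    by_contra h1
    exact h.not_gt (wordCode_lt_of_compSize_lt (not_le.1 h1))
  have h2 : wordCode (x ++ q) < wordCode (y ++ q) := by
    rw [wordCode_append, wordCode_append]
    have := Nat.mul_lt_mul_of_pos_left h (Nat.two_pow_pos (compSize q))
    omega
  rw [wordCode_append, wordCode_append p]
  have h3 : 2 ^ compSize (x ++ q) ≤ 2 ^ compSize (y ++ q) :=
    Nat.pow_le_pow_right (by norm_num) (by rw [compSize_append, compSize_append]; omega)
  have := Nat.mul_le_mul_right (wordCode p) h3
  omega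

/-- The code determines the size and, after removal of its leading binary digit, the tail.
Injectivity makes the sets of words of bounded code finite. -/
theorem wordCode_injective : Function.Injective wordCode := by
  intro g
  induction g with
  | nil =>
    intro g' h
    by_contra hne
    have h1 := le_wordCode (Ne.symm hne)
    have h2 := Nat.two_pow_pos (compSize g')
    rw [← h] at h1
    simp only [wordCode] at h1
    omega
  | cons n g ih =>
    intro g' h
    have hs : compSize (n :: g) = compSize g' := by
      rcases lt_trichotomy (compSize (n :: g)) (compSize g') with h1 | h1 | h1
      · exact absurd h (wordCode_lt_of_compSize_lt h1).ne
      · exact h1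
      · exact absurd h (wordCode_lt_of_compSize_lt h1).ne'
    rcases g' with _ | ⟨m, g'⟩
    · exact absurd (compSize_eq_zero.1 hs) (by simp)
    · rw [wordCode, wordCode, hs, Nat.add_left_cancel_iff] at h
      obtain rfl := ih h
      rw [compSize_cons, compSize_cons, Nat.add_right_cancel_iff] at hs
      rw [PNat.coe_injective hs]

/-- The word of size `n` with at most one letter. -/
def letterWord : ℕ → List ℕ+
  | 0 => []
  | n + 1 => [n.succPNat]

theorem compSize_letterWord (n : ℕ) : compSize (letterWord n) = n := by
  cases n with
  | zero => rfl
  | succ n => rw [letterWord, compSize_cons, compSize_nil, Nat.succPNat_coe, add_zero]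

theorem word_letterWord (n : ℕ) : NSym.word R (letterWord n) = NSym.h n := by
  cases n with
  | zero => rfl
  | succ n => rw [letterWord, NSym.word_cons, NSym.word_nil, mul_one, Nat.succPNat_coe]

theorem wordCode_letterWord_le (n : ℕ) : wordCode (letterWord n) ≤ 2 ^ n := by
  cases n with
  | zero => simp [letterWord, wordCode]
  | succ n =>
    rw [letterWord, wordCode, wordCode, compSize_cons, compSize_nil, Nat.succPNat_coe]
    simp

/-- Among the products h_i h_k with i + k ≤ n + 1, the largest code is that of h_1 h_n: for full
size the second binary digit is k, and k = n is the largest value with i > 0. -/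
theorem wordCode_letterWord_append_lt {i k : ℕ} {n : ℕ+} (h : i + k ≤ n + 1)
    (hne : ¬ (i = 1 ∧ k = n)) :
    wordCode (letterWord i ++ letterWord k) < wordCode [1, n] := by
  have hs : compSize [1, n] = n + 1 := by
    rw [compSize_cons, compSize_cons, compSize_nil, PNat.one_coe]
    omega
  rcases h.lt_or_eq with h | h
  · refine wordCode_lt_of_compSize_lt ?_
    rw [compSize_append, compSize_letterWord, compSize_letterWord, hs]
    exact h
  · have h1 : wordCode [1, n] = 2 ^ ((n : ℕ) + 1) + 2 ^ (n : ℕ) := by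
      rw [wordCode, hs, wordCode, compSize_cons, compSize_nil]
      rfl
    have h2 := wordCode_letterWord_le i
    have h3 := wordCode_letterWord_le k
    have h4 : 2 ^ k * wordCode (letterWord i) ≤ 2 ^ ((n : ℕ) + 1) := by
      rw [← h, add_comm i k, pow_add]
      exact Nat.mul_le_mul_left _ h2
    rw [wordCode_append, compSize_letterWord, h1]
    rcases Nat.eq_zero_or_pos i with rfl | hi
    · have h5 : wordCode (letterWord 0) = 0 := by simp [letterWord, wordCode]
      have h6 : k = n + 1 := by omega
      have h7 := Nat.two_pow_pos (n : ℕ)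
      rw [h5, mul_zero, zero_add]
      rw [h6] at h3 ⊢
      omega
    · have : 2 ^ k < 2 ^ (n : ℕ) := Nat.pow_lt_pow_right (by norm_num) (by omega)
      omega

/-- A descent at 1, or two consecutive descents, is the same as a letter 1 that is not the last one.
-/
theorem exists_one_cons_of_not_isPeakSet {g : List ℕ+} (h : ¬ IsPeakSet (descentSet g)) :
    ∃ p n q, g = p ++ 1 :: n :: q := by
  have hone : ∀ t : List ℕ+, compSize t = 1 → t = [1] := by
    intro t ht
    cases t with
    | nil => simp [compSize_nil] at ht
    | cons a t =>
      rw [compSize_cons] at ht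
      have := a.pos
      have h1 : t = [] := compSize_eq_zero.1 (by omega)
      have h2 : a = 1 := PNat.coe_injective (by rw [PNat.one_coe]; omega)
      rw [h1, h2]
  have hmain : ∀ p t q, compSize t = 1 → q ≠ [] → g = p ++ (t ++ q) →
      ∃ p n q, g = p ++ 1 :: n :: q := by
    intro p t q ht hq hg
    obtain ⟨n, q, rfl⟩ := List.exists_cons_of_ne_nil hq
    exact ⟨p, n, q, by rw [hg, hone t ht]; rfl⟩
  rw [IsPeakSet, not_and_or, not_not] at h
  rcases h with h | h
  · obtain ⟨p, q, -, hq, h1, h2⟩ := mem_descentSet.1 h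
    exact hmain [] p q h2.symm hq h1
  · push Not at h
    obtain ⟨i, hi, hi'⟩ := h
    obtain ⟨p, q, -, hq, h1, h2⟩ := mem_descentSet.1 hi
    obtain ⟨p', q', -, hq', h1', h2'⟩ := mem_descentSet.1 hi'
    rcases List.append_eq_append_iff.1 (h1.symm.trans h1') with ⟨t, rfl, -⟩ | ⟨t, rfl, -⟩
    · rw [compSize_append] at h2'
      exact hmain p t q' (by omega) hq' (by rw [h1', List.append_assoc])
    · rw [compSize_append] at h2
      omega

theorem NSym.span_range_word : Submodule.span R (Set.range (NSym.word R)) = ⊤ := by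
  rw [eq_top_iff, ← (FreeAlgebra.basisFreeMonoid R ℕ+).span_eq, Submodule.span_le]
  rintro _ ⟨w, rfl⟩
  exact Submodule.subset_span ⟨w.toList, (NSym.basis_apply w).symm⟩

-- Straightening by strong induction on the code. A word that is not a peak word contains 1, n in
-- adjacent places, and the coefficient of t^(n+1) in H(t)H(⊖t) expresses h_1 h_n through products
-- of smaller code.
open PowerSeries in
theorem NSym.word_mem_cancelIdeal_sup (b : R) (g : List ℕ+) :
    NSym.word R g ∈ (cancelIdeal b).restrictScalars R ⊔
      Submodule.span R (Set.range fun α : PeakComposition => NSym.word R α.1) := by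
  set V := (cancelIdeal b).restrictScalars R ⊔
      Submodule.span R (Set.range fun α : PeakComposition => NSym.word R α.1) with hV
  induction hr : wordCode g using Nat.strong_induction_on generalizing g with
  | _ r ih =>
    by_cases hg : IsPeakSet (descentSet g)
    · exact Submodule.mem_sup_right (Submodule.subset_span ⟨⟨g, hg⟩, rfl⟩)
    obtain ⟨p, n, q, rfl⟩ := exists_one_cons_of_not_isPeakSet hg
    have hJ : NSym.word R p * coeff ((n : ℕ) + 1) (cancelSeries b) * NSym.word R q ∈ V := by
      refine Submodule.mem_sup_left (Ideal.mul_mem_right _ _ (Ideal.mul_mem_left _ _ ?_))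
      rw [← Ideal.Quotient.eq_zero_iff_mem, ← coeff_map, map_mk_cancelSeries, coeff_one,
        if_neg (by omega)]
    have hterm : ∀ i k : ℕ, i + k ≤ n + 1 → ¬ (i = 1 ∧ k = n) →
        NSym.word R p * (NSym.h i * NSym.h k) * NSym.word R q ∈ V := by
      intro i k hik hne
      have h1 := wordCode_append_lt p q (wordCode_letterWord_append_lt hik hne)
      have h2 := ih _ (by rw [← hr]; exact h1) (p ++ ((letterWord i ++ letterWord k) ++ q)) rfl
      rwa [word_append, word_append, word_append, word_letterWord, word_letterWord,
        ← mul_assoc] at h2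
    have hexp : NSym.word R p * coeff ((n : ℕ) + 1) (cancelSeries b) * NSym.word R q =
        ∑ x ∈ Finset.HasAntidiagonal.antidiagonal ((n : ℕ) + 1), ∑ k ∈ Finset.range (x.2 + 1),
          coeff x.2 (ominus b ^ k) •
            (NSym.word R p * (NSym.h x.1 * NSym.h k) * NSym.word R q) := by
      rw [cancelSeries, coeff_mul, Finset.mul_sum, Finset.sum_mul]
      refine Finset.sum_congr rfl fun x _ => ?_
      rw [coeff_substOminus, Finset.mul_sum, Finset.mul_sum, Finset.sum_mul]
      refine Finset.sum_congr rfl fun k _ => ?_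
      rw [mul_smul_comm, mul_smul_comm, smul_mul_assoc]
      simp [hSeries]
    have hmem : ((1, (n : ℕ)) : ℕ × ℕ) ∈ Finset.HasAntidiagonal.antidiagonal ((n : ℕ) + 1) := by
      rw [Finset.HasAntidiagonal.mem_antidiagonal]
      exact add_comm _ _
    -- The term h_1 h_n is isolated; its coefficient is that of tⁿ in (⊖t)ⁿ, the unit (-1)ⁿ.
    rw [hexp, ← Finset.add_sum_erase _ _ hmem, Finset.sum_range_succ, coeff_ominus_pow_self] at hJ
    have h1 : ∑ k ∈ Finset.range (n : ℕ), coeff (n : ℕ) (ominus b ^ k) •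
        (NSym.word R p * (NSym.h 1 * NSym.h k) * NSym.word R q) ∈ V := by
      refine Submodule.sum_mem _ fun k hk => Submodule.smul_mem _ _ (hterm _ _ ?_ ?_)
      all_goals
        rw [Finset.mem_range] at hk
        omega
    have h2 : ∑ x ∈ (Finset.HasAntidiagonal.antidiagonal ((n : ℕ) + 1)).erase (1, (n : ℕ)),
        ∑ k ∈ Finset.range (x.2 + 1), coeff x.2 (ominus b ^ k) •
          (NSym.word R p * (NSym.h x.1 * NSym.h k) * NSym.word R q) ∈ V := by
      refine Submodule.sum_mem _ fun x hx => Submodule.sum_mem _ fun k hk =>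
        Submodule.smul_mem _ _ (hterm _ _ ?_ ?_)
      all_goals
        rw [Finset.mem_erase, Finset.HasAntidiagonal.mem_antidiagonal] at hx
        rw [Finset.mem_range] at hk
      · omega
      · rintro ⟨h3, h4⟩
        exact hx.1 (Prod.ext h3 (by dsimp only; omega))
    have h3 := V.sub_mem (V.sub_mem hJ h2) h1
    rw [add_sub_cancel_right, add_sub_cancel_left] at h3
    have h4 := V.smul_mem ((-1) ^ (n : ℕ)) h3
    rw [smul_smul, ← mul_pow, neg_one_mul, neg_neg, one_pow, one_smul] at h4
    rw [word_append, word_cons, word_cons, PNat.one_coe]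
    simpa only [mul_assoc] using h4

end Spanning

end

/-! ### LC-Hopf subalgebras obtained from bialgebra morphisms -/

noncomputable section

namespace LCHopfAlgebra

variable {R B A' : Type} [CommRing R] [Ring B] [Algebra R B] [Ring A'] [HopfAlgebra R A']

section Pullback

variable (H : LCHopfAlgebra R B) (φ : H.A →ₐc[R] A')

/-- The elements whose form factors through `φ`. -/
def pullback : Subalgebra R B where
  carrier := {f | ∃ l : Module.Dual R A', ∀ x, H.form x f = l (φ x)}
  add_mem' := by
    rintro f g ⟨l, hl⟩ ⟨l', hl'⟩
    exact ⟨l + l', fun x => by rw [map_add, hl, hl', LinearMap.add_apply]⟩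
  mul_mem' := by
    rintro f g ⟨l, hl⟩ ⟨l', hl'⟩
    refine ⟨TensorProduct.dualDistrib R A' A' (l ⊗ₜ l') ∘ₗ Coalgebra.comul, fun x => ?_⟩
    have h1 : H.form.flip f = l ∘ₗ (φ : H.A →ₗ[R] A') := LinearMap.ext hl
    have h2 : H.form.flip g = l' ∘ₗ (φ : H.A →ₗ[R] A') := LinearMap.ext hl'
    have h3 : TensorProduct.dualDistrib R H.A H.A
        ((l ∘ₗ (φ : H.A →ₗ[R] A')) ⊗ₜ[R] (l' ∘ₗ (φ : H.A →ₗ[R] A'))) =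
        TensorProduct.dualDistrib R A' A' (l ⊗ₜ l') ∘ₗ
          TensorProduct.map (φ : H.A →ₗ[R] A') (φ : H.A →ₗ[R] A') := by
      ext x y
      simp
    rw [H.form_mul, h1, h2, h3, LinearMap.comp_apply, LinearMap.comp_apply]
    congr 1
    exact CoalgHomClass.map_comp_comul_apply φ x
  algebraMap_mem' := by
    intro r
    refine ⟨r • Coalgebra.counit, fun x => ?_⟩
    rw [Algebra.algebraMap_eq_smul_one, map_smul, H.form_one, LinearMap.smul_apply,
      CoalgHomClass.counit_comp_apply φ x]

theorem exists_form_eq (l : Module.Dual R H.A) : ∃ f, ∀ x, H.form x f = l x := by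
  obtain ⟨f, hf⟩ := H.nondegenerate.2 l
  exact ⟨f, fun x => LinearMap.congr_fun hf x⟩

theorem eq_of_form_eq {f g : B} (h : ∀ x, H.form x f = H.form x g) : f = g :=
  H.nondegenerate.1 (LinearMap.ext h)

/-- The functional through which a form factors is unique by `hφ`, hence depends linearly on the
element. Surjectivity of φ is not required: for Θ with values in its saturation, only the condition
on functionals is available. -/
theorem bijective_of_pullback (hφ : ∀ l : Module.Dual R A', (∀ x, l (φ x) = 0) → l = 0) : ∃ E : H.pullback φ ≃ₗ[R] Module.Dual R A',
    ∀ f x, E f (φ x) = H.form x f.1 := by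
  let ψ : H.pullback φ →ₗ[R] Module.Dual R A' :=
    { toFun := fun f => f.2.choose
      map_add' := fun f g => by
        rw [← sub_eq_zero]
        refine hφ _ fun x => ?_
        rw [LinearMap.sub_apply, LinearMap.add_apply, ← (f + g).2.choose_spec, ← f.2.choose_spec,
          ← g.2.choose_spec, ← map_add, ← map_sub]
        simp
      map_smul' := fun r f => by
        rw [← sub_eq_zero]
        refine hφ _ fun x => ?_
        rw [LinearMap.sub_apply, RingHom.id_apply, LinearMap.smul_apply, ← (r • f).2.choose_spec,
          ← f.2.choose_spec, ← map_smul, ← map_sub]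
        simp }
  have hψ : ∀ f x, ψ f (φ x) = H.form x f.1 := fun f x => (f.2.choose_spec x).symm
  refine ⟨LinearEquiv.ofBijective ψ ⟨fun f g h => ?_, fun l => ?_⟩, hψ⟩
  · exact Subtype.ext (H.eq_of_form_eq fun x => by rw [← hψ, ← hψ, h])
  · obtain ⟨f, hf⟩ := H.exists_form_eq (l ∘ₗ (φ : H.A →ₗ[R] A'))
    refine ⟨⟨f, l, hf⟩, sub_eq_zero.1 (hφ _ fun x => ?_)⟩
    rw [LinearMap.sub_apply, hψ, hf, sub_eq_zero]
    rfl

end Pullback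

/-- The coefficients of an infinite combination are the values of a functional on the basis; the
sums are finite because coordinates in a basis are finitely supported. -/
theorem pseudospan_eq_pullback (H : LCHopfAlgebra R B) (φ : H.A →ₐc[R] A') {I : Type}
    (a : Module.Basis I R A') (b : I → B) (hb : ∀ x i, H.form x (b i) = a.repr (φ x) i) :
    H.pseudospan b = H.pullback φ := by
  have key : ∀ (c : I → R) (x : H.A), {i | c i * H.form x (b i) ≠ 0}.Finite ∧
      ∑ᶠ i, c i * H.form x (b i) = a.constr R c (φ x) := by
    intro c x
    have h1 : {i | c i * H.form x (b i) ≠ 0} ⊆ ((a.repr (φ x)).support : Set I) := by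
      intro i hi
      rw [Finset.mem_coe, Finsupp.mem_support_iff, ← hb]
      exact right_ne_zero_of_mul hi
    refine ⟨(Finset.finite_toSet _).subset h1, ?_⟩
    rw [finsum_eq_sum_of_support_subset _ h1, Module.Basis.constr_apply, Finsupp.sum]
    exact Finset.sum_congr rfl fun i _ => by rw [hb, smul_eq_mul, mul_comm]
  ext f
  constructor
  · rintro ⟨c, hc⟩
    exact ⟨a.constr R c, fun x => by rw [(hc x).2, (key c x).2]⟩
  · rintro ⟨l, hl⟩
    refine ⟨fun i => l (a i), fun x => ⟨(key _ x).1, ?_⟩⟩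
    rw [(key _ x).2, hl]
    congr 1
    exact a.ext fun i => by rw [Module.Basis.constr_basis]

/-- The target of φ serves as predual and φ is the adjoint of the inclusion. Identities of
functionals on it are tested on the image of φ, where they become identities in `H`. -/
theorem isLCHopfSubalgebra_pseudospan (H : LCHopfAlgebra R B) (φ : H.A →ₐc[R] A')
    (hφ : ∀ l : Module.Dual R A', (∀ x, l (φ x) = 0) → l = 0) {I : Type}
    (a : Module.Basis I R A') (b : I → B) (hb : ∀ x i, H.form x (b i) = a.repr (φ x) i) :
    H.IsLCHopfSubalgebra (H.pseudospan b) b := by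
  obtain ⟨E, hE⟩ := H.bijective_of_pullback φ hφ
  have hmul : ∀ l l' : Module.Dual R A',
      (TensorProduct.dualDistrib R A' A' (l ⊗ₜ l')) ∘ₗ
        TensorProduct.map (φ : H.A →ₗ[R] A') (φ : H.A →ₗ[R] A') =
      TensorProduct.dualDistrib R H.A H.A
        ((l ∘ₗ (φ : H.A →ₗ[R] A')) ⊗ₜ[R] (l' ∘ₗ (φ : H.A →ₗ[R] A'))) := by
    intro l l'
    ext x y
    simp
  have hE' : ∀ f, E f ∘ₗ (φ : H.A →ₗ[R] A') = H.form.flip f.1 := fun f => LinearMap.ext (hE f)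
  have : Module.Free R A' := .of_basis a
  let K : LCHopfAlgebra R (H.pullback φ) :=
    { A := A'
      form := (E : H.pullback φ →ₗ[R] Module.Dual R A').flip
      nondegenerate := E.bijective
      form_mul := by
        intro y f g
        have h1 : E (f * g) = (TensorProduct.dualDistrib R A' A' (E f ⊗ₜ E g)) ∘ₗ
            Coalgebra.comul := by
          refine sub_eq_zero.1 (hφ _ fun x => ?_)
          rw [LinearMap.sub_apply, sub_eq_zero, hE, LinearMap.comp_apply,
            ← CoalgHomClass.map_comp_comul_apply φ x]
          refine (H.form_mul x f.1 g.1).trans ?_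
          rw [← hE', ← hE', ← hmul]
          rfl
        exact LinearMap.congr_fun h1 y
      form_one := by
        intro y
        have h1 : E 1 = Coalgebra.counit := by
          refine sub_eq_zero.1 (hφ _ fun x => ?_)
          rw [LinearMap.sub_apply, sub_eq_zero, hE, CoalgHomClass.counit_comp_apply φ x]
          exact H.form_one x
        exact LinearMap.congr_fun h1 y }
  have hb' : ∀ i x, H.form x (b i) = a.coord i (φ x) := fun i x => hb x i
  refine ⟨H.pullback φ, (H.pseudospan_eq_pullback φ a b hb).symm, K, ⟨(φ : H.A →ₗ[R] A'), ?_, ?_, ?_⟩,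
    fun i => ⟨b i, a.coord i, hb' i⟩, fun i => rfl, a, fun i j => ?_⟩
  · exact fun x f => hE f x
  · intro f
    refine TensorProduct.ext' fun x y => ?_
    refine (hE f (x * y)).symm.trans ?_
    rw [map_mul]
    rfl
  · intro f
    refine (hE f 1).symm.trans ?_
    rw [map_one]
    rfl
  · have h1 : E ⟨b j, a.coord j, hb' j⟩ = a.coord j := by
      refine sub_eq_zero.1 (hφ _ fun x => ?_)
      rw [LinearMap.sub_apply, hE, hb' j, sub_self]
    refine (LinearMap.congr_fun h1 (a i)).trans ?_
    rw [Module.Basis.coord_apply, Module.Basis.repr_self]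

end LCHopfAlgebra

end

/-! ### The quotient by the cancellation ideal as predual -/

noncomputable section

section Quotient

variable {R : Type} [CommRing R]

/-- The first entry of the image under the representation attached to the descent set of `α` of the
sequence supported at the size of `α`. -/
def wordFunctional (F : Set ℕ → NSym R →ₐ[R] Module.End R (ℕ → R)) (α : List ℕ+) :
    NSym R →ₗ[R] R :=
  LinearMap.proj 0 ∘ₗ LinearMap.applyₗ (Pi.single (compSize α) 1) ∘ₗ (F (descentSet α)).toLinearMap

theorem wordFunctional_apply (F : Set ℕ → NSym R →ₐ[R] Module.End R (ℕ → R)) (α : List ℕ+)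
    (x : NSym R) :
    wordFunctional F α x = F (descentSet α) x (Pi.single (compSize α) 1) 0 := rfl

theorem finite_wordCode_le (n : ℕ) : {α | wordCode α ≤ n}.Finite :=
  (Set.finite_Iic n).preimage wordCode_injective.injOn

theorem finite_support_of_triangular {ι : Type} {e : ι → List ℕ+} (he : Function.Injective e)
    {ℓ : ι → NSym R →ₗ[R] R}
    (hℓ : ∀ α g, ℓ α (NSym.word R g) ≠ 0 → g = e α ∨ wordCode (e α) < wordCode g) (x : NSym R) :
    (Function.support fun α => ℓ α x).Finite := by
  refine finite_support_of_span_eq_top ℓ _ NSym.span_range_word (fun g => ?_) x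
  refine ((finite_wordCode_le (wordCode g)).preimage he.injOn).subset fun α hα => ?_
  rcases hℓ α g hα with h | h
  · exact (congrArg wordCode h).ge
  · exact h.le

/-- The functionals descend to the quotient, which peak words span, and their matrix on these words
is triangular with unit diagonal. The coordinate map is therefore bijective, without any independent
proof that the quotient is free. -/
theorem exists_basis_quotient_cancelIdeal (b : R) {u : R} (hu : IsUnit u)
    {ℓ : PeakComposition → NSym R →ₗ[R] R} (hJ : ∀ α, ∀ x ∈ NSym.cancelIdeal b, ℓ α x = 0)
    (hℓ : ∀ α g, ℓ α (NSym.word R g) ≠ 0 → g = α.1 ∨ wordCode α.1 < wordCode g)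
    (hd : ∀ α, ∃ n : ℕ, ℓ α (NSym.word R α.1) = u ^ n) :
    ∃ a : Module.Basis PeakComposition R (NSym R ⧸ NSym.cancelIdeal b),
      ∀ x α, a.repr (Ideal.Quotient.mk (NSym.cancelIdeal b) x) α = ℓ α x := by
  set J := NSym.cancelIdeal b with hJdef
  let π : NSym R →ₗ[R] NSym R ⧸ J := (Ideal.Quotient.mkₐ R J).toLinearMap
  have hπ : Function.Surjective π := Ideal.Quotient.mk_surjective
  let ℓ' : PeakComposition → (NSym R ⧸ J) →ₗ[R] R := fun α =>
    (J.restrictScalars R).liftQ (ℓ α) (hJ α) ∘ₗ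
      (Submodule.Quotient.restrictScalarsEquiv R J).symm.toLinearMap
  have hℓ' : ∀ α x, ℓ' α (π x) = ℓ α x := fun α x => rfl
  have hfin : ∀ x, (Function.support fun α => ℓ' α x).Finite := by
    intro x
    obtain ⟨x, rfl⟩ := hπ x
    exact finite_support_of_triangular Subtype.val_injective hℓ x
  have hspan : Submodule.span R (Set.range fun α : PeakComposition => π (NSym.word R α.1)) = ⊤ := by
    have h1 : (J.restrictScalars R ⊔
        Submodule.span R (Set.range fun α : PeakComposition => NSym.word R α.1)) = ⊤ := by
      rw [eq_top_iff, ← NSym.span_range_word, Submodule.span_le]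
      rintro _ ⟨g, rfl⟩
      exact NSym.word_mem_cancelIdeal_sup b g
    have h2 := congrArg (Submodule.map π) h1
    rw [Submodule.map_sup, Submodule.map_top, LinearMap.range_eq_top.2 hπ, Submodule.map_span,
      ← Set.range_comp, (LinearMap.le_ker_iff_map (f := π)).1 ?_, bot_sup_eq] at h2
    · exact h2
    · exact fun x hx => Ideal.Quotient.eq_zero_iff_mem.2 hx
  have htri : IsTriangularMatrix ℓ' (fun α : PeakComposition => π (NSym.word R α.1))
      (fun α => wordCode α.1) u := by
    refine ⟨fun α γ h => ?_, fun γ => hd γ⟩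
    exact (hℓ α γ.1 h).imp_left Subtype.ext
  have hu' : ∀ r : R, u * r = 0 → r = 0 := fun r hr => (hu.mul_right_eq_zero).1 hr
  exact ⟨.ofRepr (LinearEquiv.ofBijective _
    ⟨htri.coordMap_injective hfin hu' hspan, htri.coordMap_surjective hfin hu⟩), fun x α => rfl⟩

theorem nsymForm_multipeakBar_word (b : R) (α : PeakComposition) (g : List ℕ+)
    (h : nsymForm (NSym.word R g) (multipeakBar b α) ≠ 0) :
    g = α.1 ∨ wordCode α.1 < wordCode g := by
  rw [nsymForm_multipeakBar] at h
  exact (isTriangularRep_peakBarRep b _).apply_word g h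

theorem nsymForm_multipeak_word (b : R) (α : PeakComposition) (g : List ℕ+)
    (h : nsymForm (NSym.word R g) (multipeak b α) ≠ 0) :
    g = α.1 ∨ wordCode α.1 < wordCode g := by
  rw [nsymForm_multipeak] at h
  exact (isTriangularRep_peakRep b α.2).apply_word g h

theorem exists_basis_multipeakBar (b : R) :
    ∃ a : Module.Basis PeakComposition R (NSym R ⧸ NSym.cancelIdeal b),
      ∀ x α, a.repr (Ideal.Quotient.mk (NSym.cancelIdeal b) x) α =
        nsymForm x (multipeakBar b α) := by
  refine exists_basis_quotient_cancelIdeal b (u := 1) isUnit_one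
    (ℓ := fun α => nsymForm.flip (multipeakBar b α)) (fun α x hx => ?_)
    (nsymForm_multipeakBar_word b) (fun α => ⟨α.1.length, ?_⟩)
  · rw [LinearMap.flip_apply, nsymForm_multipeakBar,
      NSym.peakBarRep_eq_zero b (zero_notMem_descentSet _) α.2 hx]
    rfl
  · rw [LinearMap.flip_apply, nsymForm_multipeakBar]
    exact (isTriangularRep_peakBarRep b _).apply_word_self

theorem nsymForm_multipeak_eq_zero (b : R) (α : PeakComposition) {x : NSym R}
    (hx : x ∈ NSym.cancelIdeal b) : nsymForm x (multipeak b α) = 0 := by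
  rw [nsymForm_multipeak, NSym.peakRep_eq_zero b (zero_notMem_descentSet _) hx]
  rfl

theorem exists_basis_multipeak (b : R) (h2 : IsUnit (2 : R)) :
    ∃ a : Module.Basis PeakComposition R (NSym R ⧸ NSym.cancelIdeal b),
      ∀ x α, a.repr (Ideal.Quotient.mk (NSym.cancelIdeal b) x) α =
        nsymForm x (multipeak b α) := by
  refine exists_basis_quotient_cancelIdeal b (u := 2) h2
    (ℓ := fun α => nsymForm.flip (multipeak b α)) (fun α x hx => nsymForm_multipeak_eq_zero b α hx)
    (nsymForm_multipeak_word b) (fun α => ⟨α.1.length, ?_⟩)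
  rw [LinearMap.flip_apply, nsymForm_multipeak]
  exact (isTriangularRep_peakRep b α.2).apply_word_self

/-- The projection to the quotient by the cancellation ideal. -/
def cancelMk (b : R) : (mQSymHopf R).A →ₐc[R] NSym R ⧸ NSym.cancelIdeal b :=
  (Bialgebra.Quotient.mkBialgHom (NSym.cancelIdeal b) : NSym R →ₐc[R] _)

theorem mem_pullback_cancelMk (b : R) (f : mQSym R) :
    f ∈ (mQSymHopf R).pullback (cancelMk b) ↔ ∀ x ∈ NSym.cancelIdeal b, nsymForm x f = 0 := by
  constructor
  · rintro ⟨l, hl⟩ x hx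
    refine (hl x).trans ?_
    rw [show cancelMk b x = 0 from Ideal.Quotient.eq_zero_iff_mem.2 hx, map_zero]
  · intro h
    exact ⟨((NSym.cancelIdeal b).restrictScalars R).liftQ (nsymForm.flip f) h ∘ₗ
      (Submodule.Quotient.restrictScalarsEquiv R (NSym.cancelIdeal b)).symm.toLinearMap,
      fun x => rfl⟩

theorem mem_pseudospan_multipeakBar (b : R) (f : mQSym R) :
    f ∈ (mQSymHopf R).pseudospan (multipeakBar b) ↔
      ∀ x ∈ NSym.cancelIdeal b, nsymForm x f = 0 := by
  obtain ⟨a, ha⟩ := exists_basis_multipeakBar b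
  rw [(mQSymHopf R).pseudospan_eq_pullback (cancelMk b) a _ fun x i => (ha x i).symm,
    SetLike.mem_coe, mem_pullback_cancelMk]

theorem mem_pseudospan_multipeak (b : R) (h2 : IsUnit (2 : R)) (f : mQSym R) :
    f ∈ (mQSymHopf R).pseudospan (multipeak b) ↔
      ∀ x ∈ NSym.cancelIdeal b, nsymForm x f = 0 := by
  obtain ⟨a, ha⟩ := exists_basis_multipeak b h2
  rw [(mQSymHopf R).pseudospan_eq_pullback (cancelMk b) a _ fun x i => (ha x i).symm,
    SetLike.mem_coe, mem_pullback_cancelMk]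

theorem pseudospan_multipeak_subset (b : R) :
    (mQSymHopf R).pseudospan (multipeak b) ⊆ (mQSymHopf R).pseudospan (multipeakBar b) := by
  rintro f ⟨c, hc⟩
  rw [mem_pseudospan_multipeakBar]
  intro x hx
  refine (hc x).2.trans ?_
  have : ∀ i, c i * (mQSymHopf R).form x (multipeak b i) = 0 := fun i =>
    mul_eq_zero_of_right _ (nsymForm_multipeak_eq_zero b i hx)
  simp only [this, finsum_zero]

theorem isLCHopfSubalgebra_multipeakBar (b : R) :
    (mQSymHopf R).IsLCHopfSubalgebra ((mQSymHopf R).pseudospan (multipeakBar b))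
      (multipeakBar b) := by
  obtain ⟨a, ha⟩ := exists_basis_multipeakBar b
  refine (mQSymHopf R).isLCHopfSubalgebra_pseudospan (cancelMk b) (fun l hl => ?_) a _
    fun x i => (ha x i).symm
  refine LinearMap.ext fun y => ?_
  obtain ⟨x, rfl⟩ := Ideal.Quotient.mk_surjective y
  exact hl x

end Quotient

end

/-! ### Base change and the intersection formula -/

noncomputable section

open PowerSeries

section BaseChange

variable {R R' : Type} [CommRing R] [CommRing R'] (j : R →+* R')

namespace NSym

/-- The change of the base ring. -/
def baseMap : NSym R →+* NSym R' :=
  letI := j.toAlgebra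
  (FreeAlgebra.lift R (FreeAlgebra.ι R') : NSym R →ₐ[R] NSym R').toRingHom

theorem baseMap_h (n : ℕ) : baseMap j (h n) = h n := by
  let := j.toAlgebra
  rcases Nat.eq_zero_or_pos n with rfl | hn
  · rw [h_zero, h_zero, map_one]
  · lift n to ℕ+ using hn
    rw [h_pnat, h_pnat]
    exact FreeAlgebra.lift_ι_apply (R := R) (FreeAlgebra.ι R') n

theorem baseMap_smul (r : R) (x : NSym R) : baseMap j (r • x) = j r • baseMap j x := by
  let := j.toAlgebra
  refine (map_smul (FreeAlgebra.lift R (FreeAlgebra.ι R') : NSym R →ₐ[R] NSym R') r x).trans ?_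
  exact algebra_compatible_smul R' r _

theorem baseMap_word (g : List ℕ+) : baseMap j (word R g) = word R' g := by
  rw [word, word, map_list_prod, List.map_map]
  congr 1
  exact List.map_congr_left fun n _ => baseMap_h j n

theorem map_ominus (b : R) : PowerSeries.map j (ominus b) = ominus (j b) := by
  rw [ominus, ominus, map_neg, map_mul, PowerSeries.map_X]
  congr 2
  ext n
  simp

theorem map_baseMap_cancelSeries (b : R) :
    PowerSeries.map (baseMap j) (cancelSeries b) = cancelSeries (j b) := by
  have h1 : PowerSeries.map (baseMap j) (hSeries (R := R)) = hSeries := by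
    ext n
    rw [coeff_map, hSeries, hSeries, coeff_mk, coeff_mk, baseMap_h]
  rw [cancelSeries, map_mul, h1, cancelSeries]
  congr 1
  ext n
  rw [coeff_map, coeff_substOminus, coeff_substOminus, map_sum]
  refine Finset.sum_congr rfl fun k _ => ?_
  rw [baseMap_smul, ← map_ominus j, ← map_pow (PowerSeries.map j), coeff_map j,
    ← coeff_map (baseMap j), h1]

theorem baseMap_mem_cancelIdeal (b : R) {x : NSym R} (hx : x ∈ cancelIdeal b) :
    baseMap j x ∈ cancelIdeal (j b) := by
  rw [← Ideal.Quotient.eq_zero_iff_mem]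
  refine cancelIdeal_le_ker b ((Ideal.Quotient.mk (cancelIdeal (j b))).comp (baseMap j)) ?_ hx
  rw [← map_mk_cancelSeries, ← map_baseMap_cancelSeries]
  rfl

end NSym

/-- Extension of scalars for quasisymmetric power series. -/
def mQSym.baseMap (f : mQSym R) : mQSym R' :=
  ⟨MvPowerSeries.map j f.1, fun k a i hi => by
    rw [MvPowerSeries.coeff_map, MvPowerSeries.coeff_map, f.2 k a i hi]⟩

theorem nsymForm_baseMap (x : NSym R) (f : mQSym R) :
    nsymForm (NSym.baseMap j x) (mQSym.baseMap j f) = j (nsymForm x f) := by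
  have hx : x ∈ Submodule.span R (Set.range (NSym.word R)) :=
    NSym.span_range_word (R := R) ▸ Submodule.mem_top
  induction hx using Submodule.span_induction with
  | mem x hx =>
    obtain ⟨g, rfl⟩ := hx
    rw [NSym.baseMap_word, NSym.word, NSym.word, NSym.nsymForm_prod, NSym.nsymForm_prod]
    exact MvPowerSeries.coeff_map _ _ _
  | zero => simp
  | add x y _ _ hx hy => simp only [map_add, LinearMap.add_apply, hx, hy]
  | smul r x _ hx => simp [NSym.baseMap_smul, hx]

theorem span_range_baseMap_word :
    Submodule.span R' (Set.range fun g => NSym.baseMap j (NSym.word R g)) = ⊤ := by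
  simp only [NSym.baseMap_word]
  exact NSym.span_range_word

/-- The ideal over R' is spanned over R' by the products word · generator · word, and each of these
comes from R. The converse uses the injectivity of j. -/
theorem forall_cancelIdeal_baseMap (hj : Function.Injective j) (b : R) (f : mQSym R) :
    (∀ x ∈ NSym.cancelIdeal (j b), nsymForm x (mQSym.baseMap j f) = 0) ↔
      ∀ x ∈ NSym.cancelIdeal b, nsymForm x f = 0 := by
  constructor
  · intro h x hx
    refine hj ?_
    rw [map_zero, ← nsymForm_baseMap]
    exact h _ (NSym.baseMap_mem_cancelIdeal j b hx)
  · intro h x hx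
    -- Quantifying over the factors p and q turns the kernel of the functional into a two-sided
    -- ideal, so that only generators need be tested.
    let K : TwoSidedIdeal (NSym R') :=
      TwoSidedIdeal.mk' {x | ∀ p q, nsymForm (p * x * q) (mQSym.baseMap j f) = 0}
        (by simp)
        (fun {x y} hx hy p q => by
          rw [mul_add, add_mul, map_add, LinearMap.add_apply, hx, hy, add_zero])
        (fun {x} hx p q => by rw [mul_neg, neg_mul, map_neg, LinearMap.neg_apply, hx, neg_zero])
        (fun {y x} hx p q => by rw [← mul_assoc p]; exact hx _ _)
        (fun {x y} hx p q => by rw [← mul_assoc p, mul_assoc _ y]; exact hx _ _)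
    have h1 : NSym.cancelTwoSided (j b) ≤ K := by
      rw [NSym.cancelTwoSided, TwoSidedIdeal.span_le]
      rintro _ ⟨n, rfl⟩
      refine (TwoSidedIdeal.mem_mk' _ _ _ _ _ _ _).2 fun p q => ?_
      have hp : p ∈ Submodule.span R' (Set.range fun g => NSym.baseMap j (NSym.word R g)) :=
        span_range_baseMap_word j ▸ Submodule.mem_top
      have hq : q ∈ Submodule.span R' (Set.range fun g => NSym.baseMap j (NSym.word R g)) :=
        span_range_baseMap_word j ▸ Submodule.mem_top
      induction hp using Submodule.span_induction with
      | mem p hp =>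
        obtain ⟨g, rfl⟩ := hp
        induction hq using Submodule.span_induction with
        | mem q hq =>
          obtain ⟨g', rfl⟩ := hq
          have h2 : coeff n (NSym.cancelSeries (j b)) - coeff n 1 =
              NSym.baseMap j (coeff n (NSym.cancelSeries b) - coeff n 1) := by
            rw [map_sub, ← coeff_map, ← coeff_map, NSym.map_baseMap_cancelSeries,
              map_one (PowerSeries.map (NSym.baseMap j))]
          dsimp only
          rw [h2, ← map_mul, ← map_mul, nsymForm_baseMap, h, map_zero]
          exact Ideal.mul_mem_right _ _ (Ideal.mul_mem_left _ _
            (TwoSidedIdeal.mem_asIdeal.2 (TwoSidedIdeal.subset_span ⟨n, rfl⟩)))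
        | zero => simp
        | add x y _ _ hx hy => rw [mul_add, map_add, LinearMap.add_apply, hx, hy, add_zero]
        | smul r x _ hx => rw [mul_smul_comm, map_smul, LinearMap.smul_apply, hx, smul_zero]
      | zero => simp
      | add x y _ _ hx hy => rw [add_mul, add_mul, map_add, LinearMap.add_apply, hx, hy, add_zero]
      | smul r x _ hx =>
        rw [smul_mul_assoc, smul_mul_assoc, map_smul, LinearMap.smul_apply, hx, smul_zero]
    have h2 : x ∈ K := h1 (TwoSidedIdeal.mem_asIdeal.1 hx)
    have h3 := (TwoSidedIdeal.mem_mk' _ _ _ _ _ _ _).1 h2 1 1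
    rwa [one_mul, mul_one] at h3

theorem image_extendScalars_mPiBarSym :
    Set.image extendScalars mPiBarSym = Set.range extendScalars ∩ mPeakRat := by
  have hj : Function.Injective (Polynomial.mapRingHom (Int.castRingHom ℚ)) :=
    Polynomial.map_injective _ Int.cast_injective
  have hX : Polynomial.mapRingHom (Int.castRingHom ℚ) Polynomial.X = Polynomial.X :=
    Polynomial.map_X _
  -- Inverting 2 makes the diagonal entries for K units; only here is ℚ needed.
  have h2 : IsUnit (2 : Polynomial ℚ) := by
    have : IsUnit (Polynomial.C (2 : ℚ)) := Polynomial.isUnit_C.2 (by norm_num)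
    rwa [map_ofNat] at this
  have key : ∀ f, extendScalars f ∈ mPeakRat ↔ f ∈ mPiBarSym := by
    intro f
    rw [mPeakRat, mPiBarSym, mem_pseudospan_multipeak _ h2, mem_pseudospan_multipeakBar, ← hX]
    exact forall_cancelIdeal_baseMap _ hj _ f
  ext f
  constructor
  · rintro ⟨f, hf, rfl⟩
    exact ⟨⟨f, rfl⟩, (key f).2 hf⟩
  · rintro ⟨⟨f, rfl⟩, hf⟩
    exact ⟨f, (key f).1 hf, rfl⟩

end BaseChange

end

/-! ### Hopf subalgebras that are linear retracts -/

noncomputable section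

section HopfRetract

variable {R H : Type} [CommRing R] [Ring H] [HopfAlgebra R H] {S : Subalgebra R H}

/-- A linear retraction onto a subalgebra that is compatible with the coproduct and the
antipode of a Hopf algebra. -/
structure HopfRetraction (S : Subalgebra R H) where
  retract : H →ₗ[R] S
  retract_val : ∀ a : S, retract a = a
  comul_mem : ∀ a : S, TensorProduct.map (S.val.toLinearMap ∘ₗ retract)
    (S.val.toLinearMap ∘ₗ retract) (Coalgebra.comul (R := R) (a : H)) = Coalgebra.comul (a : H)
  antipode_mem : ∀ a : S, HopfAlgebra.antipode R (a : H) ∈ S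

namespace HopfRetraction

variable (ρ : HopfRetraction S)

theorem retract_comp_val : ρ.retract ∘ₗ S.val.toLinearMap = LinearMap.id :=
  LinearMap.ext ρ.retract_val

theorem map_map_injective {M N M' N' : Type} [AddCommGroup M] [Module R M] [AddCommGroup N]
    [Module R N] [AddCommGroup M'] [Module R M'] [AddCommGroup N'] [Module R N'] {f : M →ₗ[R] M'}
    {f' : M' →ₗ[R] M} {g : N →ₗ[R] N'} {g' : N' →ₗ[R] N} (hf : f' ∘ₗ f = LinearMap.id)
    (hg : g' ∘ₗ g = LinearMap.id) : Function.Injective (TensorProduct.map f g) := by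
  refine Function.LeftInverse.injective (g := TensorProduct.map f' g') fun x => ?_
  rw [← LinearMap.comp_apply, ← TensorProduct.map_comp, hf, hg, TensorProduct.map_id,
    LinearMap.id_apply]

/-- Over a general ring the tensor square of an inclusion need not be injective; the retraction
splits it. The axioms for the subalgebra can then be checked in the ambient Hopf algebra. -/
theorem val_tensor_injective (ρ : HopfRetraction S) :
    Function.Injective (Algebra.TensorProduct.map S.val S.val) :=
  map_map_injective ρ.retract_comp_val ρ.retract_comp_val

theorem val_tensor_val_tensor_injective (ρ : HopfRetraction S) : Function.Injective
    (Algebra.TensorProduct.map S.val (Algebra.TensorProduct.map S.val S.val)) := by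
  refine map_map_injective (f := S.val.toLinearMap) ρ.retract_comp_val
    (g := (Algebra.TensorProduct.map S.val S.val).toLinearMap)
    (g' := TensorProduct.map ρ.retract ρ.retract) ?_
  refine TensorProduct.ext' fun x y => ?_
  simp [ρ.retract_val]

/-- The coproduct of the subalgebra, as a linear map. -/
def comulLin : S →ₗ[R] S ⊗[R] S :=
  TensorProduct.map ρ.retract ρ.retract ∘ₗ Coalgebra.comul ∘ₗ S.val.toLinearMap

theorem val_tensor_comulLin (a : S) :
    Algebra.TensorProduct.map S.val S.val (ρ.comulLin a) = Coalgebra.comul (R := R) (a : H) := by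
  refine Eq.trans ?_ (ρ.comul_mem a)
  rw [TensorProduct.map_comp]
  rfl

/-- The coproduct of the subalgebra. -/
def comulHom : S →ₐ[R] S ⊗[R] S :=
  AlgHom.ofLinearMap ρ.comulLin
    (ρ.val_tensor_injective (by
      rw [val_tensor_comulLin, OneMemClass.coe_one, Bialgebra.comul_one, map_one]))
    (fun x y => ρ.val_tensor_injective (by
      rw [val_tensor_comulLin, map_mul, val_tensor_comulLin, val_tensor_comulLin,
        MulMemClass.coe_mul, Bialgebra.comul_mul]))

theorem val_tensor_comp_comulHom : (Algebra.TensorProduct.map S.val S.val).comp ρ.comulHom =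
    (Bialgebra.comulAlgHom R H).comp S.val := by
  refine AlgHom.ext fun a => ?_
  exact ρ.val_tensor_comulLin a

/-- The counit of the subalgebra. -/
def counitHom (S : Subalgebra R H) : S →ₐ[R] R := (Bialgebra.counitAlgHom R H).comp S.val

theorem comulHom_coassoc : (Algebra.TensorProduct.assoc R R R S S S).toAlgHom.comp
      ((Algebra.TensorProduct.map ρ.comulHom (.id R S)).comp ρ.comulHom) =
    (Algebra.TensorProduct.map (.id R S) ρ.comulHom).comp ρ.comulHom := by
  have hv := ρ.val_tensor_comp_comulHom
  refine AlgHom.ext fun a => ρ.val_tensor_val_tensor_injective ?_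
  have h1 : (Algebra.TensorProduct.map S.val (Algebra.TensorProduct.map S.val S.val)).comp
      ((Algebra.TensorProduct.assoc R R R S S S).toAlgHom.comp
        (Algebra.TensorProduct.map ρ.comulHom (.id R S))) =
      (Algebra.TensorProduct.assoc R R R H H H).toAlgHom.comp
        ((Algebra.TensorProduct.map (Bialgebra.comulAlgHom R H) (.id R H)).comp
          (Algebra.TensorProduct.map S.val S.val)) := by
    have h2 : (Algebra.TensorProduct.map (Bialgebra.comulAlgHom R H) (.id R H)).comp
          (Algebra.TensorProduct.map S.val S.val) =
        (Algebra.TensorProduct.map (Algebra.TensorProduct.map S.val S.val) S.val).comp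
          (Algebra.TensorProduct.map ρ.comulHom (.id R S)) := by
      rw [← Algebra.TensorProduct.map_comp, ← Algebra.TensorProduct.map_comp, hv]
      rfl
    rw [h2, ← AlgHom.comp_assoc, ← AlgHom.comp_assoc]
    congr 1
    ext <;> simp [Algebra.TensorProduct.one_def]
  have h3 : (Algebra.TensorProduct.map S.val (Algebra.TensorProduct.map S.val S.val)).comp
      (Algebra.TensorProduct.map (.id R S) ρ.comulHom) =
      (Algebra.TensorProduct.map (.id R H) (Bialgebra.comulAlgHom R H)).comp
          (Algebra.TensorProduct.map S.val S.val) := by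
    rw [← Algebra.TensorProduct.map_comp, ← Algebra.TensorProduct.map_comp, hv]
    rfl
  refine (AlgHom.congr_fun h1 (ρ.comulHom a)).trans ?_
  refine Eq.trans ?_ (AlgHom.congr_fun h3 (ρ.comulHom a)).symm
  have h4 := AlgHom.congr_fun hv a
  simp only [AlgHom.comp_apply] at h4 ⊢
  rw [h4]
  exact Coalgebra.coassoc_apply (a : H)

theorem comulHom_rTensor :
    (Algebra.TensorProduct.map (counitHom S) (.id R S)).comp ρ.comulHom =
      (Algebra.TensorProduct.lid R S).symm := by
  have hv := ρ.val_tensor_comp_comulHom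
  have hinj : Function.Injective (Algebra.TensorProduct.map (.id R R) S.val) :=
    map_map_injective (f := LinearMap.id) (f' := LinearMap.id) rfl ρ.retract_comp_val
  refine AlgHom.ext fun a => hinj ?_
  have h1 : (Algebra.TensorProduct.map (.id R R) S.val).comp
      (Algebra.TensorProduct.map (counitHom S) (.id R S)) =
      (Algebra.TensorProduct.map (Bialgebra.counitAlgHom R H) (.id R H)).comp
        (Algebra.TensorProduct.map S.val S.val) := by
    rw [← Algebra.TensorProduct.map_comp, ← Algebra.TensorProduct.map_comp]
    rfl
  refine (AlgHom.congr_fun h1 (ρ.comulHom a)).trans ?_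
  have h4 := AlgHom.congr_fun hv a
  simp only [AlgHom.comp_apply] at h4 ⊢
  rw [h4]
  exact Coalgebra.rTensor_counit_comul (a : H)

theorem comulHom_lTensor :
    (Algebra.TensorProduct.map (.id R S) (counitHom S)).comp ρ.comulHom =
      (Algebra.TensorProduct.rid R R S).symm := by
  have hv := ρ.val_tensor_comp_comulHom
  have hinj : Function.Injective (Algebra.TensorProduct.map S.val (.id R R)) :=
    map_map_injective (g := LinearMap.id) (g' := LinearMap.id) ρ.retract_comp_val rfl
  refine AlgHom.ext fun a => hinj ?_
  have h1 : (Algebra.TensorProduct.map S.val (.id R R)).comp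
      (Algebra.TensorProduct.map (.id R S) (counitHom S)) =
      (Algebra.TensorProduct.map (.id R H) (Bialgebra.counitAlgHom R H)).comp
        (Algebra.TensorProduct.map S.val S.val) := by
    rw [← Algebra.TensorProduct.map_comp, ← Algebra.TensorProduct.map_comp]
    rfl
  refine (AlgHom.congr_fun h1 (ρ.comulHom a)).trans ?_
  have h4 := AlgHom.congr_fun hv a
  simp only [AlgHom.comp_apply] at h4 ⊢
  rw [h4]
  exact Coalgebra.lTensor_counit_comul (a : H)

/-- The bialgebra structure on the subalgebra. -/
@[reducible] def bialgebra : Bialgebra R S :=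
  Bialgebra.ofAlgHom ρ.comulHom (counitHom S) ρ.comulHom_coassoc ρ.comulHom_rTensor
    ρ.comulHom_lTensor

/-- The antipode of the subalgebra. -/
def antipodeLin : S →ₗ[R] S :=
  LinearMap.codRestrict S.toSubmodule (HopfAlgebra.antipode R ∘ₗ S.val.toLinearMap) ρ.antipode_mem

/-- The Hopf algebra structure on the subalgebra. -/
@[reducible] def hopfAlgebra : HopfAlgebra R S :=
  { ρ.bialgebra with
    antipode := ρ.antipodeLin
    mul_antipode_rTensor_comul := by
      refine LinearMap.ext fun a => Subtype.val_injective ?_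
      have h1 : S.val.toLinearMap ∘ₗ LinearMap.mul' R S ∘ₗ ρ.antipodeLin.rTensor S =
          LinearMap.mul' R H ∘ₗ (HopfAlgebra.antipode R).rTensor H ∘ₗ
            (Algebra.TensorProduct.map S.val S.val).toLinearMap :=
        TensorProduct.ext' fun x y => rfl
      refine (LinearMap.congr_fun h1 (ρ.comulHom a)).trans ?_
      simp only [LinearMap.comp_apply]
      rw [AlgHom.toLinearMap_apply, show Algebra.TensorProduct.map S.val S.val (ρ.comulHom a) =
        Coalgebra.comul (R := R) (a : H) from ρ.val_tensor_comulLin a]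
      exact HopfAlgebra.mul_antipode_rTensor_comul_apply (a : H)
    mul_antipode_lTensor_comul := by
      refine LinearMap.ext fun a => Subtype.val_injective ?_
      have h1 : S.val.toLinearMap ∘ₗ LinearMap.mul' R S ∘ₗ ρ.antipodeLin.lTensor S =
          LinearMap.mul' R H ∘ₗ (HopfAlgebra.antipode R).lTensor H ∘ₗ
            (Algebra.TensorProduct.map S.val S.val).toLinearMap :=
        TensorProduct.ext' fun x y => rfl
      refine (LinearMap.congr_fun h1 (ρ.comulHom a)).trans ?_
      simp only [LinearMap.comp_apply]
      rw [AlgHom.toLinearMap_apply, show Algebra.TensorProduct.map S.val S.val (ρ.comulHom a) =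
        Coalgebra.comul (R := R) (a : H) from ρ.val_tensor_comulLin a]
      exact HopfAlgebra.mul_antipode_lTensor_comul_apply (a : H) }

/-- A bialgebra morphism with values in the subalgebra is a bialgebra morphism to the subalgebra. -/
def codRestrict {H' : Type} [Ring H'] [Bialgebra R H'] (f : H' →ₐc[R] H) (hf : ∀ x, f x ∈ S) :
    letI := ρ.hopfAlgebra
    H' →ₐc[R] S :=
  letI := ρ.hopfAlgebra
  BialgHom.ofAlgHom ((f : H' →ₐ[R] H).codRestrict S hf)
    (AlgHom.ext fun x => CoalgHomClass.counit_comp_apply f x)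
    (AlgHom.ext fun x => ρ.val_tensor_injective (by
      have h1 : (Algebra.TensorProduct.map S.val S.val).comp
          (Algebra.TensorProduct.map ((f : H' →ₐ[R] H).codRestrict S hf)
            ((f : H' →ₐ[R] H).codRestrict S hf)) =
          Algebra.TensorProduct.map (f : H' →ₐ[R] H) (f : H' →ₐ[R] H) := by
        rw [← Algebra.TensorProduct.map_comp]
        rfl
      refine (AlgHom.congr_fun h1 (Coalgebra.comul x)).trans ?_
      refine Eq.trans ?_ (ρ.val_tensor_comulLin _).symm
      exact CoalgHomClass.map_comp_comul_apply f x))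

end HopfRetraction

end HopfRetract

end

/-! ### The peak composition of a composition -/

noncomputable section

section PeakWord

theorem descentSet_singleton (a : ℕ+) : descentSet [a] = ∅ := by
  refine Set.eq_empty_of_forall_notMem ?_
  rintro s ⟨k, hk, hk', -⟩
  rw [List.length_singleton] at hk'
  omega

theorem descentSet_nil : descentSet [] = ∅ := by
  refine Set.eq_empty_of_forall_notMem ?_
  rintro s ⟨k, hk, hk', -⟩
  simp at hk'

theorem mem_descentSet_cons {a : ℕ+} {r : List ℕ+} (hr : r ≠ []) {s : ℕ} :
    s ∈ descentSet (a :: r) ↔ s = a ∨ ∃ j ∈ descentSet r, s = a + j := by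
  simp only [mem_descentSet]
  constructor
  · rintro ⟨p, q, hp, hq, h, rfl⟩
    rcases p with _ | ⟨x, p⟩
    · exact absurd rfl hp
    rw [List.cons_append, List.cons.injEq] at h
    obtain ⟨rfl, h⟩ := h
    rw [compSize_cons]
    rcases eq_or_ne p [] with rfl | hp
    · exact Or.inl (by rw [compSize_nil, add_zero])
    · exact Or.inr ⟨_, ⟨p, q, hp, hq, h, rfl⟩, rfl⟩
  · rintro (rfl | ⟨j, ⟨p, q, hp, hq, rfl, rfl⟩, rfl⟩)
    · exact ⟨[a], r, by simp, hr, rfl, by rw [compSize_cons, compSize_nil, add_zero]⟩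
    · exact ⟨a :: p, q, by simp, hq, rfl, by rw [compSize_cons]⟩

/-- Increases the first letter of a word by one. -/
def incHead : List ℕ+ → List ℕ+
  | [] => []
  | a :: r => (a + 1) :: r

theorem compSize_incHead {w : List ℕ+} (hw : w ≠ []) : compSize (incHead w) = 1 + compSize w := by
  rcases w with _ | ⟨a, w⟩
  · exact absurd rfl hw
  · rw [incHead, compSize_cons, compSize_cons, PNat.add_coe, PNat.one_coe]
    omega

theorem incHead_ne_nil {w : List ℕ+} (hw : w ≠ []) : incHead w ≠ [] := by
  rcases w with _ | ⟨a, w⟩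
  · exact absurd rfl hw
  · simp [incHead]

theorem mem_descentSet_incHead {w : List ℕ+} {s : ℕ} :
    s ∈ descentSet (incHead w) ↔ ∃ j ∈ descentSet w, s = 1 + j := by
  rcases w with _ | ⟨a, w⟩
  · simp [incHead, descentSet_nil]
  rcases eq_or_ne w [] with rfl | hw
  · simp [incHead, descentSet_singleton]
  · rw [incHead, mem_descentSet_cons hw, PNat.add_coe, PNat.one_coe]
    simp only [mem_descentSet_cons hw]
    constructor
    · rintro (rfl | ⟨j, hj, rfl⟩)
      · exact ⟨a, Or.inl rfl, by omega⟩
      · exact ⟨a + j, Or.inr ⟨j, hj, rfl⟩, by omega⟩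
    · rintro ⟨_, rfl | ⟨j, hj, rfl⟩, rfl⟩
      · exact Or.inl (by omega)
      · exact Or.inr ⟨j, hj, by omega⟩

/-- The composition whose descent set is the set of peaks of the descent set. -/
def peakWord : List ℕ+ → List ℕ+
  | [] => []
  | a :: r => if r = [] then [a] else if a = 1 then incHead (peakWord r) else a :: peakWord r

theorem peakWord_ne_nil {w : List ℕ+} (hw : w ≠ []) : peakWord w ≠ [] := by
  induction w with
  | nil => exact absurd rfl hw
  | cons a r ih =>
    rw [peakWord]
    split_ifs with h1 h2
    · simp
    · exact incHead_ne_nil (ih h1)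
    · simp

theorem compSize_peakWord (w : List ℕ+) : compSize (peakWord w) = compSize w := by
  induction w with
  | nil => rfl
  | cons a r ih =>
    rw [peakWord]
    split_ifs with h1 h2
    · rw [h1]
    · rw [compSize_incHead (peakWord_ne_nil h1), ih, compSize_cons, h2, PNat.one_coe]
    · rw [compSize_cons, compSize_cons, ih]

/-- A leading letter 1 gives a descent at 1, which is no peak and prevents 2 from being one, so the
peaks are those of the tail shifted by 1. A leading letter a > 1 gives a peak at a and prevents one
at a + 1. -/
theorem descentSet_peakWord (w : List ℕ+) : descentSet (peakWord w) = peaks (descentSet w) := by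
  induction w with
  | nil =>
    rw [peakWord, descentSet_nil]
    exact (Set.eq_empty_of_forall_notMem fun i hi => hi.2.1).symm
  | cons a r ih =>
    rw [peakWord]
    split_ifs with h1 h2
    · rw [h1, descentSet_singleton]
      exact (Set.eq_empty_of_forall_notMem fun i hi => hi.2.1).symm
    · ext s
      have h0 := zero_notMem_descentSet r
      rw [mem_descentSet_incHead, ih, h2]
      simp only [peaks, Set.mem_ofPred_eq, mem_descentSet_cons h1, PNat.one_coe]
      constructor
      · rintro ⟨j, ⟨hj, hj1, hj2⟩, rfl⟩
        refine ⟨by omega, Or.inr ⟨j, hj1, rfl⟩, ?_⟩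
        rintro (h | ⟨i, hi, h⟩)
        · omega
        · exact hj2 (by rwa [show j - 1 = i by omega])
      · rintro ⟨hs, rfl | ⟨j, hj, rfl⟩, h⟩
        · omega
        · have hj0 : j ≠ 0 := by rintro rfl; exact h0 hj
          have hj1 : j ≠ 1 := by rintro rfl; exact h (Or.inl rfl)
          exact ⟨j, ⟨by omega, hj, fun h' => h (Or.inr ⟨j - 1, h', by omega⟩)⟩, rfl⟩
    · ext s
      have h0 := zero_notMem_descentSet r
      have ha : (a : ℕ) ≠ 1 := fun h => h2 (PNat.coe_injective h)
      have ha' := a.pos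
      rw [mem_descentSet_cons (peakWord_ne_nil h1), ih]
      simp only [peaks, Set.mem_ofPred_eq, mem_descentSet_cons h1]
      constructor
      · rintro (rfl | ⟨j, ⟨hj, hj1, hj2⟩, rfl⟩)
        · refine ⟨by omega, Or.inl rfl, ?_⟩
          rintro (h | ⟨i, hi, h⟩) <;> omega
        · refine ⟨by omega, Or.inr ⟨j, hj1, rfl⟩, ?_⟩
          rintro (h | ⟨i, hi, h⟩)
          · omega
          · exact hj2 (by rwa [show j - 1 = i by omega])
      · rintro ⟨hs, rfl | ⟨j, hj, rfl⟩, h⟩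
        · exact Or.inl rfl
        · have hj0 : j ≠ 0 := by rintro rfl; exact h0 hj
          have hj1 : j ≠ 1 := by rintro rfl; exact h (Or.inl (by omega))
          exact Or.inr ⟨j, ⟨by omega, hj, fun h' => h (Or.inr ⟨j - 1, h', by omega⟩)⟩, rfl⟩

theorem isPeakSet_peaks (I : Set ℕ) : IsPeakSet (peaks I) :=
  ⟨fun h => absurd h.1 (by omega), fun _ hi hi' => hi'.2.2 hi.2.1⟩

theorem peakWord_eq_self {w : List ℕ+} (hw : IsPeakSet (descentSet w)) : peakWord w = w := by
  induction w with
  | nil => rfl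
  | cons a r ih =>
    rw [peakWord]
    split_ifs with h1 h2
    · rw [h1]
    · exact absurd ((mem_descentSet_cons h1).2 (Or.inl (by rw [h2, PNat.one_coe]))) hw.1
    · rw [ih ⟨fun h => ?_, fun i hi hi' => ?_⟩]
      · exact hw.2 a ((mem_descentSet_cons h1).2 (Or.inl rfl))
          ((mem_descentSet_cons h1).2 (Or.inr ⟨1, h, rfl⟩))
      · exact hw.2 (a + i) ((mem_descentSet_cons h1).2 (Or.inr ⟨i, hi, rfl⟩))
          ((mem_descentSet_cons h1).2 (Or.inr ⟨i + 1, hi', rfl⟩))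

/-- The peak composition attached to a composition. -/
def peakComp (w : List ℕ+) : PeakComposition :=
  ⟨peakWord w, by rw [descentSet_peakWord]; exact isPeakSet_peaks _⟩

theorem peakComp_val (α : PeakComposition) : peakComp α.1 = α := Subtype.ext (peakWord_eq_self α.2)

theorem finite_compSize_eq (n : ℕ) : {w | compSize w = n}.Finite := by
  refine (finite_wordCode_le (2 ^ (n + 1))).subset fun w hw => ?_
  have := wordCode_lt w
  rw [← show compSize w = n from hw]
  exact this.le

theorem finite_peakComp_eq (α : PeakComposition) : {w | peakComp w = α}.Finite := by
  refine (finite_compSize_eq (compSize α.1)).subset fun w hw => ?_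
  rw [Set.mem_ofPred_eq, ← show peakComp w = α from hw]
  exact (compSize_peakWord w).symm

end PeakWord

end

/-! ### The saturation of the image of an endomorphism -/

noncomputable section

section Saturation

variable {R H : Type} [CommRing R] [Ring H] [HopfAlgebra R H]

/-- The elements that have a multiple by a power of `u` in the image of `Θ`. -/
def saturation (Θ : H →ₐc[R] H) (u : R) : Subalgebra R H where
  carrier := {a | ∃ (k : ℕ) (x : H), u ^ k • a = Θ x}
  add_mem' := by
    rintro a b ⟨k, x, hx⟩ ⟨l, y, hy⟩
    exact ⟨k + l, u ^ l • x + u ^ k • y, by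
      rw [map_add, map_smul, map_smul, ← hx, ← hy, smul_add, smul_smul, smul_smul, ← pow_add,
        ← pow_add, add_comm l k]⟩
  mul_mem' := by
    rintro a b ⟨k, x, hx⟩ ⟨l, y, hy⟩
    exact ⟨k + l, x * y, by rw [map_mul, ← hx, ← hy, smul_mul_smul_comm, pow_add]⟩
  algebraMap_mem' := fun r => ⟨0, algebraMap R H r, by
    rw [pow_zero, one_smul]
    exact (AlgHomClass.commutes Θ r).symm⟩

theorem apply_mem_saturation (Θ : H →ₐc[R] H) (u : R) (x : H) : Θ x ∈ saturation Θ u :=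
  ⟨0, x, by rw [pow_zero, one_smul]⟩

theorem eq_of_pow_smul_eq {M : Type} [AddCommGroup M] [Module R M] {u : R}
    (hu : ∀ z : M, u • z = 0 → z = 0) {k : ℕ} {y z : M} (h : u ^ k • y = u ^ k • z) : y = z := by
  induction k with
  | zero => simpa using h
  | succ k ih =>
    refine ih (sub_eq_zero.1 (hu _ ?_))
    rw [smul_sub, smul_smul, smul_smul, ← pow_succ', h, sub_self]

/-- A linear retraction onto the saturation of the image of a bialgebra morphism is compatible with
the Hopf algebra structure. -/
def saturationRetraction (Θ : H →ₐc[R] H) {u : R} (hu : ∀ z : H ⊗[R] H, u • z = 0 → z = 0)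
    (f : H →ₗ[R] saturation Θ u) (hf : ∀ a : saturation Θ u, f a = a) :
    HopfRetraction (saturation Θ u) where
  retract := f
  retract_val := hf
  comul_mem := by
    rintro ⟨a, k, x, hx⟩
    -- After multiplication by u^k the element is Θ x, whose coproduct is the image of that of x
    -- under Θ ⊗ Θ and so is fixed by the retraction; `hu` removes the factor.
    refine eq_of_pow_smul_eq hu (k := k) ?_
    have h1 : (saturation Θ u).val.toLinearMap ∘ₗ f ∘ₗ (Θ : H →ₗ[R] H) = (Θ : H →ₗ[R] H) :=
      LinearMap.ext fun x => congrArg Subtype.val (hf ⟨Θ x, apply_mem_saturation Θ u x⟩)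
    rw [← map_smul, ← map_smul, hx, ← CoalgHomClass.map_comp_comul_apply Θ x]
    change (TensorProduct.map ((saturation Θ u).val.toLinearMap ∘ₗ f)
      ((saturation Θ u).val.toLinearMap ∘ₗ f) ∘ₗ
        TensorProduct.map (Θ : H →ₗ[R] H) (Θ : H →ₗ[R] H)) _ = _
    rw [← TensorProduct.map_comp, LinearMap.comp_assoc, h1]
  antipode_mem := by
    rintro ⟨a, k, x, hx⟩
    refine ⟨k, HopfAlgebra.antipode R x, ?_⟩
    rw [← map_smul, hx]
    exact LinearMap.congr_fun (antipode_comp_bialgHom Θ) x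

end Saturation

/-! ### The predual of the multipeak functions over the integers -/

section PeakSubalgebra

variable {R : Type} [CommRing R]

/-- The coordinates of an element Θ x depend only on the peaks of the composition, and they are its
pairings with the multipeak functions. -/
theorem wordFunctional_rep_theta (b : R) (w : List ℕ+) (x : NSym R) :
    wordFunctional (NSym.rep b) w (NSym.theta b x) =
      nsymForm x (multipeak b (peakComp w)) := by
  have h0 := zero_notMem_descentSet w
  rw [nsymForm_multipeak, wordFunctional_apply, NSym.theta_apply, NSym.rep_thetaAlg b h0,
    ← NSym.peakRep_peaks b h0, ← descentSet_peakWord, ← compSize_peakWord]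
  rfl

theorem wordFunctional_rep_word (b : R) (w g : List ℕ+)
    (h : wordFunctional (NSym.rep b) w (NSym.word R g) ≠ 0) :
    g = w ∨ wordCode w < wordCode g :=
  (isTriangularRep_rep b (descentSet w)).apply_word g h

theorem finite_support_wordFunctional_rep (b : R) (x : NSym R) :
    (Function.support fun w => wordFunctional (NSym.rep b) w x).Finite :=
  finite_support_of_triangular Function.injective_id (wordFunctional_rep_word b) x

/-- The coordinates with respect to all compositions. -/
def wordEquiv (b : R) : NSym R ≃ₗ[R] List ℕ+ →₀ R :=
  have h : IsTriangularMatrix (wordFunctional (NSym.rep b)) (NSym.word R) wordCode (1 : R) :=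
    ⟨wordFunctional_rep_word b, fun w => ⟨w.length, by
      rw [wordFunctional_apply]
      exact (isTriangularRep_rep b (descentSet w)).apply_word_self⟩⟩
  LinearEquiv.ofBijective (coordMap _ (finite_support_wordFunctional_rep b))
    ⟨h.coordMap_injective _ (fun r hr => by rwa [one_mul] at hr) NSym.span_range_word,
      h.coordMap_surjective _ isUnit_one⟩

theorem wordEquiv_apply (b : R) (x : NSym R) (w : List ℕ+) :
    wordEquiv b x w = wordFunctional (NSym.rep b) w x := rfl

variable (R) in
/-- The pullback of functions on peak compositions to functions on compositions. -/
def pullPeak : (PeakComposition →₀ R) →ₗ[R] List ℕ+ →₀ R :=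
  coordMap (fun w => Finsupp.lapply (peakComp w)) fun m => by
    refine ((m.support.finite_toSet).biUnion fun α _ => finite_peakComp_eq α).subset fun w hw => ?_
    exact Set.mem_biUnion (Finset.mem_coe.2 (Finsupp.mem_support_iff.2 hw)) rfl

theorem pullPeak_apply (m : PeakComposition →₀ R) (w : List ℕ+) :
    pullPeak R m w = m (peakComp w) := rfl

/-- The coordinates with respect to peak compositions. -/
def peakCoord (b : R) : NSym R →ₗ[R] PeakComposition →₀ R :=
  coordMap (fun α => wordFunctional (NSym.rep b) α.1) fun x =>
    (finite_support_wordFunctional_rep b x).preimage Subtype.val_injective.injOn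

theorem peakCoord_apply (b : R) (x : NSym R) (α : PeakComposition) :
    peakCoord b x α = wordFunctional (NSym.rep b) α.1 x := rfl

theorem wordEquiv_symm_pullPeak (b : R) (m : PeakComposition →₀ R) (w : List ℕ+) :
    wordFunctional (NSym.rep b) w ((wordEquiv b).symm (pullPeak R m)) = m (peakComp w) := by
  rw [← wordEquiv_apply, LinearEquiv.apply_symm_apply, pullPeak_apply]

theorem peakCoord_symm_pullPeak (b : R) (m : PeakComposition →₀ R) :
    peakCoord b ((wordEquiv b).symm (pullPeak R m)) = m := by
  ext α
  rw [peakCoord_apply, wordEquiv_symm_pullPeak, peakComp_val]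

theorem eq_of_wordFunctional_eq (b : R) {x y : NSym R}
    (h : ∀ w, wordFunctional (NSym.rep b) w x = wordFunctional (NSym.rep b) w y) : x = y :=
  (wordEquiv b).injective (Finsupp.ext h)

/-- Conversely, coordinates that depend only on the peaks come from the saturation: the matrix of K
on peak words has powers of 2 on its diagonal, so some 2^k m is the family of pairings of an x with
the K_α. -/
theorem symm_pullPeak_mem (b : R) (m : PeakComposition →₀ R) :
    (wordEquiv b).symm (pullPeak R m) ∈ saturation (NSym.theta b) 2 := by
  have h : IsTriangularMatrix (fun α : PeakComposition => nsymForm.flip (multipeak b α))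
      (fun α => NSym.word R α.1) (fun α => wordCode α.1) (2 : R) := by
    refine ⟨fun α γ h => (nsymForm_multipeak_word b α γ.1 h).imp_left Subtype.ext,
      fun α => ⟨α.1.length, ?_⟩⟩
    rw [LinearMap.flip_apply, nsymForm_multipeak]
    exact (isTriangularRep_peakRep b α.2).apply_word_self
  have hfin := finite_support_of_triangular Subtype.val_injective
    (ℓ := fun α : PeakComposition => nsymForm.flip (multipeak b α)) (nsymForm_multipeak_word b)
  obtain ⟨k, x, hx⟩ := h.exists_apply_eq hfin m
  refine ⟨k, x, eq_of_wordFunctional_eq b fun w => ?_⟩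
  rw [wordFunctional_rep_theta, map_smul, wordEquiv_symm_pullPeak]
  exact (DFunLike.congr_fun hx (peakComp w)).symm

/-- For 2^k a = Θ x the coordinates are constant on the fibres of `peakComp`, and 2^k cancels in a
domain. -/
theorem symm_pullPeak_peakCoord [IsDomain R] (b : R) (h2 : (2 : R) ≠ 0) {a : NSym R}
    (ha : a ∈ saturation (NSym.theta b) 2) :
    (wordEquiv b).symm (pullPeak R (peakCoord b a)) = a := by
  obtain ⟨k, x, hx⟩ := ha
  refine eq_of_wordFunctional_eq b fun w => ?_
  rw [wordEquiv_symm_pullPeak, peakCoord_apply]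
  refine mul_left_cancel₀ (pow_ne_zero k h2) ?_
  rw [← smul_eq_mul, ← smul_eq_mul, ← map_smul, ← map_smul, hx, wordFunctional_rep_theta,
    wordFunctional_rep_theta, peakComp_val]

/-- The retraction of the noncommutative symmetric functions onto the saturation. -/
def peakRetract (b : R) : NSym R →ₗ[R] saturation (NSym.theta b) 2 :=
  LinearMap.codRestrict (saturation (NSym.theta b) 2).toSubmodule
    ((wordEquiv b).symm.toLinearMap ∘ₗ pullPeak R ∘ₗ peakCoord b) fun x =>
      symm_pullPeak_mem b (peakCoord b x)

theorem peakRetract_val [IsDomain R] (b : R) (h2 : (2 : R) ≠ 0) (a : saturation (NSym.theta b) 2) :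
    peakRetract b a = a := Subtype.ext (symm_pullPeak_peakCoord b h2 a.2)

/-- The basis of the saturation indexed by peak compositions. -/
def peakBasis [IsDomain R] (b : R) (h2 : (2 : R) ≠ 0) :
    Module.Basis PeakComposition R (saturation (NSym.theta b) 2) :=
  .ofRepr
    { peakCoord b ∘ₗ (saturation (NSym.theta b) 2).val.toLinearMap with
      invFun := fun m => ⟨(wordEquiv b).symm (pullPeak R m), symm_pullPeak_mem b m⟩
      left_inv := fun a => Subtype.ext (symm_pullPeak_peakCoord b h2 a.2)
      right_inv := fun m => peakCoord_symm_pullPeak b m }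

theorem isLCHopfSubalgebra_multipeak [IsDomain R] (b : R) (h2 : (2 : R) ≠ 0) :
    (mQSymHopf R).IsLCHopfSubalgebra ((mQSymHopf R).pseudospan (multipeak b)) (multipeak b) := by
  have hu : ∀ z : NSym R ⊗[R] NSym R, (2 : R) • z = 0 → z = 0 := fun z hz =>
    (smul_eq_zero.1 hz).resolve_left h2
  let ρ := saturationRetraction (NSym.theta b) hu (peakRetract b) (peakRetract_val b h2)
  let := ρ.hopfAlgebra
  let φ : NSym R →ₐc[R] saturation (NSym.theta b) 2 :=
    ρ.codRestrict (NSym.theta b) (apply_mem_saturation _ _)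
  have hφ : ∀ x, (φ x : NSym R) = NSym.theta b x := fun x => rfl
  refine (mQSymHopf R).isLCHopfSubalgebra_pseudospan φ (fun l hl => ?_) (peakBasis b h2) _
    fun x α => ?_
  · refine LinearMap.ext ?_
    rintro ⟨a, k, x, hx⟩
    -- A functional that vanishes on the image of Θ vanishes on the saturation, because 2^k can be
    -- cancelled in R.
    have h1 : (2 : R) ^ k • (⟨a, k, x, hx⟩ : saturation (NSym.theta b) 2) = φ x := Subtype.ext hx
    have h3 : l ((2 : R) ^ k • ⟨a, k, x, hx⟩) = 0 := h1 ▸ hl x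
    rw [map_smul, smul_eq_mul] at h3
    exact (mul_eq_zero.1 h3).resolve_left (pow_ne_zero k h2)
  · refine Eq.trans ?_ (wordFunctional_rep_theta b α.1 x).symm
    rw [peakComp_val]
    rfl

end PeakSubalgebra

end

theorem mainTheorem3 :
    (mQSymHopf (Polynomial ℤ)).IsLCHopfSubalgebra mPeak (multipeak Polynomial.X) ∧
    (mQSymHopf (Polynomial ℤ)).IsLCHopfSubalgebra mPiBarSym (multipeakBar Polynomial.X) ∧
    Set.image extendScalars mPiBarSym = Set.range extendScalars ∩ mPeakRat ∧
    mPeak ⊆ mPiBarSym :=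
  ⟨isLCHopfSubalgebra_multipeak _ two_ne_zero, isLCHopfSubalgebra_multipeakBar _,
    image_extendScalars_mPiBarSym, pseudospan_multipeak_subset _⟩
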